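/- Let $\mathbb T\subseteq\mathbb R$ be a time scale (a nonempty closed set), $A,a,b\in\mathbb T$ with $A\le a<b$, and $[A,b]:=\{t\in\mathbb T: A\le t\le b\}$, similarly $[a,b]$. Let $\rho,\sigma$ be the backward and forward jump operators (with $\rho(\min)=\min$ and $\sigma(\max)=\max$), $x^{\rho}=x\circ\rho$, and $x^{\nabla}$ the nabla derivative, on the time scale $[A,b]$; there a point $t$ is left-dense (left-scattered) if $\rho(t)=t$ ($\rho(t)<t$), and right-dense (right-scattered) if $\sigma(t)=t$ ($\sigma(t)>t$). For a time scale $S$, $S_\kappa$ is $S$ without its minimum if that minimum is right-scattered in $S$, and $S_\kappa=S$ otherwise. A function is ld-continuous if it is continuous at left-dense points and has finite right-sided limits at right-dense points; $C_{ld}$ is the class of these functions, and $C^1_{ld}$ that of nabla differentiable functions with ld-continuous nabla derivative. The nabla integral is $\int_a^b h\,\nabla t=F(b)-F(a)$ with $F^\nabla=h$ on $[A,b]_\kappa$. Let $K$ be the set of all $t\in[a,b]_\kappa$ with $\rho(t)\ge a$; thus $K=[a,b]_\kappa$, except that the point $a$ is left out if it is left-scattered and right-dense in $[A,b]$. Let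 $f(t,x,v,z,s)$ and $g(t,x,v,z,s)$ be real functions on $[A,b]\times\mathbb R^4$ that for each $t$ have continuous partial derivatives in $x,v,z,s$, and suppose that $f$, $g$ and these partial derivatives are ld-continuous: jointly continuous at points of $[A,b]\times\mathbb R^4$ whose time is left-dense, with a finite limit as $(t',y')\to(t,y)$, $t'>t$, at points $(t,y)$ whose time $t$ is right-dense. Consider the problem to minimize (or maximize) $$\mathcal L[x,u]=\int_a^b f(t,x^\rho(t),u^\rho(t),x(a),x(b))\,\nabla t$$ over $x\in C^1_{ld}([A,b],\mathbb R)$, $u\in C_{ld}([A,b],\mathbb R)$, subject to $$x^\nabla(t)=g(t,x^\rho(t),u^\rho(t),x(a),x(b))\quad (t\in K),$$ and to the endpoint conditions $x(a)=x_a$ and $x(b)=x_b$, each of which may be present or absent; an endpoint is free if its condition is absent. An extremizer is an admissible pair that is a weak local minimizer or a weak local maximizer, that is, minimizes or maximizes $\mathcal L$ among all admissible pairs in a neighbourhood with respect to $\sup_{[A,b]}|x^\rho|+\sup_{[A,b]_\kappa}|x^\nabla|+\sup_{[A,b]}|u^\rho|$. For $\lambda_0\in\mathbb R$ put $H^{\lambda_0}(t,x,v,p,z,s)=\lambda_0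 f(t,x,v,z,s)+p\,g(t,x,v,z,s)$, and let $H=H^1=f+pg$ be the Hamiltonian. With $(\cdots)=(t,\tilde x^\rho(t),\tilde u^\rho(t),p(t),\tilde x(a),\tilde x(b))$, consider for $p\in C^1_{ld}([A,b],\mathbb R)$ the conditions 1. $p^\nabla(t)=-H^{\lambda_0}_x(\cdots)$ for all $t\in K$; 2. $H^{\lambda_0}_v(\cdots)=0$ for all $t\in K$; 3. $p(a)=-\int_a^b H^{\lambda_0}_z(\cdots)\,\nabla t$ if $x(a)$ is free; 4. $p(b)=\int_a^b H^{\lambda_0}_s(\cdots)\,\nabla t$ if $x(b)$ is free. An extremizer $(\tilde x,\tilde u)$ is normal if no $p\in C^1_{ld}([A,b],\mathbb R)$ that is not identically zero on $[a,b]$ satisfies 1--4 with $\lambda_0=0$. **Theorem.** If $(\tilde x,\tilde u)$ is a normal extremizer, then there is a function $\tilde p\in C^1_{ld}([A,b],\mathbb R)$ such that, with $p=\tilde p$ in $(\cdots)$, for all $t\in K$ $$\tilde x^\nabla(t)=H_p(\cdots),\qquad \tilde p^\nabla(t)=-H_x(\cdots),\qquad H_v(\cdots)=0,$$ and $\tilde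 p(a)=-\int_a^b H_z(\cdots)\,\nabla t$ if $x(a)$ is free, and $\tilde p(b)=\int_a^b H_s(\cdots)\,\nabla t$ if $x(b)$ is free. -/

import Mathlib

open Set Filter Topology

noncomputable section

/-! ### Nabla calculus on a time scale

A time scale is a nonempty closed set `T` of reals. A function on `T` is represented by a
function `ℝ → ℝ`; none of the notions below looks at its values outside `T`. -/

namespace TimeScale

open Classical in
/-- Backward jump: the supremum of the points of `T` below `t`; the minimum of `T` is fixed. -/
def rho (T : Set ℝ) (t : ℝ) : ℝ :=
  if (T ∩ Iio t).Nonempty then sSup (T ∩ Iio t) else t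

open Classical in
/-- Forward jump: the infimum of the points of `T` above `t`; the maximum of `T` is fixed. -/
def sigma (T : Set ℝ) (t : ℝ) : ℝ :=
  if (T ∩ Ioi t).Nonempty then sInf (T ∩ Ioi t) else t

/-- `T_κ`: the time scale `T` without its minimum if that minimum is right-scattered. -/
def kappa (T : Set ℝ) : Set ℝ :=
  {t | t ∈ T ∧ ¬ (IsLeast T t ∧ t < sigma T t)}

/-- `d` is a nabla derivative of `x` at `t`. -/
def HasNablaDerivAt (T : Set ℝ) (x : ℝ → ℝ) (d t : ℝ) : Prop :=
  ∀ ε > 0, ∃ δ > 0, ∀ s ∈ T, |s - t| < δ →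
    |x (rho T t) - x s - d * (rho T t - s)| ≤ ε * |rho T t - s|

open Classical in
/-- The nabla derivative of `x` at `t` (zero where there is none). -/
def nablaDeriv (T : Set ℝ) (x : ℝ → ℝ) (t : ℝ) : ℝ :=
  if h : ∃ d, HasNablaDerivAt T x d t then h.choose else 0

/-- `x` is ld-continuous: continuous at left-dense points, with finite right-sided limits at
right-dense points. -/
def LdContinuous (T : Set ℝ) (x : ℝ → ℝ) : Prop :=
  ∀ t ∈ T, (rho T t = t → ContinuousWithinAt x T t) ∧
    (sigma T t = t → ∃ l, Tendsto x (𝓝[T ∩ Ioi t] t) (𝓝 l))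

/-- The class `C¹_ld`: nabla differentiable functions with ld-continuous nabla derivative.
(A point of `T` outside `T_κ` is isolated, so the value of the derivative there is immaterial.) -/
def C1ld (T : Set ℝ) (x : ℝ → ℝ) : Prop :=
  (∀ t ∈ kappa T, ∃ d, HasNablaDerivAt T x d t) ∧ LdContinuous T (nablaDeriv T x)

/-- `F` is a nabla antiderivative of `h`. -/
def IsNablaAntideriv (T : Set ℝ) (F h : ℝ → ℝ) : Prop :=
  ∀ t ∈ kappa T, HasNablaDerivAt T F (h t) t

open Classical in
/-- The nabla integral of `h` from `a` to `b`, namely `F b - F a` for a nabla antiderivative `F`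
of `h` (there is one if `h` is ld-continuous). -/
def nablaIntegral (T : Set ℝ) (h : ℝ → ℝ) (a b : ℝ) : ℝ :=
  if H : ∃ F, IsNablaAntideriv T F h then H.choose b - H.choose a else 0

/-- `sup |x^ρ|` over the time scale. -/
def supRho (T : Set ℝ) (x : ℝ → ℝ) : ℝ :=
  sSup ((fun t => |x (rho T t)|) '' T)

/-- The norm `‖x‖₁ = sup |x^ρ| + sup |x^∇|`. -/
def normOne (T : Set ℝ) (x : ℝ → ℝ) : ℝ :=
  supRho T x + sSup ((fun t => |nablaDeriv T x t|) '' kappa T)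

/-- Joint ld-continuity of `F (t, x, v, z, s)` on `T × ℝ⁴`: `F` is continuous at the points whose
time is left-dense, and it has a finite limit from the right in time at the points whose time is
right-dense. -/
def JointlyLdContinuous (T : Set ℝ) (F : ℝ → ℝ → ℝ → ℝ → ℝ → ℝ) : Prop :=
  ∀ t ∈ T, ∀ y : ℝ × ℝ × ℝ × ℝ,
    (rho T t = t →
      ContinuousWithinAt
        (fun q : ℝ × (ℝ × ℝ × ℝ × ℝ) => F q.1 q.2.1 q.2.2.1 q.2.2.2.1 q.2.2.2.2)
        (T ×ˢ univ) (t, y)) ∧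
    (sigma T t = t → ∃ l,
      Tendsto
        (fun q : ℝ × (ℝ × ℝ × ℝ × ℝ) => F q.1 q.2.1 q.2.2.1 q.2.2.2.1 q.2.2.2.2)
        (𝓝[(T ∩ Ioi t) ×ˢ univ] (t, y)) (𝓝 l))

/-- For each `t` the function `F (t, ·)` has continuous partial derivatives on `ℝ⁴`, and `F` and
its four partial derivatives are ld-continuous. -/
structure IsRegular (T : Set ℝ) (F : ℝ → ℝ → ℝ → ℝ → ℝ → ℝ) : Prop where
  contDiff : ∀ t ∈ T,
    ContDiff ℝ 1 (fun y : ℝ × ℝ × ℝ × ℝ => F t y.1 y.2.1 y.2.2.1 y.2.2.2)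
  ld : JointlyLdContinuous T F
  ld_x : JointlyLdContinuous T (fun t x v z s => deriv (fun r => F t r v z s) x)
  ld_v : JointlyLdContinuous T (fun t x v z s => deriv (fun r => F t x r z s) v)
  ld_z : JointlyLdContinuous T (fun t x v z s => deriv (fun r => F t x v r s) z)
  ld_s : JointlyLdContinuous T (fun t x v z s => deriv (fun r => F t x v z r) s)

end TimeScale

open TimeScale

/-- The data of the optimal control problem: minimize or maximize
`∫_a^b f (t, x^ρ, u^ρ, x(a), x(b)) ∇t` subject to `x^∇ = g (t, x^ρ, u^ρ, x(a), x(b))` and to the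
endpoint conditions that are present: `xa = some c` means `x(a) = c`, and `xa = none` means that
`x(a)` is free; likewise for `xb`. The functions `x`, `u` live on the part `[A, b]` of `T`. -/
structure ControlProblem where
  T : Set ℝ
  A : ℝ
  a : ℝ
  b : ℝ
  f : ℝ → ℝ → ℝ → ℝ → ℝ → ℝ
  g : ℝ → ℝ → ℝ → ℝ → ℝ → ℝ
  xa : Option ℝ
  xb : Option ℝ

namespace ControlProblem

/-- The time scale `[A, b]`. -/
def S (P : ControlProblem) : Set ℝ := P.T ∩ Icc P.A P.b

/-- The time scale `[a, b]`. -/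
def I (P : ControlProblem) : Set ℝ := P.T ∩ Icc P.a P.b

/-- The points of `[a, b]_κ` whose predecessor is in `[a, b]`. This is `[a, b]_κ`, except that
`a` is left out when it is left-scattered and right-dense: nothing that happens at `ρ(a) < a`
enters the integral from `a` to `b`. -/
def K (P : ControlProblem) : Set ℝ := {t | t ∈ kappa P.I ∧ P.a ≤ rho P.S t}

/-- The standing assumptions on the data. -/
structure StandingAssumptions (P : ControlProblem) : Prop where
  closed : IsClosed P.T
  A_mem : P.A ∈ P.T
  a_mem : P.a ∈ P.T
  b_mem : P.b ∈ P.T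
  A_le_a : P.A ≤ P.a
  a_lt_b : P.a < P.b
  regular_f : IsRegular P.S P.f
  regular_g : IsRegular P.S P.g

/-- The objective functional. -/
def objective (P : ControlProblem) (x u : ℝ → ℝ) : ℝ :=
  nablaIntegral P.S
    (fun t => P.f t (x (rho P.S t)) (u (rho P.S t)) (x P.a) (x P.b)) P.a P.b

/-- Admissible pairs. -/
structure Admissible (P : ControlProblem) (x u : ℝ → ℝ) : Prop where
  state : C1ld P.S x
  control : LdContinuous P.S u
  dynamics : ∀ t ∈ P.K,
    HasNablaDerivAt P.S x (P.g t (x (rho P.S t)) (u (rho P.S t)) (x P.a) (x P.b)) t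
  left : ∀ c, P.xa = some c → x P.a = c
  right : ∀ c, P.xb = some c → x P.b = c

/-- Distance of two pairs in the norm `‖x‖₁ + sup |u^ρ|`. -/
def pairDist (P : ControlProblem) (x u y w : ℝ → ℝ) : ℝ :=
  normOne P.S (fun t => x t - y t) + supRho P.S (fun t => u t - w t)

/-- Weak local minimizers. -/
def IsWeakLocalMin (P : ControlProblem) (x u : ℝ → ℝ) : Prop :=
  P.Admissible x u ∧ ∃ δ > 0, ∀ y w, P.Admissible y w → P.pairDist y w x u < δ →
    P.objective x u ≤ P.objective y w

/-- Weak local maximizers. -/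
def IsWeakLocalMax (P : ControlProblem) (x u : ℝ → ℝ) : Prop :=
  P.Admissible x u ∧ ∃ δ > 0, ∀ y w, P.Admissible y w → P.pairDist y w x u < δ →
    P.objective y w ≤ P.objective x u

/-- Extremizers. -/
def IsExtremizer (P : ControlProblem) (x u : ℝ → ℝ) : Prop :=
  P.IsWeakLocalMin x u ∨ P.IsWeakLocalMax x u

/-- The Hamiltonian `l f + p g` with cost multiplier `l`; the normal case is `l = 1`, the
abnormal case `l = 0`. -/
def H (P : ControlProblem) (l t x v p z s : ℝ) : ℝ :=
  l * P.f t x v z s + p * P.g t x v z s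

/-- `p` is an abnormal costate along `(x, u)`: it is not identically zero on `[a, b]`, and it
satisfies the adjoint equation, the stationarity condition and the transversality conditions with
the cost multiplier zero. -/
structure IsAbnormalCostate (P : ControlProblem) (x u p : ℝ → ℝ) : Prop where
  smooth : C1ld P.S p
  nontrivial : ∃ t ∈ P.I, p t ≠ 0
  adjoint : ∀ t ∈ P.K, HasNablaDerivAt P.S p
    (-deriv (fun r => P.H 0 t r (u (rho P.S t)) (p t) (x P.a) (x P.b)) (x (rho P.S t))) t
  stationary : ∀ t ∈ P.K,
    deriv (fun r => P.H 0 t (x (rho P.S t)) r (p t) (x P.a) (x P.b)) (u (rho P.S t)) = 0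
  left : P.xa = none → p P.a = -nablaIntegral P.S (fun t =>
    deriv (fun r => P.H 0 t (x (rho P.S t)) (u (rho P.S t)) (p t) r (x P.b)) (x P.a)) P.a P.b
  right : P.xb = none → p P.b = nablaIntegral P.S (fun t =>
    deriv (fun r => P.H 0 t (x (rho P.S t)) (u (rho P.S t)) (p t) (x P.a) r) (x P.b)) P.a P.b

/-- A normal extremizer: an extremizer that admits no multiplier with zero cost multiplier. -/
def IsNormalExtremizer (P : ControlProblem) (x u : ℝ → ℝ) : Prop :=
  P.IsExtremizer x u ∧ ¬ ∃ p, P.IsAbnormalCostate x u p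

end ControlProblem

end

/-!
Why the theorem holds. Fix the extremizer `(x, u)` and perturb it: let the control change by `ω`,
the initial state by `z`, and the argument of `f` and `g` for the final state by `s`. The dynamics
determine the change `ξ` of the state. The perturbed pair is admissible if the single scalar
constraint `ξ(b) = s` holds and `z`, `s` respect the endpoint conditions. So the infinite
dimensional problem has only one real equality constraint, and testing it on the span of two
perturbations is enough.

For a solution `p` of the adjoint equation with cost multiplier `l`, integration by parts in
`p(b) ξ(b) - p(a) z = ∫ (p ξ)^∇` eliminates `ξ` to first order (`Trajectory.exists_expansion`):
`p(b) (ξ(b) - s) + l · (change of the cost)` equals, up to a remainder of higher order,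
`p(a) z - p(b) s + ∫ (H_v ω^ρ + H_z z + H_s s)`, the quantity `Trajectory.lagrangeVar`.
With `l = 0`, `p₀(b) = 1` this is the derivative of the constraint, and with `l = 1`, `p₁(b) = 0`
the derivative of the cost. If the derivative of the constraint vanished in all directions, `p₀`
would be an abnormal costate; so normality gives a direction in which it does not vanish. Then the
constraint can be solved by the intermediate value theorem, and a multiplier rule for two real
parameters (`mul_eq_mul_of_constrained_min`) makes the derivative of the cost a multiple of the
derivative of the constraint. Hence the derivative of the Lagrangian for `p = p₁ + c p₀` vanishes,
for a suitable `c`. The transversality conditions are read off from the directions `z` and `s`, and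
`H_v = 0` from the directions `ω` (`Trajectory.eq_zero_of_integral_mul_eq_zero`).

The calculus on the time scale is reduced to Lebesgue integration: the nabla integral of an
ld-continuous `h` is the integral of `h ∘ ceil`, where `ceil τ` is the first point of the time
scale that is not before `τ` (`nablaIntegral_eq`). In these terms the state equation and the adjoint
equation are Volterra equations with a delayed or an advanced argument, solved by contraction
(`exists_volterra`). The functions `f` and `g` are only ld-continuous in time. Their first order
expansions are nevertheless uniform in time (`IsRegular.exists_linearization`), by compactness and
because they have joint limits from both sides.

A point `a` that is left-scattered and right-dense in `[A, b]` needs care, since `ρ(a) < a` there.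
The backward jump is cut off at `a` (`back`), so that nothing before `a` enters the equation for the
perturbation; to the left of `a` the state is continued in a way that keeps its nabla derivative
ld-continuous.
-/

namespace TimeScale

/-- `S` is a closed set with minimum `A` and maximum `b`, and it has at least two points. -/
structure Spans (S : Set ℝ) (A b : ℝ) : Prop where
  closed : IsClosed S
  left_mem : A ∈ S
  right_mem : b ∈ S
  lt : A < b
  subset : S ⊆ Icc A b

/-- The first point of `S` that is not before `τ`. If `S` has a point at or after `τ`, this is the
right end of the gap of `S` around `τ`, or `τ` itself if `τ ∈ S`. -/
noncomputable def ceil (S : Set ℝ) (τ : ℝ) : ℝ := sInf (S ∩ Ici τ)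

variable {S : Set ℝ} {A b : ℝ}

theorem Spans.isCompact (h : Spans S A b) : IsCompact S :=
  isCompact_Icc.of_isClosed_subset h.closed h.subset

/-! ### Jump operators -/

theorem rho_le (S : Set ℝ) (t : ℝ) : rho S t ≤ t := by
  unfold rho
  split_ifs with h
  · exact csSup_le h fun s hs => hs.2.le
  · exact le_rfl

theorem le_rho {s t : ℝ} (hs : s ∈ S) (hst : s < t) : s ≤ rho S t := by
  have hne : (S ∩ Iio t).Nonempty := ⟨s, hs, hst⟩
  unfold rho
  rw [if_pos hne]
  exact le_csSup ⟨t, fun r hr => hr.2.le⟩ ⟨hs, hst⟩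

theorem rho_mem (hS : IsClosed S) {t : ℝ} (ht : t ∈ S) : rho S t ∈ S := by
  unfold rho
  split_ifs with h
  · have : sSup (S ∩ Iio t) ∈ closure (S ∩ Iio t) :=
      csSup_mem_closure h ⟨t, fun r hr => hr.2.le⟩
    exact hS.closure_subset (closure_mono inter_subset_left this)
  · exact ht

theorem exists_mem_Ioo_of_rho_eq {s t : ℝ} (hs : s ∈ S) (hst : s < t) (ht : rho S t = t)
    {c : ℝ} (hc : c < t) : ∃ r ∈ S, c < r ∧ r < t := by
  have hne : (S ∩ Iio t).Nonempty := ⟨s, hs, hst⟩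
  unfold rho at ht
  rw [if_pos hne] at ht
  obtain ⟨r, hr, hcr⟩ := exists_lt_of_lt_csSup hne (ht.symm ▸ hc)
  exact ⟨r, hr.1, hcr, hr.2⟩

theorem le_sigma (S : Set ℝ) (t : ℝ) : t ≤ sigma S t := by
  unfold sigma
  split_ifs with h
  · exact le_csInf h fun s hs => hs.2.le
  · exact le_rfl

theorem sigma_le {s t : ℝ} (hs : s ∈ S) (hst : t < s) : sigma S t ≤ s := by
  have hne : (S ∩ Ioi t).Nonempty := ⟨s, hs, hst⟩
  unfold sigma
  rw [if_pos hne]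
  exact csInf_le ⟨t, fun r hr => hr.2.le⟩ ⟨hs, hst⟩

theorem exists_mem_Ioo_of_sigma_eq {s t : ℝ} (hs : s ∈ S) (hst : t < s) (ht : sigma S t = t)
    {c : ℝ} (hc : t < c) : ∃ r ∈ S, t < r ∧ r < c := by
  have hne : (S ∩ Ioi t).Nonempty := ⟨s, hs, hst⟩
  unfold sigma at ht
  rw [if_pos hne] at ht
  obtain ⟨r, hr, hcr⟩ := exists_lt_of_csInf_lt hne (ht.symm ▸ hc)
  exact ⟨r, hr.1, hr.2, hcr⟩

/-- A left-scattered point is a local minimum of the time scale. -/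
theorem eventually_le_of_rho_lt {t : ℝ} (ht : rho S t < t) : ∀ᶠ s in 𝓝[S] t, t ≤ s := by
  filter_upwards [self_mem_nhdsWithin, mem_nhdsWithin_of_mem_nhds (Ioi_mem_nhds ht)] with s hs h's
  by_contra! hlt
  exact absurd (le_rho hs hlt) (not_le.2 h's)

theorem nhdsWithin_Ioi_eq_bot_of_lt_sigma {t : ℝ} (ht : t < sigma S t) :
    𝓝[S ∩ Ioi t] t = ⊥ := by
  rw [← empty_mem_iff_bot]
  filter_upwards [self_mem_nhdsWithin, mem_nhdsWithin_of_mem_nhds (Iio_mem_nhds ht)] with s hs h's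
  exact absurd (sigma_le hs.1 hs.2) (not_le.2 h's)

/-! ### The first point not before a given real number -/

section ceil

theorem ceil_of_mem {t : ℝ} (ht : t ∈ S) : ceil S t = t :=
  le_antisymm (csInf_le ⟨t, fun _ hr => hr.2⟩ ⟨ht, Set.mem_Ici.2 le_rfl⟩)
    (le_csInf ⟨t, ht, Set.mem_Ici.2 le_rfl⟩ fun _ hr => hr.2)

theorem ceil_le {s τ : ℝ} (hs : s ∈ S) (h : τ ≤ s) : ceil S τ ≤ s :=
  csInf_le ⟨τ, fun _ hr => hr.2⟩ ⟨hs, h⟩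

theorem Spans.ceil_mem (h : Spans S A b) {τ : ℝ} (hτ : τ ≤ b) : ceil S τ ∈ S := by
  have : sInf (S ∩ Ici τ) ∈ closure (S ∩ Ici τ) :=
    csInf_mem_closure ⟨b, h.right_mem, hτ⟩ ⟨τ, fun r hr => hr.2⟩
  exact h.closed.closure_subset (closure_mono inter_subset_left this)

theorem Spans.le_ceil (h : Spans S A b) {τ : ℝ} (hτ : τ ≤ b) : τ ≤ ceil S τ :=
  le_csInf ⟨b, h.right_mem, hτ⟩ fun _ hr => hr.2

theorem Spans.rho_ceil_le (h : Spans S A b) {τ : ℝ} (hA : A ≤ τ) (hτ : τ ≤ b) :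
    rho S (ceil S τ) ≤ τ := by
  by_cases hm : τ ∈ S
  · rw [ceil_of_mem hm]; exact rho_le S τ
  · have hAlt : A < ceil S τ := by
      refine lt_of_lt_of_le (lt_of_le_of_ne hA ?_) (h.le_ceil hτ)
      rintro rfl
      exact hm h.left_mem
    unfold rho
    rw [if_pos ⟨A, h.left_mem, hAlt⟩]
    refine csSup_le ⟨A, h.left_mem, hAlt⟩ fun s hs => ?_
    by_contra! hlt
    exact absurd (ceil_le hs.1 hlt.le) (not_le.2 hs.2)

/-- On the half-open gap to the left of a left-scattered point `t` the next point is `t`. -/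
theorem ceil_of_gap {t τ : ℝ} (ht : t ∈ S) (h1 : rho S t < τ) (h2 : τ ≤ t) : ceil S τ = t := by
  refine le_antisymm (ceil_le ht h2) (le_csInf ⟨t, ht, h2⟩ fun s hs => ?_)
  by_contra! hlt
  exact absurd (le_rho hs.1 hlt) (not_le.2 (h1.trans_le hs.2))

theorem Spans.eventually_ceil_eq (h : Spans S A b) {τ : ℝ} (hA : A < τ) (hb : τ < b)
    (hτ : τ ∉ S) : ∀ᶠ τ' in 𝓝 τ, ceil S τ' = ceil S τ := by
  have hr : rho S (ceil S τ) < τ := by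
    refine lt_of_le_of_ne (h.rho_ceil_le hA.le hb.le) fun he => hτ ?_
    rw [← he]
    exact rho_mem h.closed (h.ceil_mem hb.le)
  have hl : τ < ceil S τ := by
    refine lt_of_le_of_ne (h.le_ceil hb.le) fun he => hτ ?_
    rw [he]
    exact h.ceil_mem hb.le
  filter_upwards [Ioo_mem_nhds hr hl] with τ' h'
  exact ceil_of_gap (h.ceil_mem hb.le) h'.1 h'.2.le

/-- The points that are left- or right-scattered; there are countably many. -/
def scattered (S : Set ℝ) : Set ℝ := {t | t ∈ S ∧ (rho S t < t ∨ t < sigma S t)}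

theorem countable_scattered (S : Set ℝ) : (scattered S).Countable := by
  have h := (countable_setOfPred_isolated_right_within (s := S)).union
    (countable_setOfPred_isolated_left_within (s := S))
  refine h.mono ?_
  rintro t ⟨ht, h1 | h1⟩
  · refine Or.inr ⟨ht, ?_⟩
    rw [← empty_mem_iff_bot]
    filter_upwards [self_mem_nhdsWithin, mem_nhdsWithin_of_mem_nhds (Ioi_mem_nhds h1)]
      with s hs h's
    exact absurd (le_rho hs.1 hs.2) (not_le.2 h's)
  · exact Or.inl ⟨ht, nhdsWithin_Ioi_eq_bot_of_lt_sigma h1⟩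

theorem dense_of_notMem_scattered {t : ℝ} (ht : t ∈ S) (h : t ∉ scattered S) :
    rho S t = t ∧ sigma S t = t := by
  constructor
  · by_contra hne
    exact h ⟨ht, Or.inl (lt_of_le_of_ne (rho_le S t) hne)⟩
  · by_contra hne
    exact h ⟨ht, Or.inr (lt_of_le_of_ne (le_sigma S t) (Ne.symm hne))⟩

theorem Spans.tendsto_ceil (h : Spans S A b) {t : ℝ} (hb : t < b)
    (hr : sigma S t = t) : Tendsto (ceil S) (𝓝 t) (𝓝[S] t) := by
  refine tendsto_nhdsWithin_iff.2 ⟨?_, ?_⟩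
  · rw [Metric.tendsto_nhds]
    intro ε hε
    obtain ⟨c, hc, htc, hce⟩ := exists_mem_Ioo_of_sigma_eq h.right_mem hb hr
      (c := t + ε) (by linarith)
    filter_upwards [Ioo_mem_nhds (show t - ε < t by linarith) htc] with τ hτ
    have h1 : ceil S τ ≤ c := ceil_le hc hτ.2.le
    have h2 : τ ≤ ceil S τ := h.le_ceil (hτ.2.le.trans (h.subset hc).2)
    rw [Real.dist_eq, abs_lt]
    constructor <;> linarith [hτ.1]
  · filter_upwards [Iio_mem_nhds hb] with τ hτ
    exact h.ceil_mem (le_of_lt hτ)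

end ceil

/-! ### Functions that are ld-continuous -/

theorem LdContinuous.congr {h k : ℝ → ℝ} (hh : LdContinuous S h) (hk : ∀ t ∈ S, k t = h t) :
    LdContinuous S k := by
  intro t ht
  refine ⟨fun hd => ((hh t ht).1 hd).congr (fun s hs => hk s hs) (hk t ht), fun hd => ?_⟩
  obtain ⟨l, hl⟩ := (hh t ht).2 hd
  refine ⟨l, hl.congr' ?_⟩
  filter_upwards [self_mem_nhdsWithin] with s hs
  exact (hk s hs.1).symm

theorem _root_.ContinuousOn.ldContinuous {h : ℝ → ℝ} (hh : ContinuousOn h S) :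
    LdContinuous S h := fun t ht =>
  ⟨fun _ => hh t ht, fun _ => ⟨h t, (hh t ht).mono inter_subset_left⟩⟩

theorem ldContinuous_const (c : ℝ) : LdContinuous S fun _ => c :=
  continuousOn_const.ldContinuous

theorem LdContinuous.add {h k : ℝ → ℝ} (hh : LdContinuous S h) (hk : LdContinuous S k) :
    LdContinuous S fun t => h t + k t := by
  intro t ht
  refine ⟨fun hd => ((hh t ht).1 hd).add ((hk t ht).1 hd), fun hd => ?_⟩
  obtain ⟨l, hl⟩ := (hh t ht).2 hd
  obtain ⟨m, hm⟩ := (hk t ht).2 hd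
  exact ⟨_, hl.add hm⟩

theorem LdContinuous.mul {h k : ℝ → ℝ} (hh : LdContinuous S h) (hk : LdContinuous S k) :
    LdContinuous S fun t => h t * k t := by
  intro t ht
  refine ⟨fun hd => ((hh t ht).1 hd).mul ((hk t ht).1 hd), fun hd => ?_⟩
  obtain ⟨l, hl⟩ := (hh t ht).2 hd
  obtain ⟨m, hm⟩ := (hk t ht).2 hd
  exact ⟨_, hl.mul hm⟩

theorem LdContinuous.const_mul {h : ℝ → ℝ} (c : ℝ) (hh : LdContinuous S h) :
    LdContinuous S fun t => c * h t := (ldContinuous_const c).mul hh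

theorem LdContinuous.neg {h : ℝ → ℝ} (hh : LdContinuous S h) :
    LdContinuous S fun t => -h t := (hh.const_mul (-1)).congr fun t _ => by ring

theorem LdContinuous.sub {h k : ℝ → ℝ} (hh : LdContinuous S h) (hk : LdContinuous S k) :
    LdContinuous S fun t => h t - k t := (hh.add hk.neg).congr fun t _ => by ring

/-- At a left-dense point the backward jump is continuous. -/
theorem tendsto_rho_of_rho_eq (hS : IsClosed S) {t : ℝ} (hd : rho S t = t) :
    Tendsto (rho S) (𝓝[S] t) (𝓝[S] t) := by
  refine tendsto_nhdsWithin_iff.2 ⟨?_, ?_⟩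
  · rw [Metric.tendsto_nhds]
    intro ε hε
    -- a bound from below for `ρ(s)`: a point of `S` close to `t`, or nothing if `t` is the minimum
    by_cases hmin : ∃ s ∈ S, s < t
    · obtain ⟨s0, hs0, hst0⟩ := hmin
      obtain ⟨c, hc, hc1, hc2⟩ := exists_mem_Ioo_of_rho_eq hs0 hst0 hd
        (c := t - ε) (by linarith)
      filter_upwards [self_mem_nhdsWithin, mem_nhdsWithin_of_mem_nhds
        (Ioo_mem_nhds hc2 (show t < t + ε by linarith))] with s hs hs'
      have := le_rho hc hs'.1
      have := rho_le S s
      rw [Real.dist_eq, abs_lt]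
      constructor <;> linarith [hs'.2]
    · push Not at hmin
      filter_upwards [self_mem_nhdsWithin, mem_nhdsWithin_of_mem_nhds
        (Iio_mem_nhds (show t < t + ε by linarith))] with s hs hs'
      have h1 := hmin _ (rho_mem hS hs)
      have := rho_le S s
      have h3 : s < t + ε := hs'
      rw [Real.dist_eq, abs_lt]
      constructor <;> linarith
  · filter_upwards [self_mem_nhdsWithin] with s hs
    exact rho_mem hS hs

/-- To the right of a right-dense point the backward jump stays to the right. -/
theorem tendsto_rho_of_sigma_eq (hS : IsClosed S) {t : ℝ} (hd : sigma S t = t) :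
    Tendsto (rho S) (𝓝[S ∩ Ioi t] t) (𝓝[S ∩ Ioi t] t) := by
  have hev : ∀ᶠ s in 𝓝[S ∩ Ioi t] t, s ∈ S ∩ Ioi t := self_mem_nhdsWithin
  have hgt : ∀ s ∈ S ∩ Ioi t, t < rho S s := by
    intro s hs
    obtain ⟨r, hr, h1, h2⟩ := exists_mem_Ioo_of_sigma_eq hs.1 hs.2 hd hs.2
    exact h1.trans_le (le_rho hr h2)
  refine tendsto_nhdsWithin_iff.2 ⟨?_, ?_⟩
  · have hid : Tendsto (fun s : ℝ => s) (𝓝[S ∩ Ioi t] t) (𝓝 t) := nhdsWithin_le_nhds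
    refine tendsto_of_tendsto_of_tendsto_of_le_of_le' tendsto_const_nhds hid ?_ ?_
    · filter_upwards [hev] with s hs using (hgt s hs).le
    · filter_upwards with s using rho_le S s
  · filter_upwards [hev] with s hs using ⟨rho_mem hS hs.1, hgt s hs⟩

theorem LdContinuous.comp_rho (hS : IsClosed S) {h : ℝ → ℝ} (hh : LdContinuous S h) :
    LdContinuous S fun t => h (rho S t) := by
  intro t ht
  refine ⟨fun hd => ?_, fun hd => ?_⟩
  · have h1 := (hh t ht).1 hd
    have : Tendsto (fun s => h (rho S s)) (𝓝[S] t) (𝓝 (h t)) :=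
      Tendsto.comp h1 (tendsto_rho_of_rho_eq hS hd)
    simpa only [ContinuousWithinAt, hd] using this
  · obtain ⟨l, hl⟩ := (hh t ht).2 hd
    exact ⟨l, hl.comp (tendsto_rho_of_sigma_eq hS hd)⟩

/-- Near a left-scattered point only the point itself and the points to its right matter. -/
theorem eventually_nhdsWithin_of_scattered {t : ℝ} (ht : rho S t < t) {p : ℝ → Prop}
    (h0 : p t) (h1 : ∀ᶠ s in 𝓝[S ∩ Ioi t] t, p s) : ∀ᶠ s in 𝓝[S] t, p s := by
  have h2 : ∀ᶠ s in 𝓝[S] t, s ∈ Ioi t → p s := by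
    rw [eventually_nhdsWithin_iff] at h1 ⊢
    filter_upwards [h1] with s hs h3 h4 using hs ⟨h3, h4⟩
  filter_upwards [h2, eventually_le_of_rho_lt ht] with s hs hs'
  rcases hs'.eq_or_lt with rfl | hlt
  · exact h0
  · exact hs hlt

/-- The case distinction behind local arguments on ld-continuous functions: a property holds near
`t` if it holds near `t` when `t` is left-dense, at `t`, and on the right of `t` when `t` is
right-dense. -/
theorem eventually_nhdsWithin_of_ld {t : ℝ} {p : ℝ → Prop}
    (hld : rho S t = t → ∀ᶠ s in 𝓝[S] t, p s) (h0 : p t)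
    (hrd : sigma S t = t → ∀ᶠ s in 𝓝[S ∩ Ioi t] t, p s) : ∀ᶠ s in 𝓝[S] t, p s := by
  rcases (rho_le S t).eq_or_lt with h | h
  · exact hld h
  · refine eventually_nhdsWithin_of_scattered h h0 ?_
    rcases (le_sigma S t).eq_or_lt with h' | h'
    · exact hrd h'.symm
    · rw [nhdsWithin_Ioi_eq_bot_of_lt_sigma h']
      exact eventually_bot

theorem LdContinuous.exists_bound (hS : IsCompact S) {h : ℝ → ℝ} (hh : LdContinuous S h) :
    ∃ B, 0 ≤ B ∧ ∀ t ∈ S, |h t| ≤ B := by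
  refine hS.induction_on (p := fun s => ∃ B, 0 ≤ B ∧ ∀ t ∈ s, |h t| ≤ B)
    ⟨0, le_rfl, by simp⟩ ?_ ?_ ?_
  · rintro s t hst ⟨B, hB, h1⟩
    exact ⟨B, hB, fun r hr => h1 r (hst hr)⟩
  · rintro s t ⟨B, hB, h1⟩ ⟨C, hC, h2⟩
    refine ⟨max B C, le_max_of_le_left hB, ?_⟩
    rintro r (hr | hr)
    · exact (h1 r hr).trans (le_max_left _ _)
    · exact (h2 r hr).trans (le_max_right _ _)
  · intro t ht
    have key : ∀ l, ∀ F : Filter ℝ, Tendsto h F (𝓝 l) → ∀ᶠ s in F, |h s| ≤ |l| + 1 := by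
      intro l F hF
      filter_upwards [hF.abs.eventually (Iio_mem_nhds (show |l| < |l| + 1 by linarith))] with s hs
      exact le_of_lt hs
    suffices hB : ∃ B, 0 ≤ B ∧ ∀ᶠ s in 𝓝[S] t, |h s| ≤ B by
      obtain ⟨B, hB0, hB⟩ := hB
      exact ⟨{s | |h s| ≤ B}, hB, B, hB0, fun s hs => hs⟩
    by_cases hσ : sigma S t = t
    · obtain ⟨l, hl⟩ := (hh t ht).2 hσ
      refine ⟨max (|h t| + 1) (|l| + 1), by positivity, eventually_nhdsWithin_of_ld ?_ ?_ ?_⟩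
      · intro hd
        filter_upwards [key _ _ ((hh t ht).1 hd)] with s hs using hs.trans (le_max_left _ _)
      · exact (by linarith : |h t| ≤ |h t| + 1).trans (le_max_left _ _)
      · intro _
        filter_upwards [key _ _ hl] with s hs using hs.trans (le_max_right _ _)
    · refine ⟨|h t| + 1, by positivity, eventually_nhdsWithin_of_ld ?_ (by linarith) ?_⟩
      · intro hd
        exact key _ _ ((hh t ht).1 hd)
      · intro h'
        exact absurd h' hσ

end TimeScale

namespace TimeScale

variable {S : Set ℝ} {A b : ℝ}

/-! ### The Lebesgue integral of a function of the next point -/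

open MeasureTheory intervalIntegral

theorem LdContinuous.continuousAt_comp_ceil (hS : Spans S A b) {h : ℝ → ℝ}
    (hh : LdContinuous S h) {τ : ℝ} (hτ : τ ∈ Ioo A b) (hs : τ ∉ scattered S) :
    ContinuousAt (fun τ => h (ceil S τ)) τ := by
  by_cases hm : τ ∈ S
  · obtain ⟨h1, h2⟩ := dense_of_notMem_scattered hm hs
    have h3 : Tendsto h (𝓝[S] τ) (𝓝 (h τ)) := (hh τ hm).1 h1
    have h4 := h3.comp (hS.tendsto_ceil hτ.2 h2)
    simpa only [ContinuousAt, Function.comp_def, ceil_of_mem hm] using h4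
  · refine (continuousAt_const (y := h (ceil S τ))).congr ?_
    filter_upwards [hS.eventually_ceil_eq hτ.1 hτ.2 hm] with τ' h'
    rw [h']

theorem LdContinuous.aestronglyMeasurable (hS : Spans S A b) {h : ℝ → ℝ}
    (hh : LdContinuous S h) :
    AEStronglyMeasurable (fun τ => h (ceil S τ)) (volume.restrict (Icc A b)) := by
  have hc : ContinuousOn (fun τ => h (ceil S τ)) (Ioo A b \ scattered S) := fun τ hτ =>
    (hh.continuousAt_comp_ceil hS hτ.1 hτ.2).continuousWithinAt
  have hm := hc.aestronglyMeasurable (μ := volume)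
    (measurableSet_Ioo.diff (countable_scattered S).measurableSet)
  have he : (Ioo A b \ scattered S : Set ℝ) =ᵐ[volume] Icc A b := by
    refine (sdiff_ae_eq_self.2 ?_).trans Ioo_ae_eq_Icc
    exact measure_mono_null inter_subset_right ((countable_scattered S).measure_zero _)
  rwa [Measure.restrict_congr_set he] at hm

theorem LdContinuous.intervalIntegrable (hS : Spans S A b) {h : ℝ → ℝ}
    (hh : LdContinuous S h) {c d : ℝ} (hc : c ∈ Icc A b) (hd : d ∈ Icc A b) :
    IntervalIntegrable (fun τ => h (ceil S τ)) volume c d := by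
  obtain ⟨B, -, hB⟩ := hh.exists_bound hS.isCompact
  have hi : IntegrableOn (fun τ => h (ceil S τ)) (Icc A b) volume := by
    refine Integrable.of_bound (hh.aestronglyMeasurable hS) B ?_
    filter_upwards [ae_restrict_mem measurableSet_Icc] with τ hτ
    exact hB _ (hS.ceil_mem hτ.2)
  have hsub : uIcc c d ⊆ Icc A b := uIcc_subset_Icc hc hd
  exact (hi.mono_set hsub).intervalIntegrable

/-! ### Nabla derivatives -/

theorem HasNablaDerivAt.const_add {x : ℝ → ℝ} {d t : ℝ} (hx : HasNablaDerivAt S x d t) (c : ℝ) :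
    HasNablaDerivAt S (fun s => c + x s) d t := by
  intro ε hε
  obtain ⟨δ, hδ, h⟩ := hx ε hε
  refine ⟨δ, hδ, fun s hs hst => ?_⟩
  rw [add_sub_add_left_eq_sub]
  exact h s hs hst

theorem HasNablaDerivAt.congr {x y : ℝ → ℝ} {d t : ℝ} (hS : IsClosed S) (ht : t ∈ S)
    (hx : HasNablaDerivAt S x d t) (h : ∀ s ∈ S, y s = x s) : HasNablaDerivAt S y d t := by
  intro ε hε
  obtain ⟨δ, hδ, h'⟩ := hx ε hε
  refine ⟨δ, hδ, fun s hs hst => ?_⟩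
  rw [h s hs, h _ (rho_mem hS ht)]
  exact h' s hs hst

theorem HasNablaDerivAt.add {x y : ℝ → ℝ} {d e t : ℝ} (hx : HasNablaDerivAt S x d t)
    (hy : HasNablaDerivAt S y e t) : HasNablaDerivAt S (fun s => x s + y s) (d + e) t := by
  intro ε hε
  obtain ⟨δ, hδ, h⟩ := hx (ε / 2) (by positivity)
  obtain ⟨δ', hδ', h'⟩ := hy (ε / 2) (by positivity)
  refine ⟨min δ δ', lt_min hδ hδ', fun s hs hst => ?_⟩
  have h1 := h s hs (hst.trans_le (min_le_left _ _))
  have h2 := h' s hs (hst.trans_le (min_le_right _ _))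
  calc _ = |(x (rho S t) - x s - d * (rho S t - s)) + (y (rho S t) - y s - e * (rho S t - s))| := by
        congr 1; ring
    _ ≤ _ := (abs_add_le _ _).trans (by linarith)

theorem HasNablaDerivAt.neg {x : ℝ → ℝ} {d t : ℝ} (hx : HasNablaDerivAt S x d t) :
    HasNablaDerivAt S (fun s => -x s) (-d) t := by
  intro ε hε
  obtain ⟨δ, hδ, h⟩ := hx ε hε
  refine ⟨δ, hδ, fun s hs hst => ?_⟩
  rw [show -x (rho S t) - -x s - -d * (rho S t - s) = -(x (rho S t) - x s - d * (rho S t - s)) by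
    ring, abs_neg]
  exact h s hs hst

theorem HasNablaDerivAt.sub {x y : ℝ → ℝ} {d e t : ℝ} (hx : HasNablaDerivAt S x d t)
    (hy : HasNablaDerivAt S y e t) : HasNablaDerivAt S (fun s => x s - y s) (d - e) t := by
  simpa only [sub_eq_add_neg] using hx.add hy.neg

theorem HasNablaDerivAt.continuousWithinAt {x : ℝ → ℝ} {d t : ℝ} (ht : t ∈ S)
    (hx : HasNablaDerivAt S x d t) : ContinuousWithinAt x S t := by
  rw [Metric.continuousWithinAt_iff]
  intro ε hε
  set μ := t - rho S t with hμ
  have hμ0 : 0 ≤ μ := sub_nonneg.2 (rho_le S t)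
  -- the derivative is used with an error factor that makes up for the step `μ`
  obtain ⟨δ, hδ, h⟩ := hx (ε / (4 * (μ + 1))) (by positivity)
  refine ⟨min (min δ 1) (ε / (4 * (|d| + 1))), by positivity, fun {s} hs hst => ?_⟩
  rw [Real.dist_eq] at hst
  have h1 : |s - t| < δ := hst.trans_le ((min_le_left _ _).trans (min_le_left _ _))
  have h2 : |s - t| < 1 := hst.trans_le ((min_le_left _ _).trans (min_le_right _ _))
  have h3 : |s - t| < ε / (4 * (|d| + 1)) := hst.trans_le (min_le_right _ _)
  have h4 := h s hs h1
  have h5 := h t ht (by simpa using hδ)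
  have h6 : |rho S t - s| ≤ μ + 1 := by
    calc |rho S t - s| = |-μ - (s - t)| := by rw [hμ]; congr 1; ring
      _ ≤ μ + 1 := by
        refine (abs_sub _ _).trans ?_
        rw [abs_neg, abs_of_nonneg hμ0]; linarith
  have h7 : |rho S t - t| ≤ μ + 1 := by
    rw [abs_sub_comm, ← hμ, abs_of_nonneg hμ0]; linarith
  have h8 : ε / (4 * (μ + 1)) * (μ + 1) = ε / 4 := by field_simp
  have h9 : |d| * |s - t| ≤ ε / 4 := by
    have h10 : |d| * |s - t| ≤ (|d| + 1) * (ε / (4 * (|d| + 1))) := by gcongr; linarith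
    have h11 : (|d| + 1) * (ε / (4 * (|d| + 1))) = ε / 4 := by field_simp
    linarith
  have h12 : ε / (4 * (μ + 1)) * |rho S t - s| ≤ ε / 4 := by rw [← h8]; gcongr
  have h13 : ε / (4 * (μ + 1)) * |rho S t - t| ≤ ε / 4 := by rw [← h8]; gcongr
  rw [Real.dist_eq]
  calc |x s - x t| = |(x (rho S t) - x t - d * (rho S t - t)) -
        (x (rho S t) - x s - d * (rho S t - s)) + d * (s - t)| := by congr 1; ring
    _ ≤ |x (rho S t) - x t - d * (rho S t - t)| +
        |x (rho S t) - x s - d * (rho S t - s)| + |d * (s - t)| :=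
        (abs_add_le _ _).trans (add_le_add_left (abs_sub _ _) _)
    _ < ε := by rw [abs_mul]; linarith

theorem HasNablaDerivAt.mul {x y : ℝ → ℝ} {d e t : ℝ} (ht : t ∈ S)
    (hx : HasNablaDerivAt S x d t) (hy : HasNablaDerivAt S y e t) :
    HasNablaDerivAt S (fun s => x s * y s) (x t * e + d * y (rho S t)) t := by
  intro ε hε
  have hc := hx.continuousWithinAt ht
  set B := |x t| + 1 with hB
  set C := |y (rho S t)| + 1 with hC
  have hB0 : B ≠ 0 := by positivity
  have hC0 : C ≠ 0 := by positivity
  obtain ⟨δ, hδ, h⟩ := hx (ε / (3 * C)) (by positivity)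
  obtain ⟨δ', hδ', h'⟩ := hy (ε / (3 * B)) (by positivity)
  rw [Metric.continuousWithinAt_iff] at hc
  obtain ⟨δ1, hδ1, h1⟩ := hc (min 1 (ε / (3 * (|e| + 1)))) (by positivity)
  refine ⟨min (min δ δ') δ1, by positivity, fun s hs hst => ?_⟩
  have k1 := h s hs (hst.trans_le ((min_le_left _ _).trans (min_le_left _ _)))
  have k2 := h' s hs (hst.trans_le ((min_le_left _ _).trans (min_le_right _ _)))
  have k3 := h1 hs (hst.trans_le (min_le_right _ _))
  rw [Real.dist_eq] at k3
  have k4 : |x s - x t| ≤ 1 := (k3.trans_le (min_le_left _ _)).le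
  have k5 : |x s - x t| ≤ ε / (3 * (|e| + 1)) := (k3.trans_le (min_le_right _ _)).le
  have k6 : |x s| ≤ B := by
    calc |x s| = |x t + (x s - x t)| := by congr 1; ring
      _ ≤ B := (abs_add_le _ _).trans (by linarith)
  set R := |rho S t - s| with hR
  have hR0 : 0 ≤ R := abs_nonneg _
  have l1 : |y (rho S t)| * |x (rho S t) - x s - d * (rho S t - s)| ≤ ε / 3 * R := by
    calc _ ≤ C * (ε / (3 * C) * R) := by gcongr; linarith
      _ = ε / 3 * R := by field_simp
  have l2 : |x s| * |y (rho S t) - y s - e * (rho S t - s)| ≤ ε / 3 * R := by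
    calc _ ≤ B * (ε / (3 * B) * R) := by gcongr
      _ = ε / 3 * R := by field_simp
  have l3 : |x s - x t| * (|e| * R) ≤ ε / 3 * R := by
    calc _ ≤ ε / (3 * (|e| + 1)) * ((|e| + 1) * R) := by gcongr; linarith
      _ = ε / 3 * R := by field_simp
  calc _ = |y (rho S t) * (x (rho S t) - x s - d * (rho S t - s)) +
        x s * (y (rho S t) - y s - e * (rho S t - s)) + (x s - x t) * (e * (rho S t - s))| := by
        congr 1; ring
    _ ≤ |y (rho S t) * (x (rho S t) - x s - d * (rho S t - s))| +
        |x s * (y (rho S t) - y s - e * (rho S t - s))| + |(x s - x t) * (e * (rho S t - s))| :=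
        abs_add_three _ _ _
    _ ≤ ε * R := by
        rw [abs_mul, abs_mul, abs_mul (x s - x t), abs_mul e]; linarith

/-- The nabla derivative is unique at the points of `S_κ`. -/
theorem HasNablaDerivAt.unique (hS : Spans S A b) {x : ℝ → ℝ} {d e t : ℝ} (ht : t ∈ kappa S)
    (hd : HasNablaDerivAt S x d t) (he : HasNablaDerivAt S x e t) : d = e := by
  have h0 : HasNablaDerivAt S (fun _ => 0) (d - e) t := by simpa using hd.sub he
  -- points `s ≠ ρ(t)` arbitrarily close to `t`
  have key : ∀ δ > 0, ∃ s ∈ S, |s - t| < δ ∧ rho S t ≠ s := by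
    intro δ hδ
    rcases (rho_le S t).lt_or_eq with hlt | heq
    · exact ⟨t, ht.1, by simpa using hδ, hlt.ne⟩
    · rw [heq]
      rcases (hS.subset ht.1).1.eq_or_lt with hA | hA
      · have hσ : sigma S t = t := by
          by_contra hne
          refine ht.2 ⟨⟨ht.1, fun s hs => ?_⟩, lt_of_le_of_ne (le_sigma S t) (Ne.symm hne)⟩
          rw [← hA]
          exact (hS.subset hs).1
        obtain ⟨s, hs, h1, h2⟩ := exists_mem_Ioo_of_sigma_eq hS.right_mem (hA ▸ hS.lt) hσ
          (show t < t + δ by linarith)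
        exact ⟨s, hs, by rw [abs_lt]; constructor <;> linarith, h1.ne⟩
      · obtain ⟨s, hs, h1, h2⟩ := exists_mem_Ioo_of_rho_eq hS.left_mem hA heq
          (show t - δ < t by linarith)
        exact ⟨s, hs, by rw [abs_lt]; constructor <;> linarith, h2.ne'⟩
  by_contra hne
  have hpos : 0 < |d - e| := abs_pos.2 (sub_ne_zero.2 hne)
  obtain ⟨δ, hδ, h⟩ := h0 (|d - e| / 2) (by positivity)
  obtain ⟨s, hs, hst, hsr⟩ := key δ hδ
  have h1 := h s hs hst
  have h2 : 0 < |rho S t - s| := abs_pos.2 (sub_ne_zero.2 hsr)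
  rw [sub_self, zero_sub, abs_neg, abs_mul] at h1
  nlinarith

theorem HasNablaDerivAt.nablaDeriv_eq (hS : Spans S A b) {x : ℝ → ℝ} {d t : ℝ}
    (ht : t ∈ kappa S) (hd : HasNablaDerivAt S x d t) : nablaDeriv S x t = d := by
  have hex : ∃ d, HasNablaDerivAt S x d t := ⟨d, hd⟩
  unfold nablaDeriv
  rw [dif_pos hex]
  exact hex.choose_spec.unique hS ht hd

/-- The point of `S` outside `S_κ`, if there is one, is isolated. -/
theorem nhdsWithin_eq_pure_of_notMem_kappa {t : ℝ} (ht : t ∈ S) (hk : t ∉ kappa S) :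
    𝓝[S] t = pure t := by
  have h : IsLeast S t ∧ t < sigma S t := by
    by_contra hne
    exact hk ⟨ht, hne⟩
  refine le_antisymm ?_ (pure_le_nhdsWithin ht)
  rw [le_pure_iff]
  filter_upwards [self_mem_nhdsWithin, mem_nhdsWithin_of_mem_nhds (Iio_mem_nhds h.2)] with s hs h's
  rcases (h.1.2 hs).eq_or_lt with h1 | h1
  · exact h1.symm
  · exact absurd (sigma_le hs h1) (not_le.2 h's)

theorem LdContinuous.congr_kappa {h k : ℝ → ℝ} (hh : LdContinuous S h)
    (hk : ∀ t ∈ kappa S, k t = h t) : LdContinuous S k := by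
  intro t ht
  by_cases hκ : t ∈ kappa S
  · have hev : ∀ᶠ s in 𝓝[S] t, k s = h s := by
      by_cases hm : IsLeast S t
      · -- the minimum is the only point that could be outside `S_κ`
        filter_upwards [self_mem_nhdsWithin] with s hs
        refine hk s ⟨hs, fun h' => ?_⟩
        have : s = t := h'.1.unique hm
        exact hκ.2 (this ▸ h')
      · obtain ⟨r, hr, hrt⟩ : ∃ r ∈ S, r < t := by
          by_contra! hno
          exact hm ⟨ht, fun s hs => hno s hs⟩
        filter_upwards [self_mem_nhdsWithin, mem_nhdsWithin_of_mem_nhds (Ioi_mem_nhds hrt)]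
          with s hs hs'
        exact hk s ⟨hs, fun h' => absurd (h'.1.2 hr) (not_le.2 hs')⟩
    refine ⟨fun hd => ((hh t ht).1 hd).congr_of_eventuallyEq hev (hk t hκ), fun hd => ?_⟩
    obtain ⟨l, hl⟩ := (hh t ht).2 hd
    refine ⟨l, hl.congr' ?_⟩
    filter_upwards [nhdsWithin_mono t inter_subset_left hev] with s hs using hs.symm
  · have hp := nhdsWithin_eq_pure_of_notMem_kappa ht hκ
    refine ⟨fun _ => ?_, fun _ => ⟨k t, ?_⟩⟩
    · unfold ContinuousWithinAt
      rw [hp]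
      exact tendsto_pure_nhds k t
    · exact (hp ▸ tendsto_pure_nhds k t : Tendsto k (𝓝[S] t) (𝓝 (k t))).mono_left
        (nhdsWithin_mono t inter_subset_left)

theorem c1ld_of_hasNablaDerivAt (hS : Spans S A b) {x h : ℝ → ℝ} (hh : LdContinuous S h)
    (hx : ∀ t ∈ kappa S, HasNablaDerivAt S x (h t) t) : C1ld S x :=
  ⟨fun t ht => ⟨h t, hx t ht⟩, hh.congr_kappa fun t ht => (hx t ht).nablaDeriv_eq hS ht⟩

theorem C1ld.hasNablaDerivAt (hS : Spans S A b) {x : ℝ → ℝ} (hx : C1ld S x) {t : ℝ}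
    (ht : t ∈ kappa S) : HasNablaDerivAt S x (nablaDeriv S x t) t := by
  obtain ⟨d, hd⟩ := hx.1 t ht
  rwa [hd.nablaDeriv_eq hS ht]

theorem continuousOn_of_hasNablaDerivAt {x h : ℝ → ℝ}
    (hx : ∀ t ∈ kappa S, HasNablaDerivAt S x (h t) t) : ContinuousOn x S := by
  intro t ht
  by_cases hκ : t ∈ kappa S
  · exact (hx t hκ).continuousWithinAt ht
  · unfold ContinuousWithinAt
    rw [nhdsWithin_eq_pure_of_notMem_kappa ht hκ]
    exact tendsto_pure_nhds x t

theorem C1ld.continuousOn (hS : Spans S A b) {x : ℝ → ℝ} (hx : C1ld S x) : ContinuousOn x S :=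
  continuousOn_of_hasNablaDerivAt fun _ ht => hx.hasNablaDerivAt hS ht

/-! ### The fundamental theorem of calculus -/

/-- The Lebesgue integral of `h` at the next point, as a function of its upper limit, is a nabla
antiderivative of `h`. -/
theorem hasNablaDerivAt_integral (hS : Spans S A b) {h : ℝ → ℝ} (hh : LdContinuous S h) {c : ℝ}
    (hc : c ∈ Icc A b) {t : ℝ} (ht : t ∈ S) :
    HasNablaDerivAt S (fun t => ∫ τ in c..t, h (ceil S τ)) (h t) t := by
  have hii : ∀ r ∈ S, ∀ s ∈ S, IntervalIntegrable (fun τ => h (ceil S τ)) volume r s :=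
    fun r hr s hs => hh.intervalIntegrable hS (hS.subset hr) (hS.subset hs)
  have hcc : ∀ s ∈ S, IntervalIntegrable (fun τ => h (ceil S τ)) volume c s :=
    fun s hs => hh.intervalIntegrable hS hc (hS.subset hs)
  have hsub : ∀ r ∈ S, ∀ s ∈ S, (∫ τ in c..r, h (ceil S τ)) - (∫ τ in c..s, h (ceil S τ)) -
      h t * (r - s) = ∫ τ in s..r, (h (ceil S τ) - h t) := by
    intro r hr s hs
    rw [integral_interval_sub_left (hcc r hr) (hcc s hs),
      integral_sub (hii s hs r hr) intervalIntegrable_const, intervalIntegral.integral_const, smul_eq_mul]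
    ring
  intro ε hε
  have hρ := rho_mem hS.closed ht
  rcases (rho_le S t).eq_or_lt with hd | hd
  · have h1 := (hh t ht).1 hd
    rw [Metric.continuousWithinAt_iff] at h1
    obtain ⟨δ, hδ, h2⟩ := h1 ε hε
    refine ⟨δ, hδ, fun s hs hst => ?_⟩
    rw [hsub _ hρ s hs, hd, ← Real.norm_eq_abs]
    refine norm_integral_le_of_norm_le_const fun τ hτ => ?_
    have hτb : τ ≤ b := hτ.2.trans (max_le (hS.subset hs).2 (hS.subset ht).2)
    have h3 := hS.le_ceil hτb
    have h4 : ceil S τ ≤ max s t := by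
      rcases le_total s t with h' | h'
      · rw [max_eq_right h']
        rw [uIoc_of_le h'] at hτ
        exact ceil_le ht hτ.2
      · rw [max_eq_left h']
        rw [uIoc_of_ge h'] at hτ
        exact ceil_le hs hτ.2
    have h5 : min s t < τ := hτ.1
    refine (h2 (hS.ceil_mem hτb) ?_).le
    rw [Real.dist_eq]
    rw [abs_lt] at hst ⊢
    rcases le_total s t with h' | h'
    · rw [max_eq_right h'] at h4; rw [min_eq_left h'] at h5
      constructor <;> linarith [hst.1]
    · rw [max_eq_left h'] at h4; rw [min_eq_right h'] at h5
      constructor <;> linarith [hst.2]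
  · obtain ⟨B, hB0, hB⟩ := hh.exists_bound hS.isCompact
    set μ := t - rho S t with hμ
    have hμ0 : 0 < μ := sub_pos.2 hd
    refine ⟨min μ (ε * μ / (2 * B + 1)), by positivity, fun s hs hst => ?_⟩
    have h1 : |s - t| < μ := hst.trans_le (min_le_left _ _)
    have h2 : |s - t| < ε * μ / (2 * B + 1) := hst.trans_le (min_le_right _ _)
    have hst : t ≤ s := by
      by_contra! hlt
      have := le_rho hs hlt
      rw [abs_lt] at h1
      linarith [h1.1]
    -- on `(ρ(t), t]` the integrand is constant, so only the part from `t` to `s` matters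
    have h3 : ∫ τ in s..rho S t, (h (ceil S τ) - h t) = ∫ τ in s..t, (h (ceil S τ) - h t) := by
      have hint : ∀ r ∈ S, ∀ s ∈ S,
          IntervalIntegrable (fun τ => h (ceil S τ) - h t) volume r s := fun r hr s hs =>
        (hii r hr s hs).sub intervalIntegrable_const
      rw [← integral_add_adjacent_intervals (hint s hs t ht) (hint t ht _ hρ)]
      have h4 : ∫ τ in t..rho S t, (h (ceil S τ) - h t) = ∫ τ in t..rho S t, (0 : ℝ) := by
        refine integral_congr_ae (Eventually.of_forall fun τ hτ => ?_)
        rw [uIoc_of_ge hd.le] at hτ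
        rw [ceil_of_gap ht hτ.1 hτ.2, sub_self]
      rw [h4, intervalIntegral.integral_zero, add_zero]
    rw [hsub _ hρ s hs, h3]
    have h5 : |∫ τ in s..t, (h (ceil S τ) - h t)| ≤ (2 * B) * |t - s| := by
      rw [← Real.norm_eq_abs]
      refine norm_integral_le_of_norm_le_const fun τ hτ => ?_
      rw [uIoc_of_ge hst] at hτ
      rw [Real.norm_eq_abs]
      have k1 := hB _ (hS.ceil_mem (hτ.2.trans (hS.subset hs).2))
      have k2 := hB _ ht
      exact (abs_sub _ _).trans (by linarith)
    refine h5.trans ?_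
    rw [abs_sub_comm t s]
    have h6 : |rho S t - s| = s - rho S t := by
      rw [abs_sub_comm, abs_of_nonneg]; linarith
    rw [h6]
    have h7 : (2 * B) * |s - t| ≤ (2 * B + 1) * (ε * μ / (2 * B + 1)) := by gcongr; linarith
    have h8 : (2 * B + 1) * (ε * μ / (2 * B + 1)) = ε * μ := by field_simp
    rw [h8] at h7
    refine h7.trans ?_
    gcongr
    linarith

/-- A function with nabla derivative zero is constant. -/
theorem eq_of_hasNablaDerivAt_zero (hS : Spans S A b) {x : ℝ → ℝ}
    (hx : ∀ t ∈ kappa S, HasNablaDerivAt S x 0 t) {s t : ℝ} (hs : s ∈ S) (ht : t ∈ S) :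
    x s = x t := by
  have hcont := continuousOn_of_hasNablaDerivAt (h := fun _ => 0) hx
  have hjump : ∀ t ∈ S, x (rho S t) = x t := by
    intro t ht
    rcases (rho_le S t).eq_or_lt with h | h
    · rw [h]
    · have hκ : t ∈ kappa S := ⟨ht, fun h' => absurd (h'.1.2 (rho_mem hS.closed ht)) (not_le.2 h)⟩
      refine eq_of_abs_sub_le_all fun ε hε => ?_
      obtain ⟨δ, hδ, h'⟩ := hx t hκ (ε / (t - rho S t)) (div_pos hε (sub_pos.2 h))
      have h1 := h' t ht (by simpa using hδ)
      rw [zero_mul, sub_zero, abs_sub_comm (rho S t) t, abs_of_pos (sub_pos.2 h),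
        div_mul_cancel₀ _ (sub_pos.2 h).ne'] at h1
      exact h1
  -- the constant extension over the gaps
  set y : ℝ → ℝ := fun τ => x (ceil S τ) with hy
  have hyS : ∀ t ∈ S, y t = x t := fun t ht => by rw [hy]; simp only [ceil_of_mem ht]
  have hyr : ∀ τ, τ ≤ b → y τ = x (rho S (ceil S τ)) := fun τ hτ =>
    (hjump _ (hS.ceil_mem hτ)).symm
  -- near a point `t` of `S` a value of `y` is a value of `x` at a point between
  have hbetween : ∀ t ∈ S, ∀ τ ∈ Icc A b, ∃ s ∈ S, y τ = x s ∧ |s - t| ≤ |τ - t| := by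
    intro t ht τ hτ
    rcases le_total τ t with h | h
    · refine ⟨ceil S τ, hS.ceil_mem hτ.2, rfl, ?_⟩
      have h1 := ceil_le ht h
      have h2 := hS.le_ceil hτ.2
      rw [abs_of_nonpos (by linarith), abs_of_nonpos (by linarith)]
      linarith
    · rcases h.eq_or_lt with h' | h'
      · exact ⟨t, ht, by rw [← h']; exact hyS t ht, by simp⟩
      · refine ⟨rho S (ceil S τ), rho_mem hS.closed (hS.ceil_mem hτ.2), hyr τ hτ.2, ?_⟩
        have h1 := le_rho ht (h'.trans_le (hS.le_ceil hτ.2))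
        have h2 := hS.rho_ceil_le hτ.1 hτ.2
        rw [abs_of_nonneg (by linarith), abs_of_nonneg (by linarith)]
        linarith
  have hyc : ContinuousOn y (Icc A b) := by
    intro τ hτ
    by_cases hm : τ ∈ S
    · rw [Metric.continuousWithinAt_iff]
      intro ε hε
      obtain ⟨δ, hδ, h1⟩ := Metric.continuousWithinAt_iff.1 (hcont τ hm) ε hε
      refine ⟨δ, hδ, fun {τ'} hτ' hd => ?_⟩
      obtain ⟨s, hs, h2, h3⟩ := hbetween τ hm τ' hτ'
      rw [h2, hyS τ hm]
      refine h1 hs ?_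
      rw [Real.dist_eq] at hd ⊢
      exact h3.trans_lt hd
    · have hA : A < τ := lt_of_le_of_ne hτ.1 (by rintro rfl; exact hm hS.left_mem)
      have hb : τ < b := lt_of_le_of_ne hτ.2 (by rintro rfl; exact hm hS.right_mem)
      refine ContinuousAt.continuousWithinAt ((continuousAt_const (y := y τ)).congr ?_)
      filter_upwards [hS.eventually_ceil_eq hA hb hm] with τ' h'
      simp only [hy, h']
  have hyd : ∀ τ ∈ Ioo A b \ scattered S, HasDerivAt y 0 τ := by
    rintro τ ⟨hτ, hsc⟩
    by_cases hm : τ ∈ S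
    · obtain ⟨h1, -⟩ := dense_of_notMem_scattered hm hsc
      have hκ : τ ∈ kappa S := ⟨hm, fun h' => absurd (h'.1.2 hS.left_mem) (not_le.2 hτ.1)⟩
      rw [hasDerivAt_iff_isLittleO, Asymptotics.isLittleO_iff]
      intro ε hε
      obtain ⟨δ, hδ, h2⟩ := hx τ hκ ε hε
      filter_upwards [Metric.ball_mem_nhds τ hδ, Ioo_mem_nhds hτ.1 hτ.2] with τ' h3 h4
      rw [Metric.mem_ball, Real.dist_eq] at h3
      obtain ⟨s, hs, h5, h6⟩ := hbetween τ hm τ' ⟨h4.1.le, h4.2.le⟩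
      have h7 := h2 s hs (h6.trans_lt h3)
      rw [h1, zero_mul, sub_zero, abs_sub_comm, abs_sub_comm τ s] at h7
      rw [h5, hyS τ hm, smul_zero, sub_zero, Real.norm_eq_abs, Real.norm_eq_abs]
      exact h7.trans (by gcongr)
    · refine (hasDerivAt_const τ (y τ)).congr_of_eventuallyEq ?_
      filter_upwards [hS.eventually_ceil_eq hτ.1 hτ.2 hm] with τ' h'
      simp only [hy, h']
  have key : ∀ t ∈ S, x t = x A := by
    intro t ht
    have h1 := integral_eq_of_hasDerivAt_off_countable_of_le y (fun _ => 0) (hS.subset ht).1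
      (countable_scattered S) (hyc.mono (Icc_subset_Icc_right (hS.subset ht).2))
      (fun τ hτ => hyd τ ⟨⟨hτ.1.1, hτ.1.2.trans_le (hS.subset ht).2⟩, hτ.2⟩)
      intervalIntegrable_const
    rw [intervalIntegral.integral_zero, hyS t ht, hyS A hS.left_mem] at h1
    linarith
  rw [key s hs, key t ht]

theorem integral_eq_sub_of_hasNablaDerivAt (hS : Spans S A b) {F h : ℝ → ℝ}
    (hh : LdContinuous S h) (hF : ∀ t ∈ kappa S, HasNablaDerivAt S F (h t) t) {c d : ℝ}
    (hc : c ∈ S) (hd : d ∈ S) : ∫ τ in c..d, h (ceil S τ) = F d - F c := by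
  have h1 : ∀ t ∈ kappa S,
      HasNablaDerivAt S (fun t => F t - ∫ τ in c..t, h (ceil S τ)) 0 t := fun t ht => by
    simpa using (hF t ht).sub (hasNablaDerivAt_integral hS hh (hS.subset hc) ht.1)
  have h2 := eq_of_hasNablaDerivAt_zero hS h1 hc hd
  simp only [integral_same] at h2
  linarith

/-- The nabla integral of an ld-continuous function as a Lebesgue integral. -/
theorem nablaIntegral_eq (hS : Spans S A b) {h : ℝ → ℝ} (hh : LdContinuous S h) {c d : ℝ}
    (hc : c ∈ S) (hd : d ∈ S) : nablaIntegral S h c d = ∫ τ in c..d, h (ceil S τ) := by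
  have hex : ∃ F, IsNablaAntideriv S F h :=
    ⟨_, fun t ht => hasNablaDerivAt_integral hS hh (hS.subset hS.left_mem) ht.1⟩
  unfold nablaIntegral
  rw [dif_pos hex, integral_eq_sub_of_hasNablaDerivAt hS hh hex.choose_spec hc hd]

end TimeScale

namespace TimeScale

/-! ### Volterra equations with a delayed argument -/

open MeasureTheory intervalIntegral

theorem integral_exp_weight_le {a t M D : ℝ} (hM : 0 < M) (hD : 0 ≤ D) :
    ∫ τ in a..t, D * Real.exp (M * τ) ≤ D / M * Real.exp (M * t) := by
  rw [intervalIntegral.integral_const_mul, integral_comp_mul_left (fun τ => Real.exp τ) hM.ne',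
    integral_exp, smul_eq_mul]
  have h1 := Real.exp_pos (M * a)
  have h2 : D / M * Real.exp (M * t) - D * (M⁻¹ * (Real.exp (M * t) - Real.exp (M * a))) =
      D / M * Real.exp (M * a) := by field_simp; ring
  have h3 : 0 ≤ D / M * Real.exp (M * a) := by positivity
  linarith

/-- Solvability of `y(t) = c + ∫_a^t φ(τ, y(θ(τ))) dτ` with a delay `θ(τ) ≤ τ`: the right-hand side
is a contraction for the supremum norm with the weight `exp (-M t)`, if `M` is large. -/
theorem exists_volterra {a b L : ℝ} (hab : a ≤ b) (hL : 0 ≤ L) {θ : ℝ → ℝ}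
    (hθ : ∀ τ ∈ Ioc a b, θ τ ∈ Icc a τ) {φ : ℝ → ℝ → ℝ}
    (hint : ∀ y : ℝ → ℝ, Continuous y → IntervalIntegrable (fun τ => φ τ (y (θ τ))) volume a b)
    (hlip : ∀ τ ∈ Ioc a b, ∀ x x', |φ τ x - φ τ x'| ≤ L * |x - x'|) (c : ℝ) :
    ∃ y : ℝ → ℝ, Continuous y ∧ ∀ t ∈ Icc a b, y t = c + ∫ τ in a..t, φ τ (y (θ τ)) := by
  set M : ℝ := 2 * L + 1 with hM
  have hM0 : 0 < M := by positivity
  have hLM : L / M ≤ 1 / 2 := by rw [div_le_div_iff₀ hM0 two_pos]; linarith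
  -- undo the weight, and extend to the real line
  let ext : C(Icc a b, ℝ) → ℝ → ℝ := fun z τ => Real.exp (M * τ) * IccExtend hab z τ
  have hext : ∀ z, Continuous (ext z) := fun z =>
    (Real.continuous_exp.comp (continuous_const.mul continuous_id)).mul z.continuous.Icc_extend'
  have hextdiff : ∀ z w τ, |ext z τ - ext w τ| ≤ dist z w * Real.exp (M * τ) := by
    intro z w τ
    simp only [ext]
    rw [← mul_sub, abs_mul, abs_of_pos (Real.exp_pos _), mul_comm]
    gcongr
    rw [← Real.dist_eq]
    exact ContinuousMap.dist_apply_le_dist _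
  have hprim : ∀ z, ContinuousOn (fun t => ∫ τ in a..t, φ τ (ext z (θ τ))) (Icc a b) := by
    intro z
    have h := hint _ (hext z)
    rw [intervalIntegrable_iff, uIoc_of_le hab, ← integrableOn_Icc_iff_integrableOn_Ioc] at h
    have := continuousOn_primitive_interval (a := a) (b := b)
      (f := fun τ => φ τ (ext z (θ τ))) (μ := volume) (by rwa [uIcc_of_le hab])
    rwa [uIcc_of_le hab] at this
  let Ψ : C(Icc a b, ℝ) → C(Icc a b, ℝ) := fun z =>
    ⟨fun t => Real.exp (-(M * t)) * (c + ∫ τ in a..(t : ℝ), φ τ (ext z (θ τ))),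
      (Real.continuous_exp.comp (continuous_const.mul continuous_subtype_val).neg).mul
        (continuous_const.add (continuousOn_iff_continuous_domRestrict.1 (hprim z)))⟩
  have hΨ : ContractingWith (1 / 2) Ψ := by
    refine ⟨by rw [← NNReal.coe_lt_coe]; push_cast; norm_num,
      LipschitzWith.of_dist_le_mul fun z w => ?_⟩
    rw [ContinuousMap.dist_le (by positivity)]
    intro t
    have hmono : uIcc a (t : ℝ) ⊆ uIcc a b := by
      rw [uIcc_of_le hab, uIcc_of_le t.2.1]; exact Icc_subset_Icc_right t.2.2
    have h1 := (hint _ (hext z)).mono_set hmono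
    have h2 := (hint _ (hext w)).mono_set hmono
    have h3 : |∫ τ in a..(t : ℝ), (φ τ (ext z (θ τ)) - φ τ (ext w (θ τ)))| ≤
        ∫ τ in a..(t : ℝ), (L * dist z w) * Real.exp (M * τ) := by
      rw [← Real.norm_eq_abs]
      refine norm_integral_le_of_norm_le t.2.1 (Eventually.of_forall fun τ hτ => ?_)
        (Continuous.intervalIntegrable (by fun_prop) _ _)
      have hτ' : τ ∈ Ioc a b := ⟨hτ.1, hτ.2.trans t.2.2⟩
      rw [Real.norm_eq_abs, mul_assoc]
      refine (hlip τ hτ' _ _).trans ?_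
      gcongr
      refine (hextdiff z w (θ τ)).trans ?_
      gcongr
      exact (hθ τ hτ').2
    have h4 := integral_exp_weight_le (a := a) (t := t) hM0
      (show 0 ≤ L * dist z w by positivity)
    simp only [Ψ, ContinuousMap.coe_mk]
    rw [Real.dist_eq, ← mul_sub, add_sub_add_left_eq_sub, ← integral_sub h1 h2, abs_mul,
      abs_of_pos (Real.exp_pos _)]
    calc _ ≤ Real.exp (-(M * t)) * (L * dist z w / M * Real.exp (M * t)) := by
          gcongr; exact h3.trans h4
      _ = (L / M * dist z w) * (Real.exp (-(M * t)) * Real.exp (M * t)) := by ring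
      _ = L / M * dist z w := by rw [← Real.exp_add]; simp
      _ ≤ 1 / 2 * dist z w := by gcongr
      _ = _ := by push_cast; ring
  have hfix := hΨ.fixedPoint_isFixedPt
  set z := ContractingWith.fixedPoint Ψ hΨ with hz
  refine ⟨ext z, hext z, fun t ht => ?_⟩
  have h1 : Ψ z ⟨t, ht⟩ = z ⟨t, ht⟩ := by rw [hfix.eq]
  have h2 : ext z t = Real.exp (M * t) * z ⟨t, ht⟩ := by
    simp only [ext]
    rw [IccExtend_of_mem hab _ ht]
  rw [h2, ← h1]
  simp only [Ψ, ContinuousMap.coe_mk]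
  rw [← mul_assoc, ← Real.exp_add, add_neg_cancel, Real.exp_zero, one_mul]

/-- The same for an equation that is solved from the right end, with an advanced argument. -/
theorem exists_volterra_backward {a b L : ℝ} (hab : a ≤ b) (hL : 0 ≤ L) {θ : ℝ → ℝ}
    (hθ : ∀ τ ∈ Ico a b, θ τ ∈ Icc τ b) {φ : ℝ → ℝ → ℝ}
    (hint : ∀ y : ℝ → ℝ, Continuous y → IntervalIntegrable (fun τ => φ τ (y (θ τ))) volume a b)
    (hlip : ∀ τ ∈ Ico a b, ∀ x x', |φ τ x - φ τ x'| ≤ L * |x - x'|) (c : ℝ) :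
    ∃ y : ℝ → ℝ, Continuous y ∧ ∀ t ∈ Icc a b, y t = c + ∫ τ in t..b, φ τ (y (θ τ)) := by
  obtain ⟨q, hq, h⟩ := exists_volterra (a := -b) (b := -a) (L := L) (θ := fun τ => -θ (-τ))
    (φ := fun τ x => φ (-τ) x) (neg_le_neg hab) hL
    (fun τ hτ => by
      have := hθ (-τ) ⟨by linarith [hτ.2], by linarith [hτ.1]⟩
      exact ⟨by linarith [this.2], by linarith [this.1]⟩)
    (fun y hy => by
      have h1 := hint (fun τ => y (-τ)) (hy.comp continuous_neg)
      rw [IntervalIntegrable.iff_comp_neg] at h1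
      exact h1.symm)
    (fun τ hτ => hlip (-τ) ⟨by linarith [hτ.2], by linarith [hτ.1]⟩) c
  refine ⟨fun t => q (-t), hq.comp continuous_neg, fun t ht => ?_⟩
  have h1 := h (-t) ⟨by linarith [ht.2], by linarith [ht.1]⟩
  have h2 := integral_comp_neg (a := -b) (b := -t) (fun τ => φ τ (q (-θ τ)))
  simp only [neg_neg] at h2
  simp only [h1, h2]

/-- A Gronwall estimate with a delay. -/
theorem gronwall_delay {a b L c K : ℝ} (hL : 0 ≤ L) (hc : 0 ≤ c) (hK : 0 ≤ K)
    {θ : ℝ → ℝ} (hθ : ∀ τ ∈ Ioc a b, θ τ ∈ Icc a τ) {e k : ℝ → ℝ} (he : ContinuousOn e (Icc a b))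
    (h : ∀ t ∈ Icc a b, |e t| ≤ c + |∫ τ in a..t, k τ|)
    (hk : ∀ τ ∈ Ioc a b, |k τ| ≤ L * |e (θ τ)| + K) {t : ℝ} (ht : t ∈ Icc a b) :
    |e t| ≤ 2 * Real.exp ((2 * L + 1) * (b - a)) * (c + K * (b - a)) := by
  set M : ℝ := 2 * L + 1 with hM
  have hM0 : 0 < M := by positivity
  have hLM : L / M ≤ 1 / 2 := by rw [div_le_div_iff₀ hM0 two_pos]; linarith
  have hab : a ≤ b := ht.1.trans ht.2
  -- the weighted supremum of `e`
  obtain ⟨t0, ht0, hmax⟩ := isCompact_Icc.exists_isMaxOn (nonempty_Icc.2 hab)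
    (f := fun t => Real.exp (-(M * t)) * |e t|)
    ((Continuous.continuousOn (by fun_prop)).mul he.abs)
  set N := Real.exp (-(M * t0)) * |e t0| with hN
  have hN0 : 0 ≤ N := by positivity
  have hle : ∀ t ∈ Icc a b, |e t| ≤ N * Real.exp (M * t) := by
    intro t ht
    have h1 : Real.exp (-(M * t)) * |e t| ≤ N := hmax ht
    calc |e t| = (Real.exp (-(M * t)) * |e t|) * Real.exp (M * t) := by
          rw [mul_comm (Real.exp _), mul_assoc, ← Real.exp_add]; simp
      _ ≤ _ := by gcongr
  have hest : ∀ t ∈ Icc a b, |e t| ≤ c + K * (b - a) + N / 2 * Real.exp (M * t) := by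
    intro t ht
    have h1 : |∫ τ in a..t, k τ| ≤ ∫ τ in a..t, ((L * N) * Real.exp (M * τ) + K) := by
      rw [← Real.norm_eq_abs]
      refine norm_integral_le_of_norm_le ht.1 (Eventually.of_forall fun τ hτ => ?_)
        (Continuous.intervalIntegrable (by fun_prop) _ _)
      have hτ' : τ ∈ Ioc a b := ⟨hτ.1, hτ.2.trans ht.2⟩
      have h2 := hθ τ hτ'
      refine (hk τ hτ').trans ?_
      rw [mul_assoc]
      gcongr
      refine (hle _ ⟨h2.1, h2.2.trans hτ'.2⟩).trans ?_
      gcongr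
      exact h2.2
    have h2 := integral_exp_weight_le (a := a) (t := t) hM0 (show 0 ≤ L * N by positivity)
    rw [integral_add (Continuous.intervalIntegrable (by fun_prop) _ _) intervalIntegrable_const,
      intervalIntegral.integral_const, smul_eq_mul] at h1
    have h3 : (t - a) * K ≤ K * (b - a) := by
      rw [mul_comm]; gcongr; exact ht.2
    have h4 : L * N / M * Real.exp (M * t) ≤ N / 2 * Real.exp (M * t) := by
      have h5 : L * N / M = L / M * N := by ring
      have h6 : L / M * N ≤ 1 / 2 * N := by gcongr
      refine mul_le_mul_of_nonneg_right ?_ (Real.exp_pos _).le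
      linarith
    linarith [h t ht]
  have hb0 : 0 ≤ c + K * (b - a) := add_nonneg hc (mul_nonneg hK (sub_nonneg.2 hab))
  have hNle : N ≤ 2 * (Real.exp (-(M * a)) * (c + K * (b - a))) := by
    have h1 : N ≤ Real.exp (-(M * t0)) * (c + K * (b - a) + N / 2 * Real.exp (M * t0)) := by
      rw [hN]
      gcongr
      exact hest t0 ht0
    have h2 : Real.exp (-(M * t0)) * (N / 2 * Real.exp (M * t0)) = N / 2 := by
      rw [mul_comm, mul_assoc, ← Real.exp_add]; simp
    have h3 : Real.exp (-(M * t0)) * (c + K * (b - a)) ≤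
        Real.exp (-(M * a)) * (c + K * (b - a)) := by
      gcongr
      exact ht0.1
    rw [mul_add, h2] at h1
    linarith
  calc |e t| ≤ N * Real.exp (M * t) := hle t ht
    _ ≤ 2 * (Real.exp (-(M * a)) * (c + K * (b - a))) * Real.exp (M * b) := by
        gcongr
        exact ht.2
    _ = 2 * (Real.exp (-(M * a)) * Real.exp (M * b)) * (c + K * (b - a)) := by ring
    _ = _ := by rw [← Real.exp_add]; congr 3; ring

end TimeScale

namespace TimeScale

variable {S : Set ℝ} {A b : ℝ}

/-! ### Jointly ld-continuous families along a pair of functions -/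

/-- `Φ (t, ·)` as a function on `ℝ⁴`. -/
def uncurry4 (Φ : ℝ → ℝ → ℝ → ℝ → ℝ → ℝ) (t : ℝ) (y : ℝ × ℝ × ℝ × ℝ) : ℝ :=
  Φ t y.1 y.2.1 y.2.2.1 y.2.2.2

/-- The backward jump of a time scale that is cut off at its point `c`: the time is first moved up
to `c`, and neither is the jump allowed to pass `c`. -/
noncomputable def back (S : Set ℝ) (c t : ℝ) : ℝ := max (rho S (max t c)) c

/-- The arguments `(x^ρ(t), u^ρ(t), α, β)` on the time scale that is cut off at `c`; they are
constant before `c`. -/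
noncomputable def path (S : Set ℝ) (c : ℝ) (x u : ℝ → ℝ) (α β t : ℝ) : ℝ × ℝ × ℝ × ℝ :=
  (x (back S c t), u (back S c t), α, β)

/-- A jointly ld-continuous family of continuous functions on `ℝ⁴`. -/
structure LdFamily (S : Set ℝ) (Φ : ℝ → ℝ → ℝ → ℝ → ℝ → ℝ) : Prop where
  joint : JointlyLdContinuous S Φ
  cont : ∀ t ∈ S, Continuous (uncurry4 Φ t)

theorem max_mem {c t : ℝ} (hc : c ∈ S) (ht : t ∈ S) : max t c ∈ S := by
  rcases max_choice t c with h | h <;> rwa [h]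

theorem back_mem (hS : IsClosed S) {c t : ℝ} (hc : c ∈ S) (ht : t ∈ S) : back S c t ∈ S := by
  have hm := max_mem hc ht
  unfold back
  rcases max_choice (rho S (max t c)) c with h | h <;> rw [h]
  · exact rho_mem hS hm
  · exact hc

theorem back_of_le {c t : ℝ} (h : t ≤ c) : back S c t = c := by
  unfold back
  rw [max_eq_right h]
  exact max_eq_right (rho_le S c)

theorem back_of_lt {c t : ℝ} (hc : c ∈ S) (h : c < t) : back S c t = rho S t := by
  unfold back
  rw [max_eq_left h.le]
  exact max_eq_left (le_rho hc h)

theorem le_back (S : Set ℝ) (c t : ℝ) : c ≤ back S c t := le_max_right _ _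

theorem back_of_le_rho {c t : ℝ} (h : c ≤ rho S t) : back S c t = rho S t := by
  unfold back
  rw [max_eq_left (h.trans (rho_le S t)), max_eq_left h]

theorem tendsto_max_nhdsWithin {c t : ℝ} (hc : c ∈ S) (hct : c ≤ t) :
    Tendsto (fun s => max s c) (𝓝[S] t) (𝓝[S] t) := by
  refine tendsto_nhdsWithin_iff.2 ⟨?_, ?_⟩
  · have : Tendsto (fun s : ℝ => max s c) (𝓝 t) (𝓝 (max t c)) :=
      (continuous_id.max continuous_const).tendsto t
    rw [max_eq_left hct] at this
    exact this.mono_left nhdsWithin_le_nhds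
  · filter_upwards [self_mem_nhdsWithin] with s hs
    exact max_mem hc hs

theorem tendsto_back_of_rho_eq (hS : IsClosed S) {c t : ℝ} (hc : c ∈ S) (hct : c ≤ t)
    (hd : rho S t = t) : Tendsto (back S c) (𝓝[S] t) (𝓝[S] t) := by
  have hmax := tendsto_max_nhdsWithin hc hct
  exact hmax.comp ((tendsto_rho_of_rho_eq hS hd).comp hmax)

section LdFamily

variable {Φ : ℝ → ℝ → ℝ → ℝ → ℝ → ℝ} {x u : ℝ → ℝ} {c α β : ℝ}

theorem LdFamily.tendsto_of_lt (hΦ : LdFamily S Φ) (hc : c ∈ S) {t : ℝ} (htc : t < c) :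
    Tendsto (fun p : ℝ × (ℝ × ℝ × ℝ × ℝ) =>
        uncurry4 Φ (max p.1 c) (path S c x u α β p.1 + p.2)) (𝓝 t ×ˢ 𝓝 0)
      (𝓝 (uncurry4 Φ (max t c) (path S c x u α β t))) := by
  have h1 : Tendsto (fun q => uncurry4 Φ c (path S c x u α β c + q)) (𝓝 0)
      (𝓝 (uncurry4 Φ c (path S c x u α β c))) := by
    have : Continuous fun q => uncurry4 Φ c (path S c x u α β c + q) :=
      (hΦ.cont c hc).comp (continuous_const.add continuous_id)
    simpa using this.tendsto 0
  have hp : ∀ s ≤ c, path S c x u α β s = path S c x u α β c := fun s hs => by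
    unfold path; rw [back_of_le hs, back_of_le le_rfl]
  rw [max_eq_right htc.le, hp t htc.le]
  refine (h1.comp tendsto_snd).congr' ?_
  have : ∀ᶠ p : ℝ × (ℝ × ℝ × ℝ × ℝ) in 𝓝 t ×ˢ 𝓝 0, p.1 < c :=
    tendsto_fst.eventually (Iio_mem_nhds htc)
  filter_upwards [this] with p hlt
  simp only [Function.comp_apply]
  rw [max_eq_right hlt.le, hp p.1 hlt.le]

theorem LdFamily.tendsto_of_rho_eq (hS : IsClosed S) (hΦ : LdFamily S Φ) (hc : c ∈ S)
    (hx : LdContinuous S x) (hu : LdContinuous S u) {t : ℝ} (ht : t ∈ S) (hd : rho S t = t) :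
    Tendsto (fun p : ℝ × (ℝ × ℝ × ℝ × ℝ) =>
        uncurry4 Φ (max p.1 c) (path S c x u α β p.1 + p.2)) (𝓝[S] t ×ˢ 𝓝 0)
      (𝓝 (uncurry4 Φ (max t c) (path S c x u α β t))) := by
  rcases lt_or_ge t c with hlt | hge
  · exact (hΦ.tendsto_of_lt hc hlt).mono_left (prod_mono_left _ nhdsWithin_le_nhds)
  have hback := tendsto_back_of_rho_eq hS hc hge hd
  have hbt : back S c t = t := by unfold back; rw [max_eq_left hge, hd, max_eq_left hge]
  have hpath : Tendsto (path S c x u α β) (𝓝[S] t) (𝓝 (path S c x u α β t)) := by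
    unfold path
    rw [hbt]
    have h1 : Tendsto x (𝓝[S] t) (𝓝 (x t)) := (hx t ht).1 hd
    have h2 : Tendsto u (𝓝[S] t) (𝓝 (u t)) := (hu t ht).1 hd
    exact (h1.comp hback).prodMk_nhds ((h2.comp hback).prodMk_nhds tendsto_const_nhds)
  have hmax := tendsto_max_nhdsWithin hc hge
  have hjoint := ((hΦ.joint t ht (path S c x u α β t)).1 hd)
  rw [ContinuousWithinAt, nhdsWithin_prod_eq, nhdsWithin_univ] at hjoint
  have hsum : Tendsto (fun p : ℝ × (ℝ × ℝ × ℝ × ℝ) => path S c x u α β p.1 + p.2)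
      (𝓝[S] t ×ˢ 𝓝 0) (𝓝 (path S c x u α β t)) := by
    simpa using (hpath.comp tendsto_fst).add (tendsto_snd (f := 𝓝[S] t)
      (g := 𝓝 (0 : ℝ × ℝ × ℝ × ℝ)))
  rw [max_eq_left hge]
  exact hjoint.comp ((hmax.comp tendsto_fst).prodMk hsum)

theorem LdFamily.exists_tendsto_of_sigma_eq (hS : IsClosed S) (hΦ : LdFamily S Φ) (hc : c ∈ S)
    (hx : LdContinuous S x) (hu : LdContinuous S u) {t : ℝ} (ht : t ∈ S) (hd : sigma S t = t) :
    ∃ l, Tendsto (fun p : ℝ × (ℝ × ℝ × ℝ × ℝ) =>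
        uncurry4 Φ (max p.1 c) (path S c x u α β p.1 + p.2)) (𝓝[S ∩ Ioi t] t ×ˢ 𝓝 0) (𝓝 l) := by
  rcases lt_or_ge t c with hlt | hge
  · exact ⟨_, (hΦ.tendsto_of_lt hc hlt).mono_left (prod_mono_left _ nhdsWithin_le_nhds)⟩
  have hev : ∀ᶠ s in 𝓝[S ∩ Ioi t] t, s ∈ S ∩ Ioi t := self_mem_nhdsWithin
  have hback : Tendsto (back S c) (𝓝[S ∩ Ioi t] t) (𝓝[S ∩ Ioi t] t) := by
    refine (tendsto_rho_of_sigma_eq hS hd).congr' ?_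
    filter_upwards [hev] with s hs
    exact (back_of_lt hc (hge.trans_lt hs.2)).symm
  obtain ⟨lx, hlx⟩ := (hx t ht).2 hd
  obtain ⟨lu, hlu⟩ := (hu t ht).2 hd
  have hpath : Tendsto (path S c x u α β) (𝓝[S ∩ Ioi t] t) (𝓝 (lx, lu, α, β)) :=
    (hlx.comp hback).prodMk_nhds ((hlu.comp hback).prodMk_nhds tendsto_const_nhds)
  have hmax : Tendsto (fun s => max s c) (𝓝[S ∩ Ioi t] t) (𝓝[S ∩ Ioi t] t) := by
    refine tendsto_id.congr' ?_
    filter_upwards [hev] with s hs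
    exact (max_eq_left (hge.trans hs.2.le)).symm
  obtain ⟨l, hl⟩ := (hΦ.joint t ht (lx, lu, α, β)).2 hd
  rw [nhdsWithin_prod_eq, nhdsWithin_univ] at hl
  have hsum : Tendsto (fun p : ℝ × (ℝ × ℝ × ℝ × ℝ) => path S c x u α β p.1 + p.2)
      (𝓝[S ∩ Ioi t] t ×ˢ 𝓝 0) (𝓝 (lx, lu, α, β)) := by
    simpa using (hpath.comp tendsto_fst).add (tendsto_snd (f := 𝓝[S ∩ Ioi t] t)
      (g := 𝓝 (0 : ℝ × ℝ × ℝ × ℝ)))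
  exact ⟨l, hl.comp ((hmax.comp tendsto_fst).prodMk hsum)⟩

theorem LdFamily.ldContinuous_path (hS : IsClosed S) (hΦ : LdFamily S Φ) (hc : c ∈ S)
    (hx : LdContinuous S x) (hu : LdContinuous S u) (α β : ℝ) :
    LdContinuous S fun t => uncurry4 Φ (max t c) (path S c x u α β t) := by
  intro t ht
  have hzero : ∀ F : Filter ℝ, Tendsto (fun s : ℝ => (s, (0 : ℝ × ℝ × ℝ × ℝ))) F (F ×ˢ 𝓝 0) :=
    fun F => tendsto_id.prodMk tendsto_const_nhds
  refine ⟨fun hd => ?_, fun hd => ?_⟩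
  · simpa [Function.comp_def, ContinuousWithinAt] using
      (hΦ.tendsto_of_rho_eq (α := α) (β := β) hS hc hx hu ht hd).comp (hzero _)
  · obtain ⟨l, hl⟩ := hΦ.exists_tendsto_of_sigma_eq (α := α) (β := β) hS hc hx hu ht hd
    exact ⟨l, by simpa [Function.comp_def] using hl.comp (hzero _)⟩

/-- Uniform continuity of a family in its arguments at the points of a path. -/
theorem LdFamily.exists_uniform (hS : IsCompact S) (hΦ : LdFamily S Φ) (hc : c ∈ S)
    (hx : LdContinuous S x) (hu : LdContinuous S u) (α β : ℝ) {ε : ℝ} (hε : 0 < ε) :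
    ∃ δ > 0, ∀ t ∈ S, ∀ q : ℝ × ℝ × ℝ × ℝ, ‖q‖ < δ →
      |uncurry4 Φ (max t c) (path S c x u α β t + q) -
        uncurry4 Φ (max t c) (path S c x u α β t)| ≤ ε := by
  set Ψ : ℝ → ℝ × ℝ × ℝ × ℝ → ℝ := fun t q => uncurry4 Φ (max t c) (path S c x u α β t + q)
    with hΨ
  suffices h : ∃ δ > 0, ∀ t ∈ S, ∀ q, ‖q‖ < δ → |Ψ t q - Ψ t 0| ≤ ε by
    simpa [hΨ] using h
  refine hS.induction_on (p := fun s => ∃ δ > 0, ∀ t ∈ s, ∀ q, ‖q‖ < δ → |Ψ t q - Ψ t 0| ≤ ε)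
    ⟨1, one_pos, by simp⟩ ?_ ?_ ?_
  · rintro s t hst ⟨δ, hδ, h⟩
    exact ⟨δ, hδ, fun r hr => h r (hst hr)⟩
  · rintro s t ⟨δ, hδ, h⟩ ⟨δ', hδ', h'⟩
    refine ⟨min δ δ', lt_min hδ hδ', ?_⟩
    rintro r (hr | hr) q hq
    · exact h r hr q (hq.trans_le (min_le_left _ _))
    · exact h' r hr q (hq.trans_le (min_le_right _ _))
  · intro t ht
    -- a joint limit along `F` makes the oscillation small along `F`
    have key : ∀ (F : Filter ℝ) (l : ℝ),
        Tendsto (fun p : ℝ × (ℝ × ℝ × ℝ × ℝ) => Ψ p.1 p.2) (F ×ˢ 𝓝 0) (𝓝 l) →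
        ∃ δ > 0, ∀ᶠ s in F, ∀ q, ‖q‖ < δ → |Ψ s q - Ψ s 0| ≤ ε := by
      intro F l hF
      have h1 : ∀ᶠ p : ℝ × (ℝ × ℝ × ℝ × ℝ) in F ×ˢ 𝓝 0, |Ψ p.1 p.2 - l| < ε / 2 := by
        have := (Metric.tendsto_nhds.1 hF) (ε / 2) (by positivity)
        simpa only [Real.dist_eq] using this
      obtain ⟨pa, hpa, pb, hpb, h2⟩ := eventually_prod_iff.1 h1
      obtain ⟨δ, hδ, h3⟩ := Metric.eventually_nhds_iff.1 hpb
      refine ⟨δ, hδ, ?_⟩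
      filter_upwards [hpa] with s hs q hq
      have h4 := h2 hs (h3 (by simpa using hq))
      have h5 := h2 hs (h3 (y := 0) (by simpa using hδ))
      calc |Ψ s q - Ψ s 0| = |(Ψ s q - l) - (Ψ s 0 - l)| := by congr 1; ring
        _ ≤ ε := (abs_sub _ _).trans (by linarith)
    have hpure : ∃ δ > 0, ∀ q, ‖q‖ < δ → |Ψ t q - Ψ t 0| ≤ ε := by
      have hcont : Continuous (Ψ t) := (hΦ.cont _ (max_mem hc ht)).comp (continuous_const.add continuous_id)
      obtain ⟨δ, hδ, h⟩ := Metric.continuous_iff.1 hcont 0 ε hε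
      exact ⟨δ, hδ, fun q hq => (h q (by simpa using hq)).le⟩
    obtain ⟨δ0, hδ0, h0⟩ := hpure
    suffices hB : ∃ δ > 0, ∀ᶠ s in 𝓝[S] t, ∀ q, ‖q‖ < δ → |Ψ s q - Ψ s 0| ≤ ε by
      obtain ⟨δ, hδ, hB⟩ := hB
      exact ⟨_, hB, δ, hδ, fun s hs => hs⟩
    by_cases hρ : rho S t = t
    · exact key _ _ (hΦ.tendsto_of_rho_eq hS.isClosed hc hx hu ht hρ)
    · have hlt := lt_of_le_of_ne (rho_le S t) hρ
      by_cases hσ : sigma S t = t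
      · obtain ⟨l, hl⟩ := hΦ.exists_tendsto_of_sigma_eq (α := α) (β := β) hS.isClosed hc hx hu ht hσ
        obtain ⟨δ1, hδ1, h1⟩ := key _ _ hl
        refine ⟨min δ0 δ1, lt_min hδ0 hδ1, eventually_nhdsWithin_of_scattered hlt ?_ ?_⟩
        · exact fun q hq => h0 q (hq.trans_le (min_le_left _ _))
        · filter_upwards [h1] with s hs q hq
          exact hs q (hq.trans_le (min_le_right _ _))
      · refine ⟨δ0, hδ0, eventually_nhdsWithin_of_scattered hlt h0 ?_⟩
        rw [nhdsWithin_Ioi_eq_bot_of_lt_sigma (lt_of_le_of_ne (le_sigma S t) (Ne.symm hσ))]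
        exact eventually_bot

end LdFamily

end TimeScale

namespace TimeScale

variable {S : Set ℝ} {A b : ℝ}

/-! ### Partial derivatives and linearization along a path -/

/-- The linear form on `ℝ⁴` with the given coefficients. -/
noncomputable def linForm (a₁ a₂ a₃ a₄ : ℝ) : ℝ × ℝ × ℝ × ℝ →L[ℝ] ℝ :=
  a₁ • ContinuousLinearMap.fst ℝ ℝ (ℝ × ℝ × ℝ) +
  (a₂ • ContinuousLinearMap.fst ℝ ℝ (ℝ × ℝ) +
    (a₃ • ContinuousLinearMap.fst ℝ ℝ ℝ +
      a₄ • ContinuousLinearMap.snd ℝ ℝ ℝ).comp (ContinuousLinearMap.snd ℝ ℝ (ℝ × ℝ))).comp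
    (ContinuousLinearMap.snd ℝ ℝ (ℝ × ℝ × ℝ))

theorem linForm_apply (a₁ a₂ a₃ a₄ : ℝ) (q : ℝ × ℝ × ℝ × ℝ) :
    linForm a₁ a₂ a₃ a₄ q = a₁ * q.1 + a₂ * q.2.1 + a₃ * q.2.2.1 + a₄ * q.2.2.2 := by
  simp [linForm]; ring

theorem abs_fst_le (q : ℝ × ℝ × ℝ × ℝ) : |q.1| ≤ ‖q‖ := norm_fst_le q
theorem abs_snd_fst_le (q : ℝ × ℝ × ℝ × ℝ) : |q.2.1| ≤ ‖q‖ :=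
  (norm_fst_le q.2).trans (norm_snd_le q)
theorem abs_snd_snd_fst_le (q : ℝ × ℝ × ℝ × ℝ) : |q.2.2.1| ≤ ‖q‖ :=
  (norm_fst_le q.2.2).trans ((norm_snd_le q.2).trans (norm_snd_le q))
theorem abs_snd_snd_snd_le (q : ℝ × ℝ × ℝ × ℝ) : |q.2.2.2| ≤ ‖q‖ :=
  (norm_snd_le q.2.2).trans ((norm_snd_le q.2).trans (norm_snd_le q))

theorem norm_le_of_abs_le {q₁ q₂ q₃ q₄ N : ℝ} (h₁ : |q₁| ≤ N) (h₂ : |q₂| ≤ N) (h₃ : |q₃| ≤ N)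
    (h₄ : |q₄| ≤ N) : ‖(q₁, q₂, q₃, q₄)‖ ≤ N :=
  norm_prod_le_iff.2 ⟨h₁, norm_prod_le_iff.2 ⟨h₂, norm_prod_le_iff.2 ⟨h₃, h₄⟩⟩⟩

theorem norm_linForm_le {a₁ a₂ a₃ a₄ B : ℝ} (h₁ : |a₁| ≤ B) (h₂ : |a₂| ≤ B) (h₃ : |a₃| ≤ B)
    (h₄ : |a₄| ≤ B) : ‖linForm a₁ a₂ a₃ a₄‖ ≤ 4 * B := by
  have hB : 0 ≤ B := (abs_nonneg _).trans h₁
  refine ContinuousLinearMap.opNorm_le_bound _ (by positivity) fun q => ?_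
  rw [linForm_apply, Real.norm_eq_abs]
  have k1 : |a₁ * q.1| ≤ B * ‖q‖ := by rw [abs_mul]; gcongr; exact abs_fst_le q
  have k2 : |a₂ * q.2.1| ≤ B * ‖q‖ := by rw [abs_mul]; gcongr; exact abs_snd_fst_le q
  have k3 : |a₃ * q.2.2.1| ≤ B * ‖q‖ := by rw [abs_mul]; gcongr; exact abs_snd_snd_fst_le q
  have k4 : |a₄ * q.2.2.2| ≤ B * ‖q‖ := by rw [abs_mul]; gcongr; exact abs_snd_snd_snd_le q
  have e1 := abs_add_le (a₁ * q.1 + a₂ * q.2.1 + a₃ * q.2.2.1) (a₄ * q.2.2.2)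
  have e2 := abs_add_three (a₁ * q.1) (a₂ * q.2.1) (a₃ * q.2.2.1)
  linarith

theorem linForm_sub (a₁ a₂ a₃ a₄ c₁ c₂ c₃ c₄ : ℝ) : linForm a₁ a₂ a₃ a₄ - linForm c₁ c₂ c₃ c₄ =
    linForm (a₁ - c₁) (a₂ - c₂) (a₃ - c₃) (a₄ - c₄) := by
  ext <;> simp [linForm]

/-- The partial derivative in the state. -/
noncomputable def dx (Φ : ℝ → ℝ → ℝ → ℝ → ℝ → ℝ) (t x v z s : ℝ) : ℝ :=
  deriv (fun r => Φ t r v z s) x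
/-- The partial derivative in the control. -/
noncomputable def dv (Φ : ℝ → ℝ → ℝ → ℝ → ℝ → ℝ) (t x v z s : ℝ) : ℝ :=
  deriv (fun r => Φ t x r z s) v
/-- The partial derivative in the initial state. -/
noncomputable def dz (Φ : ℝ → ℝ → ℝ → ℝ → ℝ → ℝ) (t x v z s : ℝ) : ℝ :=
  deriv (fun r => Φ t x v r s) z
/-- The partial derivative in the final state. -/
noncomputable def ds (Φ : ℝ → ℝ → ℝ → ℝ → ℝ → ℝ) (t x v z s : ℝ) : ℝ :=
  deriv (fun r => Φ t x v z r) s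

/-- The gradient of `Φ (t, ·)`. -/
noncomputable def gradient (Φ : ℝ → ℝ → ℝ → ℝ → ℝ → ℝ) (t : ℝ) (y : ℝ × ℝ × ℝ × ℝ) :
    ℝ × ℝ × ℝ × ℝ →L[ℝ] ℝ :=
  linForm (uncurry4 (dx Φ) t y) (uncurry4 (dv Φ) t y) (uncurry4 (dz Φ) t y) (uncurry4 (ds Φ) t y)

section IsRegular

variable {Φ : ℝ → ℝ → ℝ → ℝ → ℝ → ℝ}

theorem IsRegular.differentiableAt (hΦ : IsRegular S Φ) {t : ℝ} (ht : t ∈ S)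
    (y : ℝ × ℝ × ℝ × ℝ) : DifferentiableAt ℝ (uncurry4 Φ t) y :=
  ((hΦ.contDiff t ht).differentiable one_ne_zero) y

theorem IsRegular.hasDerivAt_x (hΦ : IsRegular S Φ) {t : ℝ} (ht : t ∈ S) (x v z s : ℝ) :
    HasDerivAt (fun r => Φ t r v z s) (fderiv ℝ (uncurry4 Φ t) (x, v, z, s) (1, 0, 0, 0)) x := by
  have h : HasDerivAt (fun r : ℝ => (r, v, z, s)) (1, 0, 0, 0) x :=
    (hasDerivAt_id x).prodMk (hasDerivAt_const x (v, z, s))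
  exact HasFDerivAt.comp_hasDerivAt x (hΦ.differentiableAt ht (x, v, z, s)).hasFDerivAt h

theorem IsRegular.hasDerivAt_v (hΦ : IsRegular S Φ) {t : ℝ} (ht : t ∈ S) (x v z s : ℝ) :
    HasDerivAt (fun r => Φ t x r z s) (fderiv ℝ (uncurry4 Φ t) (x, v, z, s) (0, 1, 0, 0)) v := by
  have h : HasDerivAt (fun r : ℝ => (x, r, z, s)) (0, 1, 0, 0) v :=
    (hasDerivAt_const v x).prodMk ((hasDerivAt_id v).prodMk (hasDerivAt_const v (z, s)))
  exact HasFDerivAt.comp_hasDerivAt v (hΦ.differentiableAt ht (x, v, z, s)).hasFDerivAt h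

theorem IsRegular.hasDerivAt_z (hΦ : IsRegular S Φ) {t : ℝ} (ht : t ∈ S) (x v z s : ℝ) :
    HasDerivAt (fun r => Φ t x v r s) (fderiv ℝ (uncurry4 Φ t) (x, v, z, s) (0, 0, 1, 0)) z := by
  have h : HasDerivAt (fun r : ℝ => (x, v, r, s)) (0, 0, 1, 0) z :=
    (hasDerivAt_const z x).prodMk
      ((hasDerivAt_const z v).prodMk ((hasDerivAt_id z).prodMk (hasDerivAt_const z s)))
  exact HasFDerivAt.comp_hasDerivAt z (hΦ.differentiableAt ht (x, v, z, s)).hasFDerivAt h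

theorem IsRegular.hasDerivAt_s (hΦ : IsRegular S Φ) {t : ℝ} (ht : t ∈ S) (x v z s : ℝ) :
    HasDerivAt (fun r => Φ t x v z r) (fderiv ℝ (uncurry4 Φ t) (x, v, z, s) (0, 0, 0, 1)) s := by
  have h : HasDerivAt (fun r : ℝ => (x, v, z, r)) (0, 0, 0, 1) s :=
    (hasDerivAt_const s x).prodMk
      ((hasDerivAt_const s v).prodMk ((hasDerivAt_const s z).prodMk (hasDerivAt_id s)))
  exact HasFDerivAt.comp_hasDerivAt s (hΦ.differentiableAt ht (x, v, z, s)).hasFDerivAt h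

theorem IsRegular.fderiv_eq (hΦ : IsRegular S Φ) {t : ℝ} (ht : t ∈ S) (y : ℝ × ℝ × ℝ × ℝ) :
    fderiv ℝ (uncurry4 Φ t) y = gradient Φ t y := by
  obtain ⟨x, v, z, s⟩ := y
  have h1 : dx Φ t x v z s = _ := (hΦ.hasDerivAt_x ht x v z s).deriv
  have h2 : dv Φ t x v z s = _ := (hΦ.hasDerivAt_v ht x v z s).deriv
  have h3 : dz Φ t x v z s = _ := (hΦ.hasDerivAt_z ht x v z s).deriv
  have h4 : ds Φ t x v z s = _ := (hΦ.hasDerivAt_s ht x v z s).deriv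
  ext
  · simp [gradient, linForm_apply, uncurry4, h1]; rfl
  · simp [gradient, linForm_apply, uncurry4, h2]; rfl
  · simp [gradient, linForm_apply, uncurry4, h3]
  · simp [gradient, linForm_apply, uncurry4, h4]

theorem IsRegular.hasFDerivAt (hΦ : IsRegular S Φ) {t : ℝ} (ht : t ∈ S) (y : ℝ × ℝ × ℝ × ℝ) :
    HasFDerivAt (uncurry4 Φ t) (gradient Φ t y) y := by
  rw [← hΦ.fderiv_eq ht]
  exact (hΦ.differentiableAt ht y).hasFDerivAt

theorem IsRegular.continuous_fderiv (hΦ : IsRegular S Φ) {t : ℝ} (ht : t ∈ S)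
    (w : ℝ × ℝ × ℝ × ℝ) : Continuous fun y => fderiv ℝ (uncurry4 Φ t) y w :=
  ((hΦ.contDiff t ht).continuous_fderiv one_ne_zero).clm_apply continuous_const

theorem IsRegular.ldFamily (hΦ : IsRegular S Φ) : LdFamily S Φ :=
  ⟨hΦ.ld, fun t ht => (hΦ.contDiff t ht).continuous⟩

theorem IsRegular.ldFamily_dx (hΦ : IsRegular S Φ) : LdFamily S (dx Φ) :=
  ⟨hΦ.ld_x, fun _ ht => (hΦ.continuous_fderiv ht (1, 0, 0, 0)).congr fun _ =>
    (hΦ.hasDerivAt_x ht _ _ _ _).deriv.symm⟩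

theorem IsRegular.ldFamily_dv (hΦ : IsRegular S Φ) : LdFamily S (dv Φ) :=
  ⟨hΦ.ld_v, fun _ ht => (hΦ.continuous_fderiv ht (0, 1, 0, 0)).congr fun _ =>
    (hΦ.hasDerivAt_v ht _ _ _ _).deriv.symm⟩

theorem IsRegular.ldFamily_dz (hΦ : IsRegular S Φ) : LdFamily S (dz Φ) :=
  ⟨hΦ.ld_z, fun _ ht => (hΦ.continuous_fderiv ht (0, 0, 1, 0)).congr fun _ =>
    (hΦ.hasDerivAt_z ht _ _ _ _).deriv.symm⟩

theorem IsRegular.ldFamily_ds (hΦ : IsRegular S Φ) : LdFamily S (ds Φ) :=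
  ⟨hΦ.ld_s, fun _ ht => (hΦ.continuous_fderiv ht (0, 0, 0, 1)).congr fun _ =>
    (hΦ.hasDerivAt_s ht _ _ _ _).deriv.symm⟩

variable {x u : ℝ → ℝ} {c α β : ℝ}

theorem IsRegular.exists_gradient_uniform (hS : IsCompact S) (hΦ : IsRegular S Φ) (hc : c ∈ S)
    (hx : LdContinuous S x) (hu : LdContinuous S u) (α β : ℝ) {ε : ℝ} (hε : 0 < ε) :
    ∃ δ > 0, ∀ t ∈ S, ∀ q : ℝ × ℝ × ℝ × ℝ, ‖q‖ < δ →
      ‖gradient Φ (max t c) (path S c x u α β t + q) -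
        gradient Φ (max t c) (path S c x u α β t)‖ ≤ ε := by
  have hε4 : 0 < ε / 4 := by positivity
  obtain ⟨δ1, hδ1, h1⟩ := hΦ.ldFamily_dx.exists_uniform hS hc hx hu α β hε4
  obtain ⟨δ2, hδ2, h2⟩ := hΦ.ldFamily_dv.exists_uniform hS hc hx hu α β hε4
  obtain ⟨δ3, hδ3, h3⟩ := hΦ.ldFamily_dz.exists_uniform hS hc hx hu α β hε4
  obtain ⟨δ4, hδ4, h4⟩ := hΦ.ldFamily_ds.exists_uniform hS hc hx hu α β hε4
  refine ⟨min (min δ1 δ2) (min δ3 δ4), by positivity, fun t ht q hq => ?_⟩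
  unfold gradient
  rw [linForm_sub]
  refine (norm_linForm_le (h1 t ht q ?_) (h2 t ht q ?_) (h3 t ht q ?_) (h4 t ht q ?_)).trans
    (by linarith)
  · exact hq.trans_le ((min_le_left _ _).trans (min_le_left _ _))
  · exact hq.trans_le ((min_le_left _ _).trans (min_le_right _ _))
  · exact hq.trans_le ((min_le_right _ _).trans (min_le_left _ _))
  · exact hq.trans_le ((min_le_right _ _).trans (min_le_right _ _))

theorem IsRegular.exists_gradient_bound (hS : IsCompact S) (hΦ : IsRegular S Φ) (hc : c ∈ S)
    (hx : LdContinuous S x) (hu : LdContinuous S u) (α β : ℝ) :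
    ∃ B, 0 ≤ B ∧ ∀ t ∈ S, ‖gradient Φ (max t c) (path S c x u α β t)‖ ≤ B := by
  obtain ⟨B1, hB1, h1⟩ :=
    (hΦ.ldFamily_dx.ldContinuous_path hS.isClosed hc hx hu α β).exists_bound hS
  obtain ⟨B2, hB2, h2⟩ :=
    (hΦ.ldFamily_dv.ldContinuous_path hS.isClosed hc hx hu α β).exists_bound hS
  obtain ⟨B3, hB3, h3⟩ :=
    (hΦ.ldFamily_dz.ldContinuous_path hS.isClosed hc hx hu α β).exists_bound hS
  obtain ⟨B4, hB4, h4⟩ :=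
    (hΦ.ldFamily_ds.ldContinuous_path hS.isClosed hc hx hu α β).exists_bound hS
  refine ⟨4 * (B1 + B2 + B3 + B4), by positivity, fun t ht => ?_⟩
  refine norm_linForm_le ((h1 t ht).trans ?_) ((h2 t ht).trans ?_) ((h3 t ht).trans ?_)
    ((h4 t ht).trans ?_) <;> linarith

/-- First order expansion of `Φ (t, ·)` at the points of a path, uniformly in `t`. -/
theorem IsRegular.exists_linearization (hS : IsCompact S) (hΦ : IsRegular S Φ) (hc : c ∈ S)
    (hx : LdContinuous S x) (hu : LdContinuous S u) (α β : ℝ) {ε : ℝ} (hε : 0 < ε) :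
    ∃ δ > 0, ∀ t ∈ S, ∀ q : ℝ × ℝ × ℝ × ℝ, ‖q‖ < δ →
      |uncurry4 Φ (max t c) (path S c x u α β t + q) -
        uncurry4 Φ (max t c) (path S c x u α β t) -
        gradient Φ (max t c) (path S c x u α β t) q| ≤ ε * ‖q‖ := by
  obtain ⟨δ, hδ, h⟩ := hΦ.exists_gradient_uniform hS hc hx hu α β hε
  refine ⟨δ, hδ, fun t ht q hq => ?_⟩
  have hm := max_mem hc ht
  have key := (convex_ball (path S c x u α β t) δ).norm_image_sub_le_of_norm_hasFDerivWithin_le'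
    (φ := gradient Φ (max t c) (path S c x u α β t))
    (fun y _ => (hΦ.hasFDerivAt hm y).hasFDerivWithinAt) (C := ε)
    (fun y hy => by
      have := h t ht (y - path S c x u α β t) (by rwa [← mem_ball_iff_norm])
      rwa [add_sub_cancel] at this)
    (Metric.mem_ball_self hδ) (y := path S c x u α β t + q) (by simpa using hq)
  rwa [add_sub_cancel_left, Real.norm_eq_abs] at key

/-- A Lipschitz estimate of `Φ (t, ·)` near the points of a path, uniformly in `t`. -/
theorem IsRegular.exists_lipschitz (hS : IsCompact S) (hΦ : IsRegular S Φ) (hc : c ∈ S)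
    (hx : LdContinuous S x) (hu : LdContinuous S u) (α β : ℝ) :
    ∃ L, 0 ≤ L ∧ ∃ δ > 0, ∀ t ∈ S, ∀ q q' : ℝ × ℝ × ℝ × ℝ, ‖q‖ < δ → ‖q'‖ < δ →
      |uncurry4 Φ (max t c) (path S c x u α β t + q) -
        uncurry4 Φ (max t c) (path S c x u α β t + q')| ≤ L * ‖q - q'‖ := by
  obtain ⟨δ, hδ, h⟩ := hΦ.exists_gradient_uniform hS hc hx hu α β one_pos
  obtain ⟨B, hB, h'⟩ := hΦ.exists_gradient_bound hS hc hx hu α β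
  refine ⟨B + 1, by positivity, δ, hδ, fun t ht q q' hq hq' => ?_⟩
  have hm := max_mem hc ht
  have key := (convex_ball (path S c x u α β t) δ).norm_image_sub_le_of_norm_hasFDerivWithin_le
    (fun y _ => (hΦ.hasFDerivAt hm y).hasFDerivWithinAt) (C := B + 1)
    (fun y hy => by
      have := h t ht (y - path S c x u α β t) (by rwa [← mem_ball_iff_norm])
      rw [add_sub_cancel] at this
      have h2 := norm_add_le (gradient Φ (max t c) y -
        gradient Φ (max t c) (path S c x u α β t)) (gradient Φ (max t c) (path S c x u α β t))
      rw [sub_add_cancel] at h2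
      linarith [h' t ht])
    (x := path S c x u α β t + q') (by simpa using hq')
    (y := path S c x u α β t + q) (by simpa using hq)
  rwa [add_sub_add_left_eq_sub, Real.norm_eq_abs] at key

end IsRegular

end TimeScale

namespace TimeScale

/-! ### Response of the state to a perturbation -/

open MeasureTheory intervalIntegral

/-- `v` moved into `[-δ, δ]`. -/
noncomputable def clamp (δ v : ℝ) : ℝ := max (-δ) (min δ v)

theorem abs_clamp_le {δ : ℝ} (hδ : 0 ≤ δ) (v : ℝ) : |clamp δ v| ≤ δ := by
  unfold clamp
  exact abs_le.2 ⟨le_max_left _ _, max_le (by linarith) (min_le_left _ _)⟩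

theorem clamp_of_abs_le {δ v : ℝ} (h : |v| ≤ δ) : clamp δ v = v := by
  unfold clamp
  rw [min_eq_right (abs_le.1 h).2, max_eq_right (abs_le.1 h).1]

theorem abs_clamp_sub_clamp_le (δ v w : ℝ) : |clamp δ v - clamp δ w| ≤ |v - w| := by
  unfold clamp
  refine (abs_max_sub_max_le_max _ _ _ _).trans (max_le (by simp) ?_)
  exact (abs_min_sub_min_le_max _ _ _ _).trans (max_le (by simp) le_rfl)

theorem abs_clamp_le_abs {δ : ℝ} (hδ : 0 ≤ δ) (v : ℝ) : |clamp δ v| ≤ |v| := by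
  have h := abs_clamp_sub_clamp_le δ v 0
  rwa [clamp_of_abs_le (v := 0) (by simpa using hδ), sub_zero, sub_zero] at h

theorem continuous_clamp (δ : ℝ) : Continuous (clamp δ) :=
  continuous_const.max (continuous_const.min continuous_id)

/-- A state `x` and a control `u` on a time scale `S` from `A` to `b`, with a point `a` of `S` at
which the control problem starts. -/
structure Trajectory where
  S : Set ℝ
  A : ℝ
  a : ℝ
  b : ℝ
  x : ℝ → ℝ
  u : ℝ → ℝ
  spans : Spans S A b
  a_mem : a ∈ S
  a_lt : a < b
  x_cont : ContinuousOn x S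
  u_ld : LdContinuous S u

namespace Trajectory

variable (R : Trajectory)

/-- The delayed time: the backward jump, cut off at `a`. -/
noncomputable def delay (t : ℝ) : ℝ := back R.S R.a t

/-- The arguments `(x^ρ(t), u^ρ(t), x(a), x(b))`, cut off at `a`. -/
noncomputable def args (t : ℝ) : ℝ × ℝ × ℝ × ℝ := path R.S R.a R.x R.u (R.x R.a) (R.x R.b) t

/-- `Φ (t, ·)` along the trajectory, cut off at `a`. -/
noncomputable def along (Φ : ℝ → ℝ → ℝ → ℝ → ℝ → ℝ) (t : ℝ) : ℝ :=
  uncurry4 Φ (max t R.a) (R.args t)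

/-- The increment of `Φ (t, ·)` from the trajectory to the arguments that differ by `q`. -/
noncomputable def incr (Φ : ℝ → ℝ → ℝ → ℝ → ℝ → ℝ) (t : ℝ) (q : ℝ × ℝ × ℝ × ℝ) : ℝ :=
  uncurry4 Φ (max t R.a) (R.args t + q) - uncurry4 Φ (max t R.a) (R.args t)

/-- The change of the arguments if the state, the control, the initial and the final state change
by `ξ`, `ω`, `z`, `s`. -/
noncomputable def pert (ξ ω : ℝ → ℝ) (z s t : ℝ) : ℝ × ℝ × ℝ × ℝ :=
  (ξ (R.delay t), ω (R.delay t), z, s)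

/-- `N` bounds the changes `ω` of the control, `z` of the initial and `s` of the final state. -/
structure PertLe (ω : ℝ → ℝ) (z s N : ℝ) : Prop where
  control : ∀ t ∈ R.S, |ω t| ≤ N
  left : |z| ≤ N
  right : |s| ≤ N

/-- The state changes by `ξ` if the control changes by `ω`, the initial state by `z`, and the
argument of `g` for the final state by `s`. It is not required that `ξ` and `s` agree at `b`. -/
structure IsResponse (g : ℝ → ℝ → ℝ → ℝ → ℝ → ℝ) (ω : ℝ → ℝ) (z s : ℝ) (ξ : ℝ → ℝ) : Prop where
  control : LdContinuous R.S ω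
  cont : ContinuousOn ξ (Icc R.A R.b)
  eq : ∀ t ∈ Icc R.A R.b,
    ξ t = z + ∫ τ in R.a..t, R.incr g (ceil R.S τ) (R.pert ξ ω z s (ceil R.S τ))

variable {R}
variable {f g Φ : ℝ → ℝ → ℝ → ℝ → ℝ → ℝ} {ω ω' ξ ξ' : ℝ → ℝ} {z s z' s' N : ℝ}

theorem x_ld (R : Trajectory) : LdContinuous R.S R.x := R.x_cont.ldContinuous

theorem a_mem_Icc (R : Trajectory) : R.a ∈ Icc R.A R.b := R.spans.subset R.a_mem

theorem delay_mem {t : ℝ} (ht : t ∈ R.S) : R.delay t ∈ R.S := back_mem R.spans.closed R.a_mem ht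

theorem delay_mem_Icc {t : ℝ} (ht : t ∈ R.S) : R.delay t ∈ Icc R.a R.b :=
  ⟨le_back _ _ _, (R.spans.subset (delay_mem ht)).2⟩

theorem delay_ceil_mem {τ : ℝ} (hτ : τ ∈ Ioc R.a R.b) : R.delay (ceil R.S τ) ∈ Icc R.a τ := by
  refine ⟨le_back _ _ _, ?_⟩
  unfold delay
  rw [back_of_lt R.a_mem (hτ.1.trans_le (R.spans.le_ceil hτ.2))]
  exact R.spans.rho_ceil_le (R.a_mem_Icc.1.trans hτ.1.le) hτ.2

theorem norm_pert_le {t M : ℝ} (ht : t ∈ R.S) (h : R.PertLe ω z s N)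
    (hξ : |ξ (R.delay t)| ≤ M) : ‖R.pert ξ ω z s t‖ ≤ max M N :=
  norm_le_of_abs_le (hξ.trans (le_max_left _ _))
    ((h.control _ (delay_mem ht)).trans (le_max_right _ _)) (h.left.trans (le_max_right _ _))
    (h.right.trans (le_max_right _ _))

theorem norm_pert_sub_le {t D : ℝ} (ht : t ∈ R.S)
    (h : R.PertLe (fun t => ω t - ω' t) (z - z') (s - s') D) :
    ‖R.pert ξ ω z s t - R.pert ξ' ω' z' s' t‖ ≤ |ξ (R.delay t) - ξ' (R.delay t)| + D := by
  have hD : 0 ≤ D := (abs_nonneg _).trans h.left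
  refine norm_le_of_abs_le (le_add_of_nonneg_right hD) ((h.control _ (delay_mem ht)).trans ?_)
    (h.left.trans ?_) (h.right.trans ?_) <;>
  exact le_add_of_nonneg_left (abs_nonneg _)

theorem ldContinuous_along (hΦ : LdFamily R.S Φ) : LdContinuous R.S (R.along Φ) :=
  hΦ.ldContinuous_path R.spans.closed R.a_mem R.x_ld R.u_ld _ _

theorem ldContinuous_incr (hΦ : LdFamily R.S Φ) (hξ : ContinuousOn ξ R.S)
    (hω : LdContinuous R.S ω) (z s : ℝ) :
    LdContinuous R.S fun t => R.incr Φ t (R.pert ξ ω z s t) :=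
  (hΦ.ldContinuous_path R.spans.closed R.a_mem (R.x_ld.add hξ.ldContinuous) (R.u_ld.add hω)
    (R.x R.a + z) (R.x R.b + s)).sub (ldContinuous_along hΦ)

theorem IsResponse.contOn (h : R.IsResponse g ω z s ξ) : ContinuousOn ξ R.S :=
  h.cont.mono R.spans.subset

theorem IsResponse.apply_a (h : R.IsResponse g ω z s ξ) : ξ R.a = z := by
  rw [h.eq _ R.a_mem_Icc, integral_same, add_zero]

theorem IsResponse.hasNablaDerivAt (hg : LdFamily R.S g)
    (h : R.IsResponse g ω z s ξ) {t : ℝ} (ht : t ∈ R.S) :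
    HasNablaDerivAt R.S ξ (R.incr g t (R.pert ξ ω z s t)) t :=
  ((hasNablaDerivAt_integral R.spans (ldContinuous_incr hg h.contOn h.control z s) R.a_mem_Icc
    ht).const_add z).congr R.spans.closed ht fun r hr => h.eq r (R.spans.subset hr)

/-- Small perturbations have responses, which depend on them in a Lipschitz continuous way. -/
theorem exists_response (hg : IsRegular R.S g) : ∃ r > 0, ∃ C ≥ 0,
    (∀ ω z s N, LdContinuous R.S ω → R.PertLe ω z s N → N ≤ r →
      ∃ ξ, R.IsResponse g ω z s ξ ∧ ∀ t ∈ Icc R.a R.b, |ξ t| ≤ C * N) ∧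
    (∀ ω z s ξ ω' z' s' ξ' D, R.PertLe ω z s r → R.PertLe ω' z' s' r →
      R.IsResponse g ω z s ξ → R.IsResponse g ω' z' s' ξ' →
      (∀ t ∈ Icc R.a R.b, |ξ t| ≤ C * r) → (∀ t ∈ Icc R.a R.b, |ξ' t| ≤ C * r) →
      R.PertLe (fun t => ω t - ω' t) (z - z') (s - s') D →
      ∀ t ∈ Icc R.a R.b, |ξ t - ξ' t| ≤ C * D) ∧
    (∀ t ∈ R.S, ∀ q, ‖q‖ ≤ max (C * r) r → |R.incr g t q| ≤ C * ‖q‖) := by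
  obtain ⟨L, hL, δ, hδ, hlip'⟩ :=
    hg.exists_lipschitz R.spans.isCompact R.a_mem R.x_ld R.u_ld (R.x R.a) (R.x R.b)
  have hlip : ∀ t ∈ R.S, ∀ q q', ‖q‖ < δ → ‖q'‖ < δ →
      |R.incr g t q - R.incr g t q'| ≤ L * ‖q - q'‖ := by
    intro t ht q q' hq hq'
    unfold incr
    rw [sub_sub_sub_cancel_right]
    exact hlip' t ht q q' hq hq'
  have hzero : ∀ t, R.incr g t 0 = 0 := fun t => by simp [incr]
  set ρ := δ / 2 with hρ
  have hρ0 : 0 < ρ := by positivity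
  have hρδ : ρ < δ := by linarith
  have hba : 0 ≤ R.b - R.a := sub_nonneg.2 R.a_lt.le
  set C := 2 * Real.exp ((2 * L + 1) * (R.b - R.a)) * (1 + L * (R.b - R.a)) + L with hC
  have hC0 : 0 ≤ C := by positivity
  have hCle : ∀ D : ℝ, 0 ≤ D →
      2 * Real.exp ((2 * L + 1) * (R.b - R.a)) * (D + L * D * (R.b - R.a)) ≤ C * D := by
    intro D hD
    rw [hC]
    nlinarith [mul_nonneg hL hD]
  set r := ρ / (C + 1) with hr
  have hr0 : 0 < r := by positivity
  have hCr : C * r ≤ ρ := by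
    rw [hr, mul_div_assoc', div_le_iff₀ (by positivity)]; nlinarith
  have hrρ : r ≤ ρ := div_le_self hρ0.le (by linarith)
  have hθ : ∀ τ ∈ Ioc R.a R.b, R.delay (ceil R.S τ) ∈ Icc R.a τ := fun τ => delay_ceil_mem
  refine ⟨r, hr0, C, hC0, ?_, ?_, ?_⟩
  · intro ω z s N hω hN hNr
    have hN0 : 0 ≤ N := (abs_nonneg _).trans hN.left
    -- the equation with the state clamped is globally Lipschitz
    let φ : ℝ → ℝ → ℝ := fun τ v =>
      R.incr g (ceil R.S τ) (clamp ρ v, ω (R.delay (ceil R.S τ)), z, s)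
    have hφ : ∀ y : ℝ → ℝ, (fun τ => φ τ (y (R.delay (ceil R.S τ)))) = fun τ =>
        R.incr g (ceil R.S τ) (R.pert (fun t => clamp ρ (y t)) ω z s (ceil R.S τ)) :=
      fun y => rfl
    have hsmall : ∀ τ ≤ R.b, ∀ v, ‖(clamp ρ v, ω (R.delay (ceil R.S τ)), z, s)‖ < δ := by
      intro τ hτ v
      refine lt_of_le_of_lt (norm_le_of_abs_le (N := ρ) (abs_clamp_le hρ0.le v) ?_ ?_ ?_) hρδ
      · exact (hN.control _ (delay_mem (R.spans.ceil_mem hτ))).trans (hNr.trans hrρ)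
      · exact hN.left.trans (hNr.trans hrρ)
      · exact hN.right.trans (hNr.trans hrρ)
    obtain ⟨y, hy, hyeq⟩ := exists_volterra R.a_lt.le hL hθ (φ := φ)
      (fun y hy => by
        rw [hφ y]
        exact (ldContinuous_incr hg.ldFamily ((continuous_clamp ρ).comp hy).continuousOn hω z
          s).intervalIntegrable R.spans R.a_mem_Icc (R.spans.subset R.spans.right_mem))
      (fun τ hτ v v' => by
        refine (hlip _ (R.spans.ceil_mem hτ.2) _ _ (hsmall τ hτ.2 v)
          (hsmall τ hτ.2 v')).trans ?_
        gcongr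
        refine norm_le_of_abs_le (abs_clamp_sub_clamp_le _ _ _) ?_ ?_ ?_ <;> simp) z
    have hybound : ∀ t ∈ Icc R.a R.b, |y t| ≤ C * N := by
      intro t ht
      refine (gronwall_delay hL hN0 (mul_nonneg hL hN0) hθ (e := y)
        (k := fun τ => φ τ (y (R.delay (ceil R.S τ)))) hy.continuousOn ?_ ?_ ht).trans (hCle N hN0)
      · intro t ht
        rw [hyeq t ht]
        exact (abs_add_le _ _).trans (by linarith [hN.left])
      · intro τ hτ
        have h1 := hlip _ (R.spans.ceil_mem hτ.2) _ 0
          (hsmall τ hτ.2 (y (R.delay (ceil R.S τ)))) (by simpa using hδ)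
        rw [hzero, sub_zero, sub_zero] at h1
        refine h1.trans ?_
        rw [← mul_add]
        refine mul_le_mul_of_nonneg_left ?_ hL
        refine norm_le_of_abs_le ?_ ?_ ?_ ?_
        · exact (abs_clamp_le_abs hρ0.le _).trans (by linarith)
        · exact (hN.control _ (delay_mem (R.spans.ceil_mem hτ.2))).trans
            (le_add_of_nonneg_left (abs_nonneg _))
        · exact hN.left.trans (le_add_of_nonneg_left (abs_nonneg _))
        · exact hN.right.trans (le_add_of_nonneg_left (abs_nonneg _))
    have hclamp : ∀ t ∈ Icc R.a R.b, clamp ρ (y t) = y t := fun t ht =>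
      clamp_of_abs_le ((hybound t ht).trans ((mul_le_mul_of_nonneg_left hNr hC0).trans hCr))
    -- continue the solution to the left of `a` by the same integral
    set ξ : ℝ → ℝ := fun t => z + ∫ τ in R.a..t, R.incr g (ceil R.S τ)
      (R.pert (fun t => clamp ρ (y t)) ω z s (ceil R.S τ)) with hξ
    have hξy : ∀ t ∈ Icc R.a R.b, ξ t = y t := fun t ht => (hyeq t ht).symm
    have hld := ldContinuous_incr hg.ldFamily
      ((continuous_clamp ρ).comp hy).continuousOn hω z s
    refine ⟨ξ, ⟨hω, ?_, ?_⟩, fun t ht => by rw [hξy t ht]; exact hybound t ht⟩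
    · refine continuousOn_const.add ?_
      have hA := hld.intervalIntegrable R.spans (R.spans.subset R.spans.left_mem)
        (R.spans.subset R.spans.right_mem)
      have := continuousOn_primitive_interval' hA
        (by rw [uIcc_of_le R.spans.lt.le]; exact R.a_mem_Icc)
      rwa [uIcc_of_le R.spans.lt.le] at this
    · intro t ht
      rw [hξ]
      simp only
      congr 1
      refine integral_congr_ae (Eventually.of_forall fun τ hτ => ?_)
      have hτb : τ ≤ R.b := hτ.2.trans (max_le R.a_lt.le ht.2)
      have hm := delay_mem_Icc (R.spans.ceil_mem hτb)
      have h1 : R.pert (fun t => clamp ρ (y t)) ω z s (ceil R.S τ) =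
          R.pert ξ ω z s (ceil R.S τ) := by
        unfold pert
        simp only [hclamp _ hm, hξy _ hm]
      rw [h1]
  · intro ω z s ξ ω' z' s' ξ' D h h' hξ hξ' hξr hξr' hD t ht
    have hD0 : 0 ≤ D := (abs_nonneg _).trans hD.left
    have hsub : Icc R.a R.b ⊆ Icc R.A R.b := Icc_subset_Icc_left R.a_mem_Icc.1
    have hsmall : ∀ {ω z s ξ}, R.PertLe ω z s r → (∀ t ∈ Icc R.a R.b, |ξ t| ≤ C * r) →
        ∀ t ∈ R.S, ‖R.pert ξ ω z s t‖ < δ := fun {ω z s ξ} h hξ t ht =>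
      (norm_pert_le ht h (hξ _ (delay_mem_Icc ht))).trans_lt
        ((max_le hCr hrρ).trans_lt hρδ)
    have hk : ∀ τ ∈ Ioc R.a R.b, |R.incr g (ceil R.S τ) (R.pert ξ ω z s (ceil R.S τ)) -
        R.incr g (ceil R.S τ) (R.pert ξ' ω' z' s' (ceil R.S τ))| ≤
        L * |ξ (R.delay (ceil R.S τ)) - ξ' (R.delay (ceil R.S τ))| + L * D := by
      intro τ hτ
      have hm := R.spans.ceil_mem hτ.2
      rw [← mul_add]
      exact (hlip _ hm _ _ (hsmall h hξr _ hm) (hsmall h' hξr' _ hm)).trans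
        (mul_le_mul_of_nonneg_left (norm_pert_sub_le hm hD) hL)
    have hint : ∀ {ω z s ξ}, R.IsResponse g ω z s ξ → ∀ t ∈ Icc R.a R.b, IntervalIntegrable
        (fun τ => R.incr g (ceil R.S τ) (R.pert ξ ω z s (ceil R.S τ))) volume R.a t :=
      fun {ω z s ξ} hξ t ht => (ldContinuous_incr hg.ldFamily hξ.contOn hξ.control z
        s).intervalIntegrable R.spans R.a_mem_Icc (hsub ht)
    refine (gronwall_delay hL hD0 (mul_nonneg hL hD0) hθ
      (e := fun t => ξ t - ξ' t) ((hξ.cont.mono hsub).sub (hξ'.cont.mono hsub)) ?_ hk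
      ht).trans (hCle D hD0)
    intro t ht
    rw [hξ.eq t (hsub ht), hξ'.eq t (hsub ht), add_sub_add_comm,
      ← integral_sub (hint hξ t ht) (hint hξ' t ht)]
    exact (abs_add_le _ _).trans (by linarith [hD.left])
  · intro t ht q hq
    have h1 := hlip t ht q 0 (hq.trans_lt ((max_le hCr hrρ).trans_lt hρδ)) (by simpa using hδ)
    rw [hzero, sub_zero, sub_zero] at h1
    refine h1.trans (mul_le_mul_of_nonneg_right ?_ (norm_nonneg _))
    rw [hC]
    exact le_add_of_nonneg_left (by positivity)

end Trajectory

end TimeScale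

namespace TimeScale

/-! ### Costates and the first variation -/

open MeasureTheory intervalIntegral

namespace Trajectory

variable {R : Trajectory} {f g F G : ℝ → ℝ → ℝ → ℝ → ℝ → ℝ} {ω ω' ξ p p₀ p₁ : ℝ → ℝ}
  {z s z' s' l N : ℝ}

/-- The combination `l F + p G` along the trajectory, cut off at `a`. For a partial derivative `F`
of the cost and the same partial derivative `G` of the dynamics this is the partial derivative of
the Hamiltonian. -/
noncomputable def hamil (R : Trajectory) (F G : ℝ → ℝ → ℝ → ℝ → ℝ → ℝ) (l : ℝ) (p : ℝ → ℝ)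
    (t : ℝ) : ℝ :=
  l * R.along F t + p (max t R.a) * R.along G t

/-- `p` satisfies the adjoint equation with the cost multiplier `l`. -/
def IsCostate (R : Trajectory) (f g : ℝ → ℝ → ℝ → ℝ → ℝ → ℝ) (l : ℝ) (p : ℝ → ℝ) : Prop :=
  ∀ t ∈ R.S, HasNablaDerivAt R.S p (-R.hamil (dx f) (dx g) l p t) t

theorem max_eq_of_mem_Ioc {τ : ℝ} (hτ : τ ∈ Ioc R.a R.b) :
    max (ceil R.S τ) R.a = ceil R.S τ :=
  max_eq_left (hτ.1.le.trans (R.spans.le_ceil hτ.2))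

theorem _root_.ContinuousOn.comp_max (hp : ContinuousOn p R.S) :
    ContinuousOn (fun t => p (max t R.a)) R.S :=
  hp.comp (continuous_id.max continuous_const).continuousOn fun _ ht => max_mem R.a_mem ht

theorem ldContinuous_hamil (hF : LdFamily R.S F) (hG : LdFamily R.S G) (l : ℝ)
    (hp : ContinuousOn p R.S) : LdContinuous R.S (R.hamil F G l p) :=
  ((ldContinuous_along hF).const_mul l).add
    (hp.comp_max.ldContinuous.mul (ldContinuous_along hG))

theorem IsCostate.continuousOn (hp : R.IsCostate f g l p) : ContinuousOn p R.S :=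
  fun t ht => (hp t ht).continuousWithinAt ht

theorem IsCostate.c1ld (hf : IsRegular R.S f) (hg : IsRegular R.S g)
    (hp : R.IsCostate f g l p) : C1ld R.S p :=
  c1ld_of_hasNablaDerivAt R.spans
    (ldContinuous_hamil hf.ldFamily_dx hg.ldFamily_dx l hp.continuousOn).neg
    fun t ht => hp t ht.1

theorem IsCostate.add_const_mul (h₁ : R.IsCostate f g 1 p₁) (h₀ : R.IsCostate f g 0 p₀) (c : ℝ) :
    R.IsCostate f g 1 fun t => p₁ t + c * p₀ t := by
  intro t ht
  have hc : HasNablaDerivAt R.S (fun _ => c) 0 t := fun ε hε =>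
    ⟨1, one_pos, fun s _ _ => by simpa using mul_nonneg hε.le (abs_nonneg _)⟩
  have h := (h₁ t ht).add (hc.mul ht (h₀ t ht))
  convert h using 1
  unfold hamil
  ring

/-- The adjoint equation can be solved backward from any final value. -/
theorem exists_isCostate (hf : IsRegular R.S f) (hg : IsRegular R.S g) (l c : ℝ) :
    ∃ p, R.IsCostate f g l p ∧ p R.b = c := by
  have hldf := ldContinuous_along hf.ldFamily_dx
  have hldg := ldContinuous_along hg.ldFamily_dx
  obtain ⟨L, hL, hbound⟩ := hldg.exists_bound R.spans.isCompact
  have hb : R.b ∈ Icc R.A R.b := R.spans.subset R.spans.right_mem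
  have hcut : ∀ (y : ℝ → ℝ), ∀ τ ∈ Ioc R.a R.b, l * R.along (dx f) (ceil R.S τ) +
      y (ceil R.S τ) * R.along (dx g) (ceil R.S τ) =
      R.hamil (dx f) (dx g) l y (ceil R.S τ) := by
    intro y τ hτ
    unfold hamil
    rw [max_eq_of_mem_Ioc hτ]
  obtain ⟨y, hy, hyeq⟩ := exists_volterra_backward R.a_lt.le hL (θ := ceil R.S)
    (φ := fun τ v => l * R.along (dx f) (ceil R.S τ) + v * R.along (dx g) (ceil R.S τ))
    (fun τ hτ => ⟨R.spans.le_ceil hτ.2.le, ceil_le R.spans.right_mem hτ.2.le⟩)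
    (fun y hy => ((hldf.const_mul l).add (hy.continuousOn.ldContinuous.mul hldg)).intervalIntegrable
      R.spans R.a_mem_Icc hb)
    (fun τ hτ v v' => by
      rw [add_sub_add_left_eq_sub, ← sub_mul, abs_mul, mul_comm]
      gcongr
      exact hbound _ (R.spans.ceil_mem hτ.2.le)) c
  set p : ℝ → ℝ := fun t => c - ∫ τ in R.b..t, R.hamil (dx f) (dx g) l y (ceil R.S τ) with hp
  have hpy : ∀ t ∈ Icc R.a R.b, p t = y t := by
    intro t ht
    rw [hyeq t ht, hp]
    simp only
    rw [integral_symm, sub_neg_eq_add]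
    congr 1
    refine integral_congr_ae (Eventually.of_forall fun τ hτ => ?_)
    rw [uIoc_of_le ht.2] at hτ
    exact (hcut y τ ⟨ht.1.trans_lt hτ.1, hτ.2⟩).symm
  refine ⟨p, fun t ht => ?_, by simp [hp]⟩
  have h1 := hasNablaDerivAt_integral R.spans
    (ldContinuous_hamil hf.ldFamily_dx hg.ldFamily_dx l hy.continuousOn) hb ht
  have h2 : R.hamil (dx f) (dx g) l p t = R.hamil (dx f) (dx g) l y t := by
    unfold hamil
    rw [hpy]
    exact ⟨le_max_right _ _, (R.spans.subset (max_mem R.a_mem ht)).2⟩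
  rw [h2]
  exact h1.neg.const_add c

/-- The first variation of `p(b) ξ(b) - p(a) z + l ∫ f` with respect to the control `ω`, the
initial state `z` and the final state `s`. -/
noncomputable def firstVar (R : Trajectory) (f g : ℝ → ℝ → ℝ → ℝ → ℝ → ℝ) (l : ℝ) (p : ℝ → ℝ)
    (ω : ℝ → ℝ) (z s : ℝ) : ℝ :=
  (∫ τ in R.a..R.b, R.hamil (dv f) (dv g) l p (ceil R.S τ) * ω (R.delay (ceil R.S τ))) +
    (∫ τ in R.a..R.b, R.hamil (dz f) (dz g) l p (ceil R.S τ)) * z +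
    (∫ τ in R.a..R.b, R.hamil (ds f) (ds g) l p (ceil R.S τ)) * s

theorem ldContinuous_comp_delay (hω : LdContinuous R.S ω) :
    LdContinuous R.S fun t => ω (R.delay t) := by
  -- the coordinate function `v` is a continuous family
  have h : LdFamily R.S (fun _ _ v _ _ => v) := by
    refine ⟨fun t _ y => ⟨fun _ => ?_, fun _ => ⟨y.2.1, ?_⟩⟩, fun t _ => ?_⟩
    · exact (Continuous.continuousWithinAt (by fun_prop))
    · exact ((by fun_prop : Continuous fun q : ℝ × (ℝ × ℝ × ℝ × ℝ) => q.2.2.1).tendsto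
        (t, y)).mono_left nhdsWithin_le_nhds
    · unfold uncurry4
      fun_prop
  exact h.ldContinuous_path R.spans.closed R.a_mem hω hω 0 0

theorem firstVar_linear (hf : IsRegular R.S f) (hg : IsRegular R.S g) (hp : ContinuousOn p R.S)
    (hω : LdContinuous R.S ω) (hω' : LdContinuous R.S ω') (σ ε : ℝ) :
    R.firstVar f g l p (fun t => σ * ω t + ε * ω' t) (σ * z + ε * z') (σ * s + ε * s') =
      σ * R.firstVar f g l p ω z s + ε * R.firstVar f g l p ω' z' s' := by
  have hii : ∀ {ω : ℝ → ℝ}, LdContinuous R.S ω → IntervalIntegrable (fun τ =>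
      R.hamil (dv f) (dv g) l p (ceil R.S τ) * ω (R.delay (ceil R.S τ))) volume R.a R.b :=
    fun {ω} hω => ((ldContinuous_hamil hf.ldFamily_dv hg.ldFamily_dv l hp).mul
      (ldContinuous_comp_delay hω)).intervalIntegrable R.spans R.a_mem_Icc
      (R.spans.subset R.spans.right_mem)
  have h1 : ∫ τ in R.a..R.b, R.hamil (dv f) (dv g) l p (ceil R.S τ) *
      (σ * ω (R.delay (ceil R.S τ)) + ε * ω' (R.delay (ceil R.S τ))) =
      σ * (∫ τ in R.a..R.b, R.hamil (dv f) (dv g) l p (ceil R.S τ) * ω (R.delay (ceil R.S τ))) +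
      ε * ∫ τ in R.a..R.b, R.hamil (dv f) (dv g) l p (ceil R.S τ) *
        ω' (R.delay (ceil R.S τ)) := by
    rw [← intervalIntegral.integral_const_mul, ← intervalIntegral.integral_const_mul,
      ← integral_add ((hii hω).const_mul σ) ((hii hω').const_mul ε)]
    congr 1
    ext τ
    ring
  unfold firstVar
  rw [h1]
  ring

theorem firstVar_add_const_mul (hf : IsRegular R.S f) (hg : IsRegular R.S g)
    (hp₁ : ContinuousOn p₁ R.S) (hp₀ : ContinuousOn p₀ R.S) (hω : LdContinuous R.S ω) (c : ℝ) :
    R.firstVar f g 1 (fun t => p₁ t + c * p₀ t) ω z s =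
      R.firstVar f g 1 p₁ ω z s + c * R.firstVar f g 0 p₀ ω z s := by
  have hb := R.spans.subset R.spans.right_mem
  have key : ∀ F G : ℝ → ℝ → ℝ → ℝ → ℝ → ℝ, LdFamily R.S F → LdFamily R.S G → ∀ h : ℝ → ℝ,
      LdContinuous R.S h →
      ∫ τ in R.a..R.b, R.hamil F G 1 (fun t => p₁ t + c * p₀ t) (ceil R.S τ) * h (ceil R.S τ) =
      (∫ τ in R.a..R.b, R.hamil F G 1 p₁ (ceil R.S τ) * h (ceil R.S τ)) +
      c * ∫ τ in R.a..R.b, R.hamil F G 0 p₀ (ceil R.S τ) * h (ceil R.S τ) := by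
    intro F G hF hG h hh
    have i1 := ((ldContinuous_hamil hF hG 1 hp₁).mul hh).intervalIntegrable R.spans R.a_mem_Icc hb
    have i0 := ((ldContinuous_hamil hF hG 0 hp₀).mul hh).intervalIntegrable R.spans R.a_mem_Icc hb
    rw [← intervalIntegral.integral_const_mul, ← integral_add i1 (i0.const_mul c)]
    congr 1
    ext τ
    unfold hamil
    ring
  have k1 := key _ _ hf.ldFamily_dv hg.ldFamily_dv _ (ldContinuous_comp_delay hω)
  have k2 := key _ _ hf.ldFamily_dz hg.ldFamily_dz _ (ldContinuous_const 1)
  have k3 := key _ _ hf.ldFamily_ds hg.ldFamily_ds _ (ldContinuous_const 1)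
  simp only [mul_one] at k2 k3
  unfold firstVar
  rw [k1, k2, k3]
  ring

/-- First order expansion of cost and final state: integration by parts against a costate removes
the response `ξ` from the integral, up to a remainder of higher order. -/
theorem exists_expansion (hf : IsRegular R.S f) (hg : IsRegular R.S g)
    (hp : R.IsCostate f g l p) {C : ℝ} (hC : 0 ≤ C) {κ : ℝ} (hκ : 0 < κ) :
    ∃ δ > 0, ∀ ω z s ξ N, R.PertLe ω z s N → R.IsResponse g ω z s ξ →
      (∀ t ∈ Icc R.a R.b, |ξ t| ≤ C * N) → N < δ →
      |p R.b * ξ R.b - p R.a * z +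
        l * (∫ τ in R.a..R.b, R.incr f (ceil R.S τ) (R.pert ξ ω z s (ceil R.S τ))) -
        R.firstVar f g l p ω z s| ≤ κ * N := by
  have hb := R.spans.subset R.spans.right_mem
  have hpc := hp.continuousOn
  obtain ⟨P, hP, hPb⟩ := hpc.ldContinuous.exists_bound R.spans.isCompact
  have hba : 0 < R.b - R.a := sub_pos.2 R.a_lt
  set ε := κ / ((P + |l| + 1) * (C + 1) * (R.b - R.a)) with hε
  have hε0 : 0 < ε := by positivity
  obtain ⟨δ₁, hδ₁, h₁⟩ := hf.exists_linearization R.spans.isCompact R.a_mem R.x_ld R.u_ld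
    (R.x R.a) (R.x R.b) hε0
  obtain ⟨δ₂, hδ₂, h₂⟩ := hg.exists_linearization R.spans.isCompact R.a_mem R.x_ld R.u_ld
    (R.x R.a) (R.x R.b) hε0
  refine ⟨min δ₁ δ₂ / (C + 1), by positivity, fun ω z s ξ N hN hξ hξN hNδ => ?_⟩
  have hN0 : 0 ≤ N := (abs_nonneg _).trans hN.left
  have hω := hξ.control
  set q : ℝ → ℝ × ℝ × ℝ × ℝ := R.pert ξ ω z s with hq
  have hqN : ∀ t ∈ R.S, ‖q t‖ ≤ (C + 1) * N := fun t ht =>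
    (norm_pert_le ht hN (hξN _ (delay_mem_Icc ht))).trans
      (max_le (by nlinarith) (by nlinarith))
  have hqδ : ∀ t ∈ R.S, ‖q t‖ < min δ₁ δ₂ := fun t ht => by
    refine (hqN t ht).trans_lt ?_
    rwa [lt_div_iff₀ (by positivity), mul_comm] at hNδ
  -- integration by parts
  have hincr_f := ldContinuous_incr hf.ldFamily hξ.contOn hω z s
  have hincr_g := ldContinuous_incr hg.ldFamily hξ.contOn hω z s
  have hx := ldContinuous_hamil hf.ldFamily_dx hg.ldFamily_dx l hpc
  have hv := ldContinuous_hamil hf.ldFamily_dv hg.ldFamily_dv l hpc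
  have hz := ldContinuous_hamil hf.ldFamily_dz hg.ldFamily_dz l hpc
  have hs := ldContinuous_hamil hf.ldFamily_ds hg.ldFamily_ds l hpc
  have hprod : LdContinuous R.S fun t => p t * R.incr g t (q t) +
      -R.hamil (dx f) (dx g) l p t * ξ (rho R.S t) :=
    (hpc.ldContinuous.mul hincr_g).add
      (hx.neg.mul (hξ.contOn.ldContinuous.comp_rho R.spans.closed))
  have hparts := integral_eq_sub_of_hasNablaDerivAt R.spans hprod
    (fun t ht => (hp t ht.1).mul ht.1 (hξ.hasNablaDerivAt hg.ldFamily ht.1))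
    R.a_mem R.spans.right_mem
  simp only [hξ.apply_a] at hparts
  have ii : ∀ {h : ℝ → ℝ}, LdContinuous R.S h →
      IntervalIntegrable (fun τ => h (ceil R.S τ)) volume R.a R.b :=
    fun hh => hh.intervalIntegrable R.spans R.a_mem_Icc hb
  have hrem : p R.b * ξ R.b - p R.a * z +
        l * (∫ τ in R.a..R.b, R.incr f (ceil R.S τ) (q (ceil R.S τ))) -
        R.firstVar f g l p ω z s =
      ∫ τ in R.a..R.b, ((p (ceil R.S τ) * R.incr g (ceil R.S τ) (q (ceil R.S τ)) +
        -R.hamil (dx f) (dx g) l p (ceil R.S τ) * ξ (rho R.S (ceil R.S τ))) +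
        l * R.incr f (ceil R.S τ) (q (ceil R.S τ)) -
        (R.hamil (dv f) (dv g) l p (ceil R.S τ) * ω (R.delay (ceil R.S τ)) +
        R.hamil (dz f) (dz g) l p (ceil R.S τ) * z +
        R.hamil (ds f) (ds g) l p (ceil R.S τ) * s)) := by
    have i1 := ii hprod
    have i2 := (ii hincr_f).const_mul l
    have i3 := ii (hv.mul (ldContinuous_comp_delay hω))
    have i4 := (ii hz).mul_const z
    have i5 := (ii hs).mul_const s
    rw [integral_sub (i1.add i2) ((i3.add i4).add i5), integral_add i1 i2,
      integral_add (i3.add i4) i5, integral_add i3 i4, hparts,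
      intervalIntegral.integral_const_mul, intervalIntegral.integral_mul_const,
      intervalIntegral.integral_mul_const]
    rfl
  rw [hrem, ← Real.norm_eq_abs]
  have hbound : ∀ τ ∈ uIoc R.a R.b,
      ‖(p (ceil R.S τ) * R.incr g (ceil R.S τ) (q (ceil R.S τ)) +
        -R.hamil (dx f) (dx g) l p (ceil R.S τ) * ξ (rho R.S (ceil R.S τ))) +
        l * R.incr f (ceil R.S τ) (q (ceil R.S τ)) -
        (R.hamil (dv f) (dv g) l p (ceil R.S τ) * ω (R.delay (ceil R.S τ)) +
        R.hamil (dz f) (dz g) l p (ceil R.S τ) * z +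
        R.hamil (ds f) (ds g) l p (ceil R.S τ) * s)‖ ≤
      (P + |l|) * (ε * ((C + 1) * N)) := by
    intro τ hτ
    rw [uIoc_of_le R.a_lt.le] at hτ
    have hm := R.spans.ceil_mem hτ.2
    have hmax := max_eq_of_mem_Ioc hτ
    have hlt : R.a < ceil R.S τ := hτ.1.trans_le (R.spans.le_ceil hτ.2)
    set t := ceil R.S τ
    have e1 := h₁ t hm (q t) ((hqδ t hm).trans_le (min_le_left _ _))
    have e2 := h₂ t hm (q t) ((hqδ t hm).trans_le (min_le_right _ _))
    have hdelay : rho R.S t = R.delay t := (back_of_lt R.a_mem hlt).symm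
    have hgrad : ∀ Φ, gradient Φ (max t R.a)
        (path R.S R.a R.x R.u (R.x R.a) (R.x R.b) t) (q t) =
        R.along (dx Φ) t * ξ (R.delay t) + R.along (dv Φ) t * ω (R.delay t) +
        R.along (dz Φ) t * z + R.along (ds Φ) t * s := fun Φ => linForm_apply _ _ _ _ _
    rw [hgrad] at e1 e2
    change |R.incr f t (q t) - _| ≤ _ at e1
    change |R.incr g t (q t) - _| ≤ _ at e2
    rw [hdelay]
    have hN' : ε * ‖q t‖ ≤ ε * ((C + 1) * N) := by gcongr; exact hqN t hm
    have hpt : |p t| ≤ P := hPb t hm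
    rw [Real.norm_eq_abs]
    unfold hamil
    rw [hmax]
    calc _ = |p t * (R.incr g t (q t) - (R.along (dx g) t * ξ (R.delay t) +
            R.along (dv g) t * ω (R.delay t) + R.along (dz g) t * z + R.along (ds g) t * s)) +
          l * (R.incr f t (q t) - (R.along (dx f) t * ξ (R.delay t) +
            R.along (dv f) t * ω (R.delay t) + R.along (dz f) t * z + R.along (ds f) t * s))| := by
          congr 1; ring
      _ ≤ P * (ε * ((C + 1) * N)) + |l| * (ε * ((C + 1) * N)) := by
          refine (abs_add_le _ _).trans ?_
          rw [abs_mul, abs_mul]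
          gcongr
          · exact e2.trans hN'
          · exact e1.trans hN'
      _ = _ := by ring
  refine (norm_integral_le_of_norm_le_const hbound).trans ?_
  rw [abs_of_pos hba]
  calc (P + |l|) * (ε * ((C + 1) * N)) * (R.b - R.a)
      ≤ (P + |l| + 1) * (ε * ((C + 1) * N)) * (R.b - R.a) := by
        refine mul_le_mul_of_nonneg_right ?_ hba.le
        exact mul_le_mul_of_nonneg_right (by linarith) (by positivity)
    _ = ε * ((P + |l| + 1) * (C + 1) * (R.b - R.a)) * N := by ring
    _ = κ * N := by
        rw [hε, div_mul_cancel₀]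
        positivity

end Trajectory

end TimeScale

namespace TimeScale

/-! ### Constrained extrema in two parameters -/

/-- A multiplier rule for two real parameters. The constraint `C = 0` is solved for `σ` near the
origin by the intermediate value theorem; differentiability at the origin alone is enough. -/
theorem mul_eq_mul_of_constrained_min {C J : ℝ → ℝ → ℝ} {r c₁ c₂ j₁ j₂ : ℝ} (hr : 0 < r)
    (hcont : ∀ ε, |ε| ≤ r → ContinuousOn (fun σ => C σ ε) (Icc (-r) r))
    (hC : ∀ κ > 0, ∃ δ > 0, ∀ σ ε, |σ| + |ε| < δ →
      |C σ ε - (c₁ * σ + c₂ * ε)| ≤ κ * (|σ| + |ε|))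
    (hJ : ∀ κ > 0, ∃ δ > 0, ∀ σ ε, |σ| + |ε| < δ →
      |J σ ε - (j₁ * σ + j₂ * ε)| ≤ κ * (|σ| + |ε|))
    (hmin : ∃ δ > 0, ∀ σ ε, |σ| + |ε| < δ → C σ ε = 0 → 0 ≤ J σ ε) (hc : c₁ ≠ 0) :
    j₂ * c₁ = j₁ * c₂ := by
  -- the slope of the level set `C = 0`
  set m := -c₂ / c₁ with hm
  have hcm : c₁ * m + c₂ = 0 := by rw [hm]; field_simp; ring
  suffices h0 : j₁ * m + j₂ = 0 by
    have : j₂ * c₁ - j₁ * c₂ = c₁ * (j₁ * m + j₂) - j₁ * (c₁ * m + c₂) := by ring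
    rw [h0, hcm] at this
    linarith
  set K := |m| + 2 with hK
  have hK0 : 0 < K := by positivity
  obtain ⟨δm, hδm, hmin⟩ := hmin
  have hc0 : 0 < |c₁| := abs_pos.2 hc
  have key : ∀ κ, 0 < κ → κ ≤ 1 → |j₁ * m + j₂| ≤ κ * (|j₁| + K) := by
    intro κ hκ hκ1
    obtain ⟨δC, hδC, hC⟩ := hC (|c₁| * κ / (2 * K)) (by positivity)
    obtain ⟨δJ, hδJ, hJ⟩ := hJ κ hκ
    set η := min (min δC δJ) (min δm r) / (2 * K) with hη
    have hη0 : 0 < η := by positivity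
    have hmain : ∀ ε, |ε| = η → 0 ≤ (j₁ * m + j₂) * ε + κ * (|j₁| + K) * η := by
      intro ε hε
      have hsize : ∀ σ, |σ - m * ε| ≤ κ * η → |σ| + |ε| ≤ K * η := by
        intro σ hσ
        have h1 : |σ| ≤ |σ - m * ε| + |m * ε| := by
          simpa using abs_add_le (σ - m * ε) (m * ε)
        rw [abs_mul, hε] at h1
        have h2 : κ * η ≤ η := mul_le_of_le_one_left hη0.le hκ1
        have h3 : K * η = |m| * η + 2 * η := by rw [hK]; ring
        linarith
      have hKη : K * η < min (min δC δJ) (min δm r) := by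
        have : K * η = min (min δC δJ) (min δm r) / 2 := by rw [hη]; field_simp
        rw [this]
        exact half_lt_self (by positivity)
      have hKC : K * η < δC := hKη.trans_le ((min_le_left _ _).trans (min_le_left _ _))
      have hKJ : K * η < δJ := hKη.trans_le ((min_le_left _ _).trans (min_le_right _ _))
      have hKm : K * η < δm := hKη.trans_le ((min_le_right _ _).trans (min_le_left _ _))
      have hKr : K * η < r := hKη.trans_le ((min_le_right _ _).trans (min_le_right _ _))
      have hval : ∀ θ, |θ| = κ → |C ((m + θ) * ε) ε - c₁ * ε * θ| ≤ |c₁| * κ / 2 * η := by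
        intro θ hθ
        have h1 : |(m + θ) * ε - m * ε| ≤ κ * η := by
          rw [← sub_mul, add_sub_cancel_left, abs_mul, hθ, hε]
        have h2 := hC _ ε ((hsize _ h1).trans_lt hKC)
        have h3 : c₁ * ((m + θ) * ε) + c₂ * ε = c₁ * ε * θ := by
          linear_combination ε * hcm
        rw [h3] at h2
        refine h2.trans ?_
        calc |c₁| * κ / (2 * K) * (|(m + θ) * ε| + |ε|) ≤ |c₁| * κ / (2 * K) * (K * η) := by
              gcongr
              exact hsize _ h1
          _ = _ := by field_simp
      have hplus := hval κ (abs_of_pos hκ)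
      have hminus := hval (-κ) (by rw [abs_neg, abs_of_pos hκ])
      have hprod : |c₁ * ε * κ| = |c₁| * κ * η := by
        rw [abs_mul, abs_mul, hε, abs_of_pos hκ]; ring
      have hpos : 0 < |c₁| * κ * η := by positivity
      have hzero : (0 : ℝ) ∈ uIcc (C ((m + -κ) * ε) ε) (C ((m + κ) * ε) ε) := by
        rw [mem_uIcc]
        rw [abs_le] at hplus hminus
        rcases abs_cases (c₁ * ε * κ) with ⟨h1, -⟩ | ⟨h1, -⟩
        · left; constructor <;> linarith [hplus.1, hminus.2]
        · right; constructor <;> linarith [hplus.2, hminus.1]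
      have hclose : ∀ σ ∈ uIcc ((m + -κ) * ε) ((m + κ) * ε), |σ - m * ε| ≤ κ * η := by
        intro σ hσ
        rw [add_mul, add_mul, neg_mul] at hσ
        have hκη : κ * η = |κ * ε| := by rw [abs_mul, abs_of_pos hκ, hε]
        rw [hκη, abs_le]
        have h1 := le_abs_self (κ * ε)
        have h2 := neg_abs_le (κ * ε)
        rcases mem_uIcc.1 hσ with h | h <;> constructor <;> linarith [h.1, h.2]
      have hsub : uIcc ((m + -κ) * ε) ((m + κ) * ε) ⊆ Icc (-r) r := fun σ hσ => by
        rw [mem_Icc, ← abs_le]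
        linarith [hsize σ (hclose σ hσ), abs_nonneg ε]
      have hεr : |ε| ≤ r := by
        have := hsize (m * ε) (by simpa using (mul_pos hκ hη0).le)
        linarith [abs_nonneg (m * ε)]
      obtain ⟨σ, hσ, hσ0⟩ := intermediate_value_uIcc ((hcont ε hεr).mono hsub) hzero
      have h1 := hsize σ (hclose σ hσ)
      have h2 := hmin σ ε (h1.trans_lt hKm) hσ0
      have h3 := (abs_le.1 (hJ σ ε (h1.trans_lt hKJ))).2
      have h4 : j₁ * (σ - m * ε) ≤ |j₁| * (κ * η) := by
        refine (le_abs_self _).trans ?_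
        rw [abs_mul]
        gcongr
        exact hclose σ hσ
      have h5 : κ * (|σ| + |ε|) ≤ κ * (K * η) := by gcongr
      have h6 : (j₁ * m + j₂) * ε = j₁ * σ + j₂ * ε - j₁ * (σ - m * ε) := by ring
      have h7 : κ * (|j₁| + K) * η = |j₁| * (κ * η) + κ * (K * η) := by ring
      rw [h6, h7]
      linarith
    have h1 := hmain η (abs_of_pos hη0)
    have h2 := hmain (-η) (by rw [abs_neg, abs_of_pos hη0])
    have h3 : 0 ≤ (j₁ * m + j₂ + κ * (|j₁| + K)) * η := by linarith
    have h4 : 0 ≤ (κ * (|j₁| + K) - (j₁ * m + j₂)) * η := by linarith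
    have h5 := nonneg_of_mul_nonneg_left h3 hη0
    have h6 := nonneg_of_mul_nonneg_left h4 hη0
    exact abs_le.2 ⟨by linarith, by linarith⟩
  by_contra hne
  have hpos : 0 < |j₁ * m + j₂| := abs_pos.2 hne
  have hD : 0 < |j₁| + K := by positivity
  have h1 := key (min 1 (|j₁ * m + j₂| / (2 * (|j₁| + K)))) (by positivity) (min_le_left _ _)
  have h2 : min 1 (|j₁ * m + j₂| / (2 * (|j₁| + K))) * (|j₁| + K) ≤ |j₁ * m + j₂| / 2 := by
    calc _ ≤ |j₁ * m + j₂| / (2 * (|j₁| + K)) * (|j₁| + K) := by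
          gcongr
          exact min_le_right _ _
      _ = _ := by field_simp
  linarith

/-! ### The fundamental lemma of the calculus of variations -/

open MeasureTheory intervalIntegral

namespace Trajectory

variable {R : Trajectory} {h : ℝ → ℝ}

/-- The quotients `n ∫_s^{s + 1/n} h` are continuous in `s`, and at `s = τ^ρ` they converge to the
value of `h` at the next point of `τ`, for all but countably many `τ`. Hence `h` itself may be used
as a variation of `u^ρ`, although there need not be an ld-continuous `ω` with `ω^ρ = h`. -/
theorem ae_eq_zero_of_integral_mul_eq_zero (hh : LdContinuous R.S h)
    (H : ∀ ω, LdContinuous R.S ω →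
      ∫ τ in R.a..R.b, h (ceil R.S τ) * ω (R.delay (ceil R.S τ)) = 0) :
    ∀ᵐ τ ∂volume.restrict (Ioc R.a R.b), h (ceil R.S τ) = 0 := by
  obtain ⟨B, hB, hhB⟩ := hh.exists_bound R.spans.isCompact
  have hA := R.spans.subset R.spans.left_mem
  have hb := R.spans.subset R.spans.right_mem
  set k : ℝ → ℝ := (Ioc R.A R.b).indicator fun τ => h (ceil R.S τ) with hk
  have hkint : Integrable k := by
    rw [hk, integrable_indicator_iff measurableSet_Ioc]
    have := hh.intervalIntegrable R.spans hA hb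
    rwa [intervalIntegrable_iff, uIoc_of_le R.spans.lt.le] at this
  have hkB : ∀ τ, |k τ| ≤ B := by
    intro τ
    by_cases hτ : τ ∈ Ioc R.A R.b
    · rw [hk, indicator_of_mem hτ]
      exact hhB _ (R.spans.ceil_mem hτ.2)
    · rw [hk, indicator_of_notMem hτ, abs_zero]
      exact hB
  set F : ℝ → ℝ := fun t => ∫ τ in R.a..t, k τ with hF
  have hii : ∀ c d, IntervalIntegrable k volume c d := fun c d => hkint.intervalIntegrable
  have hFc : Continuous F := continuous_primitive hii R.a
  have hFlip : ∀ s t, |F t - F s| ≤ B * |t - s| := by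
    intro s t
    rw [hF]
    simp only
    rw [integral_interval_sub_left (hii _ _) (hii _ _), ← Real.norm_eq_abs]
    exact norm_integral_le_of_norm_le_const fun τ _ => hkB τ
  let ω : ℕ → ℝ → ℝ := fun n s => (1 / ((n : ℝ) + 1))⁻¹ * (F (s + 1 / ((n : ℝ) + 1)) - F s)
  have hωc : ∀ n, Continuous (ω n) := fun n =>
    continuous_const.mul ((hFc.comp (continuous_id.add continuous_const)).sub hFc)
  have hωB : ∀ n s, |ω n s| ≤ B := by
    intro n s
    have hn : 0 < 1 / ((n : ℝ) + 1) := by positivity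
    simp only [ω]
    rw [abs_mul, abs_of_pos (inv_pos.2 hn), inv_mul_le_iff₀ hn, mul_comm]
    have := hFlip s (s + 1 / ((n : ℝ) + 1))
    rwa [add_sub_cancel_left, abs_of_pos hn] at this
  have hωlim : ∀ τ ∈ Ioo R.a R.b, τ ∉ scattered R.S →
      Tendsto (fun n => ω n (R.delay (ceil R.S τ))) atTop (𝓝 (h (ceil R.S τ))) := by
    intro τ hτ hsc
    have hAτ : R.A < τ := R.a_mem_Icc.1.trans_lt hτ.1
    have hm := R.spans.ceil_mem hτ.2.le
    have hd := delay_ceil_mem (R := R) ⟨hτ.1, hτ.2.le⟩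
    have hdelay : R.delay (ceil R.S τ) = rho R.S (ceil R.S τ) :=
      back_of_lt R.a_mem (hτ.1.trans_le (R.spans.le_ceil hτ.2.le))
    have hAd : R.A ≤ R.delay (ceil R.S τ) := R.a_mem_Icc.1.trans hd.1
    have hlim : Tendsto k (𝓝[>] (R.delay (ceil R.S τ))) (𝓝 (h (ceil R.S τ))) := by
      by_cases hτS : τ ∈ R.S
      · have h1 : R.delay (ceil R.S τ) = τ := by
          rw [hdelay, ceil_of_mem hτS]
          exact (dense_of_notMem_scattered hτS hsc).1
        have h2 := hh.continuousAt_comp_ceil R.spans ⟨hAτ, hτ.2⟩ hsc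
        rw [h1]
        refine (h2.tendsto.mono_left nhdsWithin_le_nhds).congr' ?_
        filter_upwards [mem_nhdsWithin_of_mem_nhds (Ioo_mem_nhds hAτ hτ.2)] with τ' hτ'
        rw [hk, indicator_of_mem (s := Ioc R.A R.b) ⟨hτ'.1, hτ'.2.le⟩]
      · refine tendsto_const_nhds.congr' ?_
        have hlt : R.delay (ceil R.S τ) < ceil R.S τ :=
          hd.2.trans_lt (lt_of_le_of_ne (R.spans.le_ceil hτ.2.le) fun he => hτS (he ▸ hm))
        filter_upwards [Ioo_mem_nhdsGT hlt] with τ' hτ'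
        rw [hk, indicator_of_mem (s := Ioc R.A R.b)
          ⟨hAd.trans_lt hτ'.1, hτ'.2.le.trans (R.spans.subset hm).2⟩,
          ceil_of_gap hm (hdelay ▸ hτ'.1) hτ'.2.le]
    have hderiv : HasDerivWithinAt F (h (ceil R.S τ)) (Ici (R.delay (ceil R.S τ)))
        (R.delay (ceil R.S τ)) :=
      integral_hasDerivWithinAt_of_tendsto_ae_right (hii _ _)
        (hkint.aestronglyMeasurable.stronglyMeasurableAtFilter) (hlim.mono_left inf_le_left)
    have hslope := (hasDerivWithinAt_iff_tendsto_slope' self_notMem_Ioi).1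
      (hderiv.mono Ioi_subset_Ici_self)
    have hseq : Tendsto (fun n : ℕ => R.delay (ceil R.S τ) + 1 / ((n : ℝ) + 1)) atTop
        (𝓝[>] (R.delay (ceil R.S τ))) := by
      refine tendsto_nhdsWithin_iff.2 ⟨?_, Eventually.of_forall fun n => ?_⟩
      · simpa using (tendsto_const_nhds (x := R.delay (ceil R.S τ))).add
          (tendsto_one_div_add_atTop_nhds_zero_nat (𝕜 := ℝ))
      · exact lt_add_of_pos_right (R.delay (ceil R.S τ)) (by positivity)
    refine (hslope.comp hseq).congr fun n => ?_
    simp only [Function.comp_apply, slope_def_field, add_sub_cancel_left, ω]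
    rw [div_eq_inv_mul]
  have hae : ∀ᵐ τ, τ ∈ uIoc R.a R.b → τ ∈ Ioo R.a R.b ∧ τ ∉ scattered R.S := by
    have h1 : ∀ᵐ τ, τ ∉ scattered R.S := (countable_scattered R.S).ae_notMem volume
    have h2 : ∀ᵐ τ : ℝ, τ ≠ R.b := Measure.ae_ne volume R.b
    filter_upwards [h1, h2] with τ h1 h2 hτ
    rw [uIoc_of_le R.a_lt.le] at hτ
    exact ⟨⟨hτ.1, lt_of_le_of_ne hτ.2 h2⟩, h1⟩
  have hDCT : Tendsto
      (fun n => ∫ τ in R.a..R.b, h (ceil R.S τ) * ω n (R.delay (ceil R.S τ))) atTop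
      (𝓝 (∫ τ in R.a..R.b, h (ceil R.S τ) * h (ceil R.S τ))) := by
    refine tendsto_integral_filter_of_dominated_convergence (fun _ => B * B)
      (Eventually.of_forall fun n => ?_) (Eventually.of_forall fun n => ?_)
      intervalIntegrable_const ?_
    · have hld := hh.mul (ldContinuous_comp_delay (hωc n).continuousOn.ldContinuous)
      have := (hld.intervalIntegrable R.spans R.a_mem_Icc hb)
      exact (intervalIntegrable_iff.1 this).aestronglyMeasurable
    · filter_upwards [hae] with τ hτ hτ'
      have := hhB _ (R.spans.ceil_mem (hτ hτ').1.2.le)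
      rw [Real.norm_eq_abs, abs_mul]
      exact mul_le_mul this (hωB _ _) (abs_nonneg _) hB
    · filter_upwards [hae] with τ hτ hτ'
      exact (hωlim τ (hτ hτ').1 (hτ hτ').2).const_mul _
  have hsq : ∫ τ in R.a..R.b, h (ceil R.S τ) * h (ceil R.S τ) = 0 := by
    refine tendsto_nhds_unique hDCT ?_
    simp only [H _ (hωc _).continuousOn.ldContinuous]
    exact tendsto_const_nhds
  have hzero := (integral_eq_zero_iff_of_le_of_nonneg_ae R.a_lt.le
    (Eventually.of_forall fun τ => mul_self_nonneg (h (ceil R.S τ)))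
    ((hh.mul hh).intervalIntegrable R.spans R.a_mem_Icc hb)).1 hsq
  filter_upwards [hzero] with τ hτ
  exact mul_self_eq_zero.1 hτ

/-- The values of `h` that enter the integral from `a` to `b` vanish, not only almost all of them:
each of them is attained, or approximated, on a set of positive measure. -/
theorem eq_zero_of_integral_mul_eq_zero (hh : LdContinuous R.S h)
    (H : ∀ ω, LdContinuous R.S ω →
      ∫ τ in R.a..R.b, h (ceil R.S τ) * ω (R.delay (ceil R.S τ)) = 0)
    {t : ℝ} (ht : t ∈ R.S) (hρ : R.a ≤ rho R.S t) (hta : t = R.a → sigma R.S t = t) :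
    h t = 0 := by
  have hzero := ae_eq_zero_of_integral_mul_eq_zero hh H
  by_contra hne
  obtain ⟨s₀, s₁, h01, ha, hs₁, hs⟩ : ∃ s₀ s₁, s₀ < s₁ ∧ R.a ≤ s₀ ∧ s₁ ∈ R.S ∧
      ∀ s ∈ R.S, s₀ < s → s ≤ s₁ → h s ≠ 0 := by
    rcases (rho_le R.S t).lt_or_eq with hlt | heq
    · refine ⟨rho R.S t, t, hlt, hρ, ht, fun s hs h1 h2 => ?_⟩
      rcases h2.eq_or_lt with rfl | h2
      · exact hne
      · exact absurd (le_rho hs h2) (not_le.2 h1)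
    · have hev : ∀ᶠ s in 𝓝[R.S] t, h s ≠ 0 :=
        ((hh t ht).1 heq).tendsto.eventually_ne hne
      obtain ⟨δ, hδ, hev⟩ := Metric.mem_nhdsWithin_iff.1 hev
      have hat : R.a ≤ t := hρ.trans (rho_le _ _)
      rcases hat.eq_or_lt with rfl | hat
      · obtain ⟨s, hs, h1, h2⟩ := exists_mem_Ioo_of_sigma_eq R.spans.right_mem R.a_lt (hta rfl)
          (show R.a < R.a + δ by linarith)
        refine ⟨R.a, s, h1, le_rfl, hs, fun r hr h3 h4 => hev ⟨?_, hr⟩⟩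
        rw [Metric.mem_ball, Real.dist_eq, abs_lt]
        constructor <;> linarith
      · obtain ⟨s, hs, h1, h2⟩ := exists_mem_Ioo_of_rho_eq R.a_mem hat heq
          (show max R.a (t - δ) < t from max_lt hat (by linarith))
        refine ⟨s, t, h2, (le_max_left _ _).trans h1.le, ht, fun r hr h3 h4 => hev ⟨?_, hr⟩⟩
        have := (le_max_right R.a (t - δ)).trans_lt h1
        rw [Metric.mem_ball, Real.dist_eq, abs_lt]
        constructor <;> linarith
  have hsub : Ioo s₀ s₁ ⊆ Ioc R.a R.b := fun τ hτ =>
    ⟨ha.trans_lt hτ.1, hτ.2.le.trans (R.spans.subset hs₁).2⟩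
  have h1 : ∀ᵐ τ ∂volume.restrict (Ioo s₀ s₁), h (ceil R.S τ) = 0 :=
    ae_restrict_of_ae_restrict_of_subset hsub hzero
  have h2 : ∀ᵐ τ ∂volume.restrict (Ioo s₀ s₁), False := by
    filter_upwards [h1, ae_restrict_mem measurableSet_Ioo] with τ h3 hτ
    have hτb := (hsub hτ).2
    exact hs _ (R.spans.ceil_mem hτb) (hτ.1.trans_le (R.spans.le_ceil hτb))
      (ceil_le hs₁ hτ.2.le) h3
  have h3 : volume (Ioo s₀ s₁) = 0 := by
    rw [← Measure.restrict_eq_zero, ← ae_eq_bot]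
    exact eventually_false_iff_eq_bot.1 h2
  rw [Real.volume_Ioo, ENNReal.ofReal_eq_zero] at h3
  linarith

end Trajectory

end TimeScale

namespace TimeScale

open MeasureTheory intervalIntegral

namespace Trajectory

/-! ### The multiplier rule along two variations -/

variable {R : Trajectory} {f g F G : ℝ → ℝ → ℝ → ℝ → ℝ → ℝ} {ω ω₁ ω₂ ξ p p₀ p₁ : ℝ → ℝ}
  {z s z₁ z₂ s₁ s₂ l c N : ℝ}

/-- The change of the cost, to be compared with `firstVar`. -/
noncomputable def costIncr (R : Trajectory) (f : ℝ → ℝ → ℝ → ℝ → ℝ → ℝ) (ω : ℝ → ℝ) (z s : ℝ)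
    (ξ : ℝ → ℝ) : ℝ :=
  ∫ τ in R.a..R.b, R.incr f (ceil R.S τ) (R.pert ξ ω z s (ceil R.S τ))

/-- The first variation of `l ∫ f + p(b) (x(b) - s)`, where `s` is the final state in the arguments
of `f` and `g`: for `l = 0` the linearized constraint, for `l = 1` the Lagrangian. -/
noncomputable def lagrangeVar (R : Trajectory) (f g : ℝ → ℝ → ℝ → ℝ → ℝ → ℝ) (l : ℝ) (p : ℝ → ℝ)
    (ω : ℝ → ℝ) (z s : ℝ) : ℝ :=
  p R.a * z + R.firstVar f g l p ω z s - p R.b * s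

theorem lagrangeVar_linear (hf : IsRegular R.S f) (hg : IsRegular R.S g)
    (hp : ContinuousOn p R.S) (h₁ : LdContinuous R.S ω₁) (h₂ : LdContinuous R.S ω₂) (σ ε : ℝ) :
    R.lagrangeVar f g l p (fun t => σ * ω₁ t + ε * ω₂ t) (σ * z₁ + ε * z₂) (σ * s₁ + ε * s₂) =
      σ * R.lagrangeVar f g l p ω₁ z₁ s₁ + ε * R.lagrangeVar f g l p ω₂ z₂ s₂ := by
  unfold lagrangeVar
  rw [firstVar_linear hf hg hp h₁ h₂]
  ring

theorem lagrangeVar_add_const_mul (hf : IsRegular R.S f) (hg : IsRegular R.S g)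
    (hp₁ : ContinuousOn p₁ R.S) (hp₀ : ContinuousOn p₀ R.S) (hω : LdContinuous R.S ω) (c : ℝ) :
    R.lagrangeVar f g 1 (fun t => p₁ t + c * p₀ t) ω z s =
      R.lagrangeVar f g 1 p₁ ω z s + c * R.lagrangeVar f g 0 p₀ ω z s := by
  unfold lagrangeVar
  rw [firstVar_add_const_mul hf hg hp₁ hp₀ hω]
  ring

/-- `δ` bounds a response, its nabla derivative, and the change of the control. -/
structure Small (R : Trajectory) (g : ℝ → ℝ → ℝ → ℝ → ℝ → ℝ) (ω : ℝ → ℝ) (z s : ℝ) (ξ : ℝ → ℝ)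
    (δ : ℝ) : Prop where
  state : ∀ t ∈ R.S, |ξ t| ≤ δ
  deriv : ∀ t ∈ R.S, |R.incr g t (R.pert ξ ω z s t)| ≤ δ
  control : ∀ t ∈ R.S, |ω t| ≤ δ

/-- A response of order `N` on `[a, b]` is of order `N` on the whole time scale, together with its
nabla derivative. -/
theorem IsResponse.small {r C : ℝ} (hC : 0 ≤ C)
    (hincr : ∀ t ∈ R.S, ∀ q, ‖q‖ ≤ max (C * r) r → |R.incr g t q| ≤ C * ‖q‖)
    (hN : R.PertLe ω z s N) (hNr : N ≤ r) (hξ : R.IsResponse g ω z s ξ)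
    (hξN : ∀ t ∈ Icc R.a R.b, |ξ t| ≤ C * N) :
    R.Small g ω z s ξ ((1 + C * (C + 1) * (1 + (R.b - R.A))) * N) := by
  have hN0 : 0 ≤ N := (abs_nonneg _).trans hN.left
  have hAb : 0 ≤ R.b - R.A := sub_nonneg.2 R.spans.lt.le
  have hq : ∀ t ∈ R.S, |R.incr g t (R.pert ξ ω z s t)| ≤ C * ((C + 1) * N) := by
    intro t ht
    have h1 : ‖R.pert ξ ω z s t‖ ≤ max (C * N) N := norm_pert_le ht hN (hξN _ (delay_mem_Icc ht))
    have h2 : max (C * N) N ≤ max (C * r) r := by gcongr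
    refine (hincr t ht _ (h1.trans h2)).trans ?_
    gcongr
    exact h1.trans (max_le (by nlinarith) (by nlinarith))
  have hD : 0 ≤ C * ((C + 1) * N) := by positivity
  have hexp : (1 + C * (C + 1) * (1 + (R.b - R.A))) * N =
      N + C * ((C + 1) * N) + C * ((C + 1) * N) * (R.b - R.A) := by ring
  have hE : 0 ≤ C * ((C + 1) * N) * (R.b - R.A) := mul_nonneg hD hAb
  refine ⟨fun t ht => ?_, fun t ht => ?_, fun t ht => ?_⟩
  · have ht' := R.spans.subset ht
    rw [hξ.eq t ht', hexp]
    have h1 : |∫ τ in R.a..t, R.incr g (ceil R.S τ) (R.pert ξ ω z s (ceil R.S τ))| ≤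
        C * ((C + 1) * N) * |t - R.a| := by
      rw [← Real.norm_eq_abs]
      refine norm_integral_le_of_norm_le_const fun τ hτ => ?_
      exact hq _ (R.spans.ceil_mem (hτ.2.trans (max_le R.a_lt.le ht'.2)))
    have h2 : |t - R.a| ≤ R.b - R.A := by
      have := R.a_mem_Icc
      rw [abs_le]
      constructor <;> linarith [ht'.1, ht'.2, this.1, this.2]
    have h3 : C * ((C + 1) * N) * |t - R.a| ≤ C * ((C + 1) * N) * (R.b - R.A) := by gcongr
    exact (abs_add_le _ _).trans (by linarith [hN.left])
  · rw [hexp]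
    linarith [hq t ht]
  · rw [hexp]
    linarith [hN.control t ht]

/-- If the cost does not decrease (`θ = 1`) or does not increase (`θ = -1`) along all small
perturbations that satisfy the constraint `ξ(b) = s`, then the first variations of cost and
constraint are proportional on the span of two perturbations. -/
theorem lagrangeVar_mul_eq (hf : IsRegular R.S f) (hg : IsRegular R.S g)
    (hp₀ : R.IsCostate f g 0 p₀) (hp₀b : p₀ R.b = 1) (hp₁ : R.IsCostate f g 1 p₁)
    (hp₁b : p₁ R.b = 0) (h₁ : LdContinuous R.S ω₁) (h₂ : LdContinuous R.S ω₂) {θ : ℝ}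
    (hθ : |θ| = 1)
    (hmin : ∃ δ > 0, ∀ σ ε ξ,
      R.IsResponse g (fun t => σ * ω₁ t + ε * ω₂ t) (σ * z₁ + ε * z₂) (σ * s₁ + ε * s₂) ξ →
      R.Small g (fun t => σ * ω₁ t + ε * ω₂ t) (σ * z₁ + ε * z₂) (σ * s₁ + ε * s₂) ξ δ →
      ξ R.b = σ * s₁ + ε * s₂ →
      0 ≤ θ * R.costIncr f (fun t => σ * ω₁ t + ε * ω₂ t) (σ * z₁ + ε * z₂) (σ * s₁ + ε * s₂) ξ)
    (hne : R.lagrangeVar f g 0 p₀ ω₁ z₁ s₁ ≠ 0) :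
    R.lagrangeVar f g 1 p₁ ω₂ z₂ s₂ * R.lagrangeVar f g 0 p₀ ω₁ z₁ s₁ =
      R.lagrangeVar f g 1 p₁ ω₁ z₁ s₁ * R.lagrangeVar f g 0 p₀ ω₂ z₂ s₂ := by
  obtain ⟨r, hr, C, hC, hex, hlip, hincr⟩ := exists_response (R := R) hg
  obtain ⟨B₁, hB₁, hωB₁⟩ := h₁.exists_bound R.spans.isCompact
  obtain ⟨B₂, hB₂, hωB₂⟩ := h₂.exists_bound R.spans.isCompact
  -- a common bound for the two directions
  set M := B₁ + B₂ + |z₁| + |z₂| + |s₁| + |s₂| + 1 with hM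
  have hM0 : 0 < M := by positivity
  set W : ℝ → ℝ → ℝ → ℝ := fun σ ε t => σ * ω₁ t + ε * ω₂ t with hW
  set Z : ℝ → ℝ → ℝ := fun σ ε => σ * z₁ + ε * z₂ with hZ
  set E : ℝ → ℝ → ℝ := fun σ ε => σ * s₁ + ε * s₂ with hE
  have hcomb : ∀ σ ε v w : ℝ, |v| ≤ M → |w| ≤ M → |σ * v + ε * w| ≤ M * (|σ| + |ε|) := by
    intro σ ε v w hv hw
    refine (abs_add_le _ _).trans ?_
    rw [abs_mul, abs_mul, mul_add, mul_comm M, mul_comm M]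
    gcongr
  have hωM₁ : ∀ t ∈ R.S, |ω₁ t| ≤ M := fun t ht => (hωB₁ t ht).trans (by
    rw [hM]; linarith [abs_nonneg z₁, abs_nonneg z₂, abs_nonneg s₁, abs_nonneg s₂])
  have hωM₂ : ∀ t ∈ R.S, |ω₂ t| ≤ M := fun t ht => (hωB₂ t ht).trans (by
    rw [hM]; linarith [abs_nonneg z₁, abs_nonneg z₂, abs_nonneg s₁, abs_nonneg s₂])
  have hle : ∀ σ ε, R.PertLe (W σ ε) (Z σ ε) (E σ ε) (M * (|σ| + |ε|)) := by
    intro σ ε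
    refine ⟨fun t ht => hcomb _ _ _ _ (hωM₁ t ht) (hωM₂ t ht), hcomb _ _ _ _ ?_ ?_,
      hcomb _ _ _ _ ?_ ?_⟩ <;> rw [hM] <;>
    linarith [abs_nonneg z₁, abs_nonneg z₂, abs_nonneg s₁, abs_nonneg s₂]
  have hWld : ∀ σ ε, LdContinuous R.S (W σ ε) := fun σ ε => (h₁.const_mul σ).add (h₂.const_mul ε)
  have hexΞ : ∀ σ ε, ∃ ξ, M * (|σ| + |ε|) ≤ r → R.IsResponse g (W σ ε) (Z σ ε) (E σ ε) ξ ∧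
      ∀ t ∈ Icc R.a R.b, |ξ t| ≤ C * (M * (|σ| + |ε|)) := by
    intro σ ε
    by_cases hN : M * (|σ| + |ε|) ≤ r
    · obtain ⟨ξ, hξ⟩ := hex _ _ _ _ (hWld σ ε) (hle σ ε) hN
      exact ⟨ξ, fun _ => hξ⟩
    · exact ⟨0, fun h => absurd h hN⟩
  choose Ξ hΞ using hexΞ
  have hbIcc : R.b ∈ Icc R.a R.b := ⟨R.a_lt.le, le_rfl⟩
  have hexpand : ∀ {l p}, R.IsCostate f g l p → ∀ κ > 0, ∃ δ > 0, ∀ σ ε, |σ| + |ε| < δ →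
      |p R.b * (Ξ σ ε R.b - E σ ε) + l * R.costIncr f (W σ ε) (Z σ ε) (E σ ε) (Ξ σ ε) -
        (R.lagrangeVar f g l p ω₁ z₁ s₁ * σ + R.lagrangeVar f g l p ω₂ z₂ s₂ * ε)| ≤
        κ * (|σ| + |ε|) := by
    intro l p hp κ hκ
    obtain ⟨δ, hδ, h⟩ := exists_expansion hf hg hp hC (κ := κ / M) (by positivity)
    refine ⟨min (r / M) (δ / M), by positivity, fun σ ε hσ => ?_⟩
    have k1 : M * (|σ| + |ε|) < r := by
      have := hσ.trans_le (min_le_left _ _)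
      rwa [lt_div_iff₀ hM0, mul_comm] at this
    have k2 : M * (|σ| + |ε|) < δ := by
      have := hσ.trans_le (min_le_right _ _)
      rwa [lt_div_iff₀ hM0, mul_comm] at this
    obtain ⟨m1, m2⟩ := hΞ σ ε k1.le
    have h3 := h _ _ _ _ _ (hle σ ε) m1 m2 k2
    have h4 := lagrangeVar_linear (z₁ := z₁) (z₂ := z₂) (s₁ := s₁) (s₂ := s₂) (l := l) hf hg
      hp.continuousOn h₁ h₂ σ ε
    have h5 : κ / M * (M * (|σ| + |ε|)) = κ * (|σ| + |ε|) := by field_simp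
    rw [h5] at h3
    refine le_trans (le_of_eq ?_) h3
    congr 1
    rw [mul_comm _ σ, mul_comm _ ε, ← h4]
    unfold lagrangeVar costIncr
    ring
  set r' := r / (2 * M) with hr'
  have hr'0 : 0 < r' := by positivity
  have hN : ∀ σ ε, |σ| ≤ r' → |ε| ≤ r' → M * (|σ| + |ε|) ≤ r := by
    intro σ ε hσ hε
    calc M * (|σ| + |ε|) ≤ M * (r' + r') := by gcongr
      _ = r := by rw [hr']; field_simp; ring
  have hcont : ∀ ε, |ε| ≤ r' → ContinuousOn (fun σ => Ξ σ ε R.b - E σ ε) (Icc (-r') r') := by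
    intro ε hε
    refine ContinuousOn.sub ?_ (Continuous.continuousOn (by rw [hE]; fun_prop))
    have hL : LipschitzOnWith (Real.toNNReal (C * M)) (fun σ => Ξ σ ε R.b) (Icc (-r') r') := by
      refine LipschitzOnWith.of_dist_le_mul fun σ hσ σ' hσ' => ?_
      rw [Real.coe_toNNReal _ (by positivity), Real.dist_eq, Real.dist_eq, mul_assoc]
      have n1 := hN σ ε (abs_le.2 hσ) hε
      have n2 := hN σ' ε (abs_le.2 hσ') hε
      obtain ⟨m1, m2⟩ := hΞ σ ε n1
      obtain ⟨m3, m4⟩ := hΞ σ' ε n2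
      have hmono : ∀ {σ}, M * (|σ| + |ε|) ≤ r → R.PertLe (W σ ε) (Z σ ε) (E σ ε) r :=
        fun {σ} n => ⟨fun t ht => ((hle σ ε).control t ht).trans n, (hle σ ε).left.trans n,
          (hle σ ε).right.trans n⟩
      have hd := hle (σ - σ') 0
      simp only [abs_zero, add_zero] at hd
      refine hlip _ _ _ _ _ _ _ _ (M * |σ - σ'|) (hmono n1) (hmono n2) m1 m3
        (fun t ht => (m2 t ht).trans (by gcongr)) (fun t ht => (m4 t ht).trans (by gcongr))
        ⟨fun t ht => ?_, ?_, ?_⟩ _ hbIcc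
      · convert hd.control t ht using 2
        simp only [hW]; ring
      · convert hd.left using 2
        simp only [hZ]; ring
      · convert hd.right using 2
        simp only [hE]; ring
    exact hL.continuousOn
  have key := mul_eq_mul_of_constrained_min (C := fun σ ε => Ξ σ ε R.b - E σ ε)
    (J := fun σ ε => θ * R.costIncr f (W σ ε) (Z σ ε) (E σ ε) (Ξ σ ε)) (r := r')
    (c₁ := R.lagrangeVar f g 0 p₀ ω₁ z₁ s₁) (c₂ := R.lagrangeVar f g 0 p₀ ω₂ z₂ s₂)
    (j₁ := θ * R.lagrangeVar f g 1 p₁ ω₁ z₁ s₁) (j₂ := θ * R.lagrangeVar f g 1 p₁ ω₂ z₂ s₂)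
    hr'0 hcont
    (by
      intro κ hκ
      obtain ⟨δ, hδ, h⟩ := hexpand hp₀ κ hκ
      refine ⟨δ, hδ, fun σ ε hσ => ?_⟩
      have := h σ ε hσ
      rwa [hp₀b, one_mul, zero_mul, add_zero] at this)
    (by
      intro κ hκ
      obtain ⟨δ, hδ, h⟩ := hexpand hp₁ κ hκ
      refine ⟨δ, hδ, fun σ ε hσ => ?_⟩
      have h1 := h σ ε hσ
      rw [hp₁b, zero_mul, zero_add, one_mul] at h1
      rw [mul_assoc, mul_assoc, ← mul_add, ← mul_sub, abs_mul, hθ, one_mul]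
      exact h1)
    (by
      obtain ⟨δ, hδ, h⟩ := hmin
      set D := 1 + C * (C + 1) * (1 + (R.b - R.A)) with hD
      have hAb : 0 ≤ R.b - R.A := sub_nonneg.2 R.spans.lt.le
      have hD0 : 0 < D := by positivity
      refine ⟨min (r / M) (δ / (D * M)), by positivity, fun σ ε hσ h0 => ?_⟩
      have k1 : M * (|σ| + |ε|) ≤ r := by
        have := hσ.trans_le (min_le_left _ _)
        rw [lt_div_iff₀ hM0, mul_comm] at this
        exact this.le
      have k2 : D * (M * (|σ| + |ε|)) ≤ δ := by
        have := hσ.trans_le (min_le_right _ _)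
        rw [lt_div_iff₀ (by positivity)] at this
        linarith
      obtain ⟨m1, m2⟩ := hΞ σ ε k1
      have hs := m1.small hC hincr (hle σ ε) k1 m2
      exact h σ ε _ m1 ⟨fun t ht => (hs.state t ht).trans k2, fun t ht => (hs.deriv t ht).trans k2,
        fun t ht => (hs.control t ht).trans k2⟩ (sub_eq_zero.1 h0))
    hne
  have hθ0 : θ ≠ 0 := by
    rintro rfl
    simp at hθ
  refine mul_left_cancel₀ hθ0 ?_
  rw [← mul_assoc, key, mul_assoc]

end Trajectory

end TimeScale

open TimeScale

/-! ### The control problem -/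

namespace ControlProblem

open MeasureTheory intervalIntegral

variable {P : ControlProblem} {x u y w p ω ξ : ℝ → ℝ} {l z s t δ : ℝ}

namespace StandingAssumptions

theorem spans (hP : P.StandingAssumptions) : Spans P.S P.A P.b where
  closed := hP.closed.inter isClosed_Icc
  left_mem := ⟨hP.A_mem, le_rfl, hP.A_le_a.trans hP.a_lt_b.le⟩
  right_mem := ⟨hP.b_mem, hP.A_le_a.trans hP.a_lt_b.le, le_rfl⟩
  lt := hP.A_le_a.trans_lt hP.a_lt_b
  subset := inter_subset_right

theorem a_mem_S (hP : P.StandingAssumptions) : P.a ∈ P.S := ⟨hP.a_mem, hP.A_le_a, hP.a_lt_b.le⟩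

theorem sigma_a (hP : P.StandingAssumptions) : sigma P.I P.a = sigma P.S P.a := by
  have h : P.I ∩ Ioi P.a = P.S ∩ Ioi P.a := by
    ext t
    simp only [I, S, mem_inter_iff, mem_Icc, mem_Ioi]
    constructor
    · rintro ⟨⟨h1, h2, h3⟩, h4⟩
      exact ⟨⟨h1, hP.A_le_a.trans h2, h3⟩, h4⟩
    · rintro ⟨⟨h1, h2, h3⟩, h4⟩
      exact ⟨⟨h1, h4.le, h3⟩, h4⟩
  unfold sigma
  rw [h]

theorem mem_S_of_mem_K (hP : P.StandingAssumptions) (ht : t ∈ P.K) : t ∈ P.S :=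
  ⟨ht.1.1.1, hP.A_le_a.trans ht.1.1.2.1, ht.1.1.2.2⟩

theorem sigma_eq_of_mem_K (hP : P.StandingAssumptions) (ht : t ∈ P.K) (hta : t = P.a) :
    sigma P.S t = t := by
  subst hta
  rw [← hP.sigma_a]
  refine le_antisymm (not_lt.1 fun h => ht.1.2 ⟨⟨ht.1.1, fun r hr => hr.2.1⟩, h⟩) (le_sigma _ _)

end StandingAssumptions

/-- An admissible pair as a trajectory. -/
def trajectory (hP : P.StandingAssumptions) (h : P.Admissible x u) : Trajectory where
  S := P.S
  A := P.A
  a := P.a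
  b := P.b
  x := x
  u := u
  spans := hP.spans
  a_mem := hP.a_mem_S
  a_lt := hP.a_lt_b
  x_cont := h.state.continuousOn hP.spans
  u_ld := h.control

theorem ldContinuous_rho (hP : P.StandingAssumptions) {Φ : ℝ → ℝ → ℝ → ℝ → ℝ → ℝ}
    (hΦ : LdFamily P.S Φ) (hx : LdContinuous P.S x) (hu : LdContinuous P.S u) (α β : ℝ) :
    LdContinuous P.S fun t => Φ t (x (rho P.S t)) (u (rho P.S t)) α β := by
  refine (hΦ.ldContinuous_path hP.spans.closed hP.spans.left_mem hx hu α β).congr fun t ht => ?_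
  have h1 := (hP.spans.subset (rho_mem hP.spans.closed ht)).1
  simp only [uncurry4, path, back_of_le_rho h1, max_eq_left (hP.spans.subset ht).1]

theorem along_eq (hP : P.StandingAssumptions) (h : P.Admissible x u)
    (Φ : ℝ → ℝ → ℝ → ℝ → ℝ → ℝ) (ht : P.a ≤ rho P.S t) :
    (trajectory hP h).along Φ t = Φ t (x (rho P.S t)) (u (rho P.S t)) (x P.a) (x P.b) := by
  simp only [Trajectory.along, Trajectory.args, uncurry4, path, trajectory, back_of_le_rho ht,
    max_eq_left (ht.trans (rho_le P.S t))]

theorem incr_eq (hP : P.StandingAssumptions) (h : P.Admissible x u)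
    (Φ : ℝ → ℝ → ℝ → ℝ → ℝ → ℝ) (ht : P.a ≤ rho P.S t) :
    (trajectory hP h).incr Φ t ((trajectory hP h).pert ξ ω z s t) =
      Φ t (x (rho P.S t) + ξ (rho P.S t)) (u (rho P.S t) + ω (rho P.S t)) (x P.a + z) (x P.b + s) -
      Φ t (x (rho P.S t)) (u (rho P.S t)) (x P.a) (x P.b) := by
  simp only [Trajectory.incr, Trajectory.pert, Trajectory.delay, Trajectory.args, uncurry4, path,
    trajectory, back_of_le_rho ht, max_eq_left (ht.trans (rho_le P.S t)), Prod.fst_add,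
    Prod.snd_add]

theorem le_rho_ceil (hP : P.StandingAssumptions) {τ : ℝ} (hτ : τ ∈ Ioc P.a P.b) :
    P.a ≤ rho P.S (ceil P.S τ) :=
  le_rho hP.a_mem_S (hτ.1.trans_le (hP.spans.le_ceil hτ.2))

theorem objective_eq (hP : P.StandingAssumptions) (hy : LdContinuous P.S y)
    (hw : LdContinuous P.S w) : P.objective y w = ∫ τ in P.a..P.b,
      P.f (ceil P.S τ) (y (rho P.S (ceil P.S τ))) (w (rho P.S (ceil P.S τ))) (y P.a) (y P.b) :=
  nablaIntegral_eq hP.spans (ldContinuous_rho hP hP.regular_f.ldFamily hy hw _ _) hP.a_mem_S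
    hP.spans.right_mem

/-- A response that hits its final state gives an admissible pair. -/
theorem admissible_add (hP : P.StandingAssumptions) (h : P.Admissible x u)
    (hξ : (trajectory hP h).IsResponse P.g ω z s ξ) (hξb : ξ P.b = s)
    (hz : P.xa ≠ none → z = 0) (hs : P.xb ≠ none → s = 0) :
    P.Admissible (fun t => x t + ξ t) (fun t => u t + ω t) := by
  have hg := hP.regular_g.ldFamily
  have hξa : ξ P.a = z := hξ.apply_a
  have hξd : ∀ t ∈ P.S, HasNablaDerivAt P.S ξ _ t := fun t ht => hξ.hasNablaDerivAt hg ht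
  refine ⟨?_, h.control.add hξ.control, fun t ht => ?_, fun c hc => ?_, fun c hc => ?_⟩
  · exact c1ld_of_hasNablaDerivAt hP.spans
      (h.state.2.add (Trajectory.ldContinuous_incr hg hξ.contOn hξ.control z s))
      fun t ht => (h.state.hasNablaDerivAt hP.spans ht).add (hξd t ht.1)
  · have h1 := (h.dynamics t ht).add (hξd t (hP.mem_S_of_mem_K ht))
    rw [incr_eq hP h P.g ht.2, add_sub_cancel] at h1
    rwa [hξa, hξb]
  · rw [hξa, hz (by simp [hc]), add_zero]
    exact h.left c hc
  · rw [hξb, hs (by simp [hc]), add_zero]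
    exact h.right c hc

theorem objective_add_sub (hP : P.StandingAssumptions) (h : P.Admissible x u)
    (hξ : (trajectory hP h).IsResponse P.g ω z s ξ) (hξb : ξ P.b = s) :
    P.objective (fun t => x t + ξ t) (fun t => u t + ω t) - P.objective x u =
      (trajectory hP h).costIncr P.f ω z s ξ := by
  have hx := (h.state.continuousOn hP.spans).ldContinuous
  have hξc : ContinuousOn ξ P.S := hξ.contOn
  have hξa : ξ P.a = z := hξ.apply_a
  have ha := hP.spans.subset hP.a_mem_S
  have hb := hP.spans.subset hP.spans.right_mem
  rw [objective_eq hP (hx.add hξc.ldContinuous) (h.control.add hξ.control),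
    objective_eq hP hx h.control, ← integral_sub
      ((ldContinuous_rho hP hP.regular_f.ldFamily (hx.add hξc.ldContinuous)
        (h.control.add hξ.control) _ _).intervalIntegrable hP.spans ha hb)
      ((ldContinuous_rho hP hP.regular_f.ldFamily hx h.control _ _).intervalIntegrable
        hP.spans ha hb)]
  refine integral_congr_ae (Eventually.of_forall fun τ hτ => ?_)
  rw [uIoc_of_le hP.a_lt_b.le] at hτ
  simp only [hξa, hξb]
  exact (incr_eq hP h P.f (le_rho_ceil hP hτ)).symm

theorem pairDist_le (hP : P.StandingAssumptions) (h : P.Admissible x u)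
    (hξ : (trajectory hP h).IsResponse P.g ω z s ξ) (hδ : 0 ≤ δ)
    (hs : (trajectory hP h).Small P.g ω z s ξ δ) :
    P.pairDist (fun t => x t + ξ t) (fun t => u t + ω t) x u ≤ 3 * δ := by
  have hρ : ∀ t ∈ P.S, rho P.S t ∈ P.S := fun t ht => rho_mem hP.spans.closed ht
  have h1 : supRho P.S ξ ≤ δ := by
    refine Real.sSup_le ?_ hδ
    rintro _ ⟨t, ht, rfl⟩
    exact hs.state _ (hρ t ht)
  have h2 : supRho P.S ω ≤ δ := by
    refine Real.sSup_le ?_ hδ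
    rintro _ ⟨t, ht, rfl⟩
    exact hs.control _ (hρ t ht)
  have h3 : sSup ((fun t => |nablaDeriv P.S ξ t|) '' kappa P.S) ≤ δ := by
    refine Real.sSup_le ?_ hδ
    rintro _ ⟨t, ht, rfl⟩
    simp only
    have hd : HasNablaDerivAt P.S ξ _ t := hξ.hasNablaDerivAt hP.regular_g.ldFamily ht.1
    rw [hd.nablaDeriv_eq hP.spans ht]
    exact hs.deriv t ht.1
  unfold pairDist normOne
  simp only [add_sub_cancel_left]
  linarith

/-! ### Derivatives of the Hamiltonian -/

section Hamiltonian

variable (hP : P.StandingAssumptions)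
include hP

theorem deriv_H_x (ht : t ∈ P.S) (l x v q z s : ℝ) :
    deriv (fun r => P.H l t r v q z s) x = l * dx P.f t x v z s + q * dx P.g t x v z s :=
  (((hP.regular_f.hasDerivAt_x ht x v z s).differentiableAt.hasDerivAt.const_mul l).add
    ((hP.regular_g.hasDerivAt_x ht x v z s).differentiableAt.hasDerivAt.const_mul q)).deriv

theorem deriv_H_v (ht : t ∈ P.S) (l x v q z s : ℝ) :
    deriv (fun r => P.H l t x r q z s) v = l * dv P.f t x v z s + q * dv P.g t x v z s :=
  (((hP.regular_f.hasDerivAt_v ht x v z s).differentiableAt.hasDerivAt.const_mul l).add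
    ((hP.regular_g.hasDerivAt_v ht x v z s).differentiableAt.hasDerivAt.const_mul q)).deriv

theorem deriv_H_z (ht : t ∈ P.S) (l x v q z s : ℝ) :
    deriv (fun r => P.H l t x v q r s) z = l * dz P.f t x v z s + q * dz P.g t x v z s :=
  (((hP.regular_f.hasDerivAt_z ht x v z s).differentiableAt.hasDerivAt.const_mul l).add
    ((hP.regular_g.hasDerivAt_z ht x v z s).differentiableAt.hasDerivAt.const_mul q)).deriv

theorem deriv_H_s (ht : t ∈ P.S) (l x v q z s : ℝ) :
    deriv (fun r => P.H l t x v q z r) s = l * ds P.f t x v z s + q * ds P.g t x v z s :=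
  (((hP.regular_f.hasDerivAt_s ht x v z s).differentiableAt.hasDerivAt.const_mul l).add
    ((hP.regular_g.hasDerivAt_s ht x v z s).differentiableAt.hasDerivAt.const_mul q)).deriv

theorem hamil_eq (h : P.Admissible x u) (F G : ℝ → ℝ → ℝ → ℝ → ℝ → ℝ) (ht : P.a ≤ rho P.S t) :
    (trajectory hP h).hamil F G l p t =
      l * F t (x (rho P.S t)) (u (rho P.S t)) (x P.a) (x P.b) +
      p t * G t (x (rho P.S t)) (u (rho P.S t)) (x P.a) (x P.b) := by
  have hm : max t (trajectory hP h).a = t := max_eq_left (ht.trans (rho_le P.S t))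
  unfold Trajectory.hamil
  rw [along_eq hP h F ht, along_eq hP h G ht, hm]

theorem nablaIntegral_hamil (h : P.Admissible x u) {F G : ℝ → ℝ → ℝ → ℝ → ℝ → ℝ}
    (hF : LdFamily P.S F) (hG : LdFamily P.S G) (hp : ContinuousOn p P.S) {k : ℝ → ℝ}
    (hk : ∀ t ∈ P.S, k t = l * F t (x (rho P.S t)) (u (rho P.S t)) (x P.a) (x P.b) +
      p t * G t (x (rho P.S t)) (u (rho P.S t)) (x P.a) (x P.b)) :
    nablaIntegral P.S k P.a P.b =
      ∫ τ in P.a..P.b, (trajectory hP h).hamil F G l p (ceil P.S τ) := by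
  have hx := (h.state.continuousOn hP.spans).ldContinuous
  have hld : LdContinuous P.S k :=
    (((ldContinuous_rho hP hF hx h.control _ _).const_mul l).add
      (hp.ldContinuous.mul (ldContinuous_rho hP hG hx h.control _ _))).congr hk
  rw [nablaIntegral_eq hP.spans hld hP.a_mem_S hP.spans.right_mem]
  refine integral_congr_ae (Eventually.of_forall fun τ hτ => ?_)
  rw [uIoc_of_le hP.a_lt_b.le] at hτ
  rw [hk _ (hP.spans.ceil_mem hτ.2), hamil_eq hP h F G (le_rho_ceil hP hτ)]

end Hamiltonian

/-! ### From vanishing first variations to the conditions on the costate -/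

section Conditions

variable (hP : P.StandingAssumptions) (h : P.Admissible x u)
  (hp : (trajectory hP h).IsCostate P.f P.g l p)
include hp

theorem adjoint_of_isCostate (ht : t ∈ P.K) : HasNablaDerivAt P.S p
    (-deriv (fun r => P.H l t r (u (rho P.S t)) (p t) (x P.a) (x P.b)) (x (rho P.S t))) t := by
  have ht' := hP.mem_S_of_mem_K ht
  rw [deriv_H_x hP ht', ← hamil_eq hP h _ _ ht.2]
  exact hp t ht'

variable (hvar : ∀ ω z s, LdContinuous P.S ω → (P.xa ≠ none → z = 0) → (P.xb ≠ none → s = 0) →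
  (trajectory hP h).lagrangeVar P.f P.g l p ω z s = 0)
include hvar

theorem stationary_of_lagrangeVar_eq_zero (ht : t ∈ P.K) :
    deriv (fun r => P.H l t (x (rho P.S t)) r (p t) (x P.a) (x P.b)) (u (rho P.S t)) = 0 := by
  have ht' := hP.mem_S_of_mem_K ht
  rw [deriv_H_v hP ht', ← hamil_eq hP h _ _ ht.2]
  refine Trajectory.eq_zero_of_integral_mul_eq_zero (R := trajectory hP h)
    (Trajectory.ldContinuous_hamil hP.regular_f.ldFamily_dv hP.regular_g.ldFamily_dv l
      hp.continuousOn) (fun ω hω => ?_) ht' ht.2 (hP.sigma_eq_of_mem_K ht)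
  have := hvar ω 0 0 hω (fun _ => rfl) (fun _ => rfl)
  simpa [Trajectory.lagrangeVar, Trajectory.firstVar] using this

theorem left_of_lagrangeVar_eq_zero (ha : P.xa = none) :
    p P.a = -nablaIntegral P.S (fun t => deriv (fun r =>
      P.H l t (x (rho P.S t)) (u (rho P.S t)) (p t) r (x P.b)) (x P.a)) P.a P.b := by
  rw [nablaIntegral_hamil hP h hP.regular_f.ldFamily_dz hP.regular_g.ldFamily_dz hp.continuousOn
    fun t ht => deriv_H_z hP ht _ _ _ _ _ _]
  have := hvar (fun _ => 0) 1 0 (ldContinuous_const 0) (fun hn => absurd ha hn) (fun _ => rfl)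
  simp only [Trajectory.lagrangeVar, Trajectory.firstVar, mul_zero, mul_one,
    intervalIntegral.integral_zero, zero_add, add_zero, sub_zero] at this
  exact eq_neg_of_add_eq_zero_left this

theorem right_of_lagrangeVar_eq_zero (hb : P.xb = none) :
    p P.b = nablaIntegral P.S (fun t => deriv (fun r =>
      P.H l t (x (rho P.S t)) (u (rho P.S t)) (p t) (x P.a) r) (x P.b)) P.a P.b := by
  rw [nablaIntegral_hamil hP h hP.regular_f.ldFamily_ds hP.regular_g.ldFamily_ds hp.continuousOn
    fun t ht => deriv_H_s hP ht _ _ _ _ _ _]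
  have := hvar (fun _ => 0) 0 1 (ldContinuous_const 0) (fun _ => rfl) (fun hn => absurd hb hn)
  simp only [Trajectory.lagrangeVar, Trajectory.firstVar, mul_zero, mul_one,
    intervalIntegral.integral_zero, zero_add, add_zero] at this
  exact (sub_eq_zero.1 this).symm

end Conditions

theorem IsExtremizer.admissible (h : P.IsExtremizer x u) : P.Admissible x u :=
  h.elim (fun h => h.1) fun h => h.1

/-- An extremizer is minimal, for the cost multiplied by `θ = 1` or `θ = -1`, among the pairs that
small responses give. -/
theorem exists_sign_costIncr (hP : P.StandingAssumptions) (hex : P.IsExtremizer x u) :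
    ∃ θ : ℝ, |θ| = 1 ∧ ∃ δ > 0, ∀ ω z s ξ, (P.xa ≠ none → z = 0) → (P.xb ≠ none → s = 0) →
      (trajectory hP hex.admissible).IsResponse P.g ω z s ξ →
      (trajectory hP hex.admissible).Small P.g ω z s ξ δ → ξ P.b = s →
      0 ≤ θ * (trajectory hP hex.admissible).costIncr P.f ω z s ξ := by
  have hadm := hex.admissible
  rcases hex with hmin | hmax
  · obtain ⟨-, δ, hδ, h⟩ := hmin
    refine ⟨1, abs_one, δ / 4, by positivity, fun ω z s ξ hz hs hξ hsmall hξb => ?_⟩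
    have h1 := h _ _ (admissible_add hP hadm hξ hξb hz hs)
      ((pairDist_le hP hadm hξ (by positivity) hsmall).trans_lt (by linarith))
    rw [← objective_add_sub hP hadm hξ hξb, one_mul]
    exact sub_nonneg.2 h1
  · obtain ⟨-, δ, hδ, h⟩ := hmax
    refine ⟨-1, by simp, δ / 4, by positivity, fun ω z s ξ hz hs hξ hsmall hξb => ?_⟩
    have h1 := h _ _ (admissible_add hP hadm hξ hξb hz hs)
      ((pairDist_le hP hadm hξ (by positivity) hsmall).trans_lt (by linarith))
    rw [← objective_add_sub hP hadm hξ hξb]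
    linarith

/-- The multiplier rule for a normal extremizer: the Lagrangian is stationary for all variations
that respect the endpoint conditions. -/
theorem exists_isCostate_lagrangeVar_eq_zero (hP : P.StandingAssumptions)
    (hex : P.IsExtremizer x u) (hnormal : ¬ ∃ p, P.IsAbnormalCostate x u p) :
    ∃ p, (trajectory hP hex.admissible).IsCostate P.f P.g 1 p ∧
      ∀ ω z s, LdContinuous P.S ω → (P.xa ≠ none → z = 0) → (P.xb ≠ none → s = 0) →
        (trajectory hP hex.admissible).lagrangeVar P.f P.g 1 p ω z s = 0 := by
  have hadm := hex.admissible
  set R := trajectory hP hadm with hR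
  have hf : IsRegular R.S P.f := hP.regular_f
  have hg : IsRegular R.S P.g := hP.regular_g
  obtain ⟨p₀, hp₀, hp₀b⟩ := Trajectory.exists_isCostate hf hg 0 1
  obtain ⟨p₁, hp₁, hp₁b⟩ := Trajectory.exists_isCostate hf hg 1 0
  -- otherwise `p₀` is an abnormal costate
  obtain ⟨ω₁, z₁, s₁, hω₁, hz₁, hs₁, hne⟩ : ∃ ω z s, LdContinuous P.S ω ∧
      (P.xa ≠ none → z = 0) ∧ (P.xb ≠ none → s = 0) ∧
      R.lagrangeVar P.f P.g 0 p₀ ω z s ≠ 0 := by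
    by_contra! hvar
    refine hnormal ⟨p₀, hp₀.c1ld hf hg, ⟨P.b, ⟨hP.b_mem, hP.a_lt_b.le, le_rfl⟩, ?_⟩,
      fun t ht => adjoint_of_isCostate hP hadm hp₀ ht,
      fun t ht => stationary_of_lagrangeVar_eq_zero hP hadm hp₀ hvar ht,
      left_of_lagrangeVar_eq_zero hP hadm hp₀ hvar,
      right_of_lagrangeVar_eq_zero hP hadm hp₀ hvar⟩
    have : p₀ P.b = 1 := hp₀b
    rw [this]
    exact one_ne_zero
  obtain ⟨θ, hθ, δ, hδ, hmin⟩ := exists_sign_costIncr hP hex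
  refine ⟨fun t => p₁ t + -(R.lagrangeVar P.f P.g 1 p₁ ω₁ z₁ s₁ /
    R.lagrangeVar P.f P.g 0 p₀ ω₁ z₁ s₁) * p₀ t, hp₁.add_const_mul hp₀ _, ?_⟩
  intro ω z s hω hz hs
  have key := Trajectory.lagrangeVar_mul_eq hf hg hp₀ hp₀b hp₁ hp₁b hω₁ hω hθ
    (z₁ := z₁) (z₂ := z) (s₁ := s₁) (s₂ := s)
    ⟨δ, hδ, fun σ ε ξ hξ hsmall hξb => hmin _ _ _ ξ
      (fun hn => by rw [hz₁ hn, hz hn]; ring) (fun hn => by rw [hs₁ hn, hs hn]; ring)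
      hξ hsmall hξb⟩ hne
  rw [Trajectory.lagrangeVar_add_const_mul hf hg hp₁.continuousOn hp₀.continuousOn hω,
    neg_mul, div_mul_eq_mul_div, ← key, mul_div_cancel_right₀ _ hne, add_neg_cancel]

end ControlProblem

theorem theorem2 (P : ControlProblem) (hP : P.StandingAssumptions) (x u : ℝ → ℝ)
    (hxu : P.IsNormalExtremizer x u) :
    ∃ p : ℝ → ℝ, TimeScale.C1ld P.S p ∧
      (∀ t ∈ P.K,
        TimeScale.HasNablaDerivAt P.S x
          (deriv (fun r => P.H 1 t (x (TimeScale.rho P.S t)) (u (TimeScale.rho P.S t)) r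
            (x P.a) (x P.b)) (p t)) t ∧
        TimeScale.HasNablaDerivAt P.S p
          (-deriv (fun r => P.H 1 t r (u (TimeScale.rho P.S t)) (p t)
            (x P.a) (x P.b)) (x (TimeScale.rho P.S t))) t ∧
        deriv (fun r => P.H 1 t (x (TimeScale.rho P.S t)) r (p t)
            (x P.a) (x P.b)) (u (TimeScale.rho P.S t)) = 0) ∧
      (P.xa = none → p P.a = -TimeScale.nablaIntegral P.S (fun t =>
        deriv (fun r => P.H 1 t (x (TimeScale.rho P.S t)) (u (TimeScale.rho P.S t)) (p t)
          r (x P.b)) (x P.a)) P.a P.b) ∧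
      (P.xb = none → p P.b = TimeScale.nablaIntegral P.S (fun t =>
        deriv (fun r => P.H 1 t (x (TimeScale.rho P.S t)) (u (TimeScale.rho P.S t)) (p t)
          (x P.a) r) (x P.b)) P.a P.b) := by
  obtain ⟨hex, hnormal⟩ := hxu
  have hadm := hex.admissible
  obtain ⟨p, hp, hvar⟩ := ControlProblem.exists_isCostate_lagrangeVar_eq_zero hP hex hnormal
  refine ⟨p, hp.c1ld hP.regular_f hP.regular_g, fun t ht => ⟨?_,
    ControlProblem.adjoint_of_isCostate hP hadm hp ht,
    ControlProblem.stationary_of_lagrangeVar_eq_zero hP hadm hp hvar ht⟩,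
    ControlProblem.left_of_lagrangeVar_eq_zero hP hadm hp hvar,
    ControlProblem.right_of_lagrangeVar_eq_zero hP hadm hp hvar⟩
  have hd : ∀ v z s y q : ℝ, deriv (fun r => P.H 1 t y v r z s) q = P.g t y v z s := by
    intro v z s y q
    have h1 : HasDerivAt (fun r : ℝ => 1 * P.f t y v z s + r * P.g t y v z s)
        (1 * P.g t y v z s) q := ((hasDerivAt_id q).mul_const _).const_add _
    exact h1.deriv.trans (one_mul _)
  rw [hd]
  exact hadm.dynamics t ht
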